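/- Let $q>0$ be a real transcendental number, $n,m\ge 1$, $V=\mathbb C^n$, $W=\mathbb C^m$, and let $\bar X=V\otimes W$ with basis $x_{ij}=v_i\otimes w_j$; we write $x_a$, $a\in B=\{1,\dots,n\}\times\{1,\dots,m\}$, in lexicographic order. Let $\hat R_V$ be the standard $\hat R$-matrix on $V\otimes V$, with entries $\hat R^{ij}_{kl}=q^{\delta_{ij}}\delta_{il}\delta_{jk}+(q-q^{-1})\delta_{ik}\delta_{jl}\theta(j-i)$, where $\theta(t)=1$ if $t>0$ and $0$ otherwise, and $\hat R_W$ likewise. Let $\hat R_{\bar X}=\hat R_V\otimes\hat R_W$ acting on $\bar X\otimes\bar X\cong (V\otimes V)\otimes(W\otimes W)$; it is diagonalizable with eigenvalues among $q^2,-1,q^{-2}$. Let $P_-$ be the spectral projection onto its $(-1)$-eigenspace and $P_+=I-P_-$. Let $\wedge_q[\bar X]$ be the $\mathbb C$-algebra generated by the entries $x_a$ of $\mathbf x$ with the relations $P_+\mathbf x_1\mathbf x_2=0$, and $\wedge^r_q[\bar X]$ its degree $r$ component. Let $\mathcal O(M_q(\bar X))$ be the $\mathbb C$-algebra generated by the entries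 of an $nm\times nm$ matrix $\mathbf u=(u_{ab})_{a,b\in B}$ with the relations $P_+(\mathbf u\otimes\mathbf u)=(\mathbf u\otimes\mathbf u)P_+$. Let $\phi_L:\wedge_q[\bar X]\to\mathcal O(M_q(\bar X))\otimes\wedge_q[\bar X]$ and $\phi_R:\wedge_q[\bar X]\to\wedge_q[\bar X]\otimes\mathcal O(M_q(\bar X))$ be the algebra homomorphisms with $\phi_L(x_a)=\sum_b u_{ab}\otimes x_b$ and $\phi_R(x_b)=\sum_a x_a\otimes u_{ab}$. Let $\omega$ be the product of all the $x_a$ in lexicographic order. Then: (1) $\wedge^{nm}_q[\bar X]$ is one-dimensional, and for all $r,s\ge 0$ with $r+s=nm$ the multiplication pairing $\wedge^r_q[\bar X]\otimes\wedge^{s}_q[\bar X]\to\wedge^{nm}_q[\bar X]$ is nondegenerate. There is a unique $D^L\in\mathcal O(M_q(\bar X))$ with $\phi_L(\omega)=D^L\otimes\omega$ and a unique $D^R$ with $\phi_R(\omega)=\omega\otimes D^R$, and they coincide; put $D_q=D^L=D^R$ (the quantum determinant). (2) There is a cofactor matrix $\tilde{\mathbf u}$ over $\mathcal O(M_q(\bar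 X))$ with $$\tilde{\mathbf u}\,\mathbf u=\mathbf u\,\tilde{\mathbf u}=D_q I,$$ obtained from the pairings between degrees $1$ and $nm-1$ as follows: there are bases $(b_a)_{a\in B}$ and $(b'_a)_{a\in B}$ of $\wedge^{nm-1}_q[\bar X]$ with $x_a b_c=\delta_{ac}\,\omega$ and $b'_c x_a=\delta_{ac}\,\omega$ for all $a,c$, and with $\phi_L(b_c)=\sum_k \tilde u_{kc}\otimes b_k$ and $\phi_R(b'_c)=\sum_k b'_k\otimes\tilde u_{ck}$ for all $c$. (3) Let $\mathcal O(GL_q(\bar X))$ be the algebra obtained from $\mathcal O(M_q(\bar X))$ by adjoining a two-sided inverse $D_q^{-1}$ of $D_q$. There is a unique Hopf algebra structure on the algebra $\mathcal O(GL_q(\bar X))$ with, for all $a,b\in B$, $\Delta(u_{ab})=\sum_k u_{ak}\otimes u_{kb}$, $\epsilon(u_{ab})=\delta_{ab}$, $S(u_{ab})=\tilde u_{ab}D_q^{-1}$ and $S(D_q^{-1})=D_q$. -/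

import Mathlib

open scoped TensorProduct

noncomputable section

namespace QuantumKronecker

/-- The basis `v_i ⊗ w_j` of `X = V ⊗ W`, where `dim V = n` and `dim W = m`. -/
abbrev Idx (n m : ℕ) : Type := Fin n × Fin m

/-- The `R̂`-matrix of the standard quantum group of `ℂⁿ`, with entries
`R̂^{ij}_{kl} = q^{δ_ij} δ_il δ_jk + (q - q⁻¹) δ_ik δ_jl θ(j - i)`. -/
def RhatStd (n : ℕ) (q : ℝ) : Matrix (Fin n × Fin n) (Fin n × Fin n) ℂ :=
  Matrix.of fun a b =>
    (if a.1 = b.2 ∧ a.2 = b.1 then (if a.1 = a.2 then (q : ℂ) else 1) else 0) +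
      (if a.1 = b.1 ∧ a.2 = b.2 ∧ a.1 < a.2 then (q : ℂ) - (q : ℂ)⁻¹ else 0)

/-- `R̂_{X,X} = R̂_{V,V} ⊗ R̂_{W,W}`, acting on `X ⊗ X = (V ⊗ W) ⊗ (V ⊗ W)`. -/
def Rhat (n m : ℕ) (q : ℝ) : Matrix (Idx n m × Idx n m) (Idx n m × Idx n m) ℂ :=
  Matrix.of fun a b =>
    RhatStd n q (a.1.1, a.2.1) (b.1.1, b.2.1) * RhatStd m q (a.1.2, a.2.2) (b.1.2, b.2.2)

/-- The spectral projection `P₋` of `R̂_{X,X}` onto the eigenspace of the negative eigenvalue `-1`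
(the eigenvalues are `q²`, `-1`, `q⁻²`), given by Lagrange interpolation. -/
def Pminus (n m : ℕ) (q : ℝ) : Matrix (Idx n m × Idx n m) (Idx n m × Idx n m) ℂ :=
  ((-1 - (q : ℂ) ^ 2) * (-1 - ((q : ℂ) ^ 2)⁻¹))⁻¹ •
    ((Rhat n m q - ((q : ℂ) ^ 2) • (1 : Matrix _ _ ℂ)) *
      (Rhat n m q - (((q : ℂ) ^ 2)⁻¹) • (1 : Matrix _ _ ℂ)))

/-- The spectral projection `P₊` of `R̂_{X,X}` onto the sum of the eigenspaces of the positive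
eigenvalues `q²` and `q⁻²`. -/
def Pplus (n m : ℕ) (q : ℝ) : Matrix (Idx n m × Idx n m) (Idx n m × Idx n m) ℂ :=
  1 - Pminus n m q

theorem RhatStd_symm (n : ℕ) (q : ℝ) (a b : Fin n × Fin n) :
    RhatStd n q a b = RhatStd n q b a := by
  obtain ⟨a1, a2⟩ := a
  obtain ⟨b1, b2⟩ := b
  simp only [RhatStd, Matrix.of_apply]
  congr 1 <;> grind

theorem Rhat_transpose (n m : ℕ) (q : ℝ) : (Rhat n m q).transpose = Rhat n m q := by
  ext a b
  simp only [Rhat, Matrix.transpose_apply, Matrix.of_apply]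
  rw [RhatStd_symm n, RhatStd_symm m]

theorem Pplus_transpose (n m : ℕ) (q : ℝ) : (Pplus n m q).transpose = Pplus n m q := by
  simp only [Pplus, Pminus, Matrix.transpose_sub, Matrix.transpose_smul, Matrix.transpose_mul,
    Matrix.transpose_one, Rhat_transpose]
  congr 2
  simp only [sub_mul, mul_sub, smul_mul_assoc, mul_smul_comm, one_mul, mul_one, smul_sub]
  rw [smul_comm ((q : ℂ) ^ 2)⁻¹ ((q : ℂ) ^ 2)]
  abel

theorem Pplus_symm (n m : ℕ) (q : ℝ) (a b : Idx n m × Idx n m) :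
    Pplus n m q a b = Pplus n m q b a :=
  congrFun (congrFun (Pplus_transpose n m q) b) a

/-! ### The quantum exterior algebra -/

/-- The relations `P₊ x₁ x₂ = 0`. -/
inductive ExtRel (n m : ℕ) (q : ℝ) :
    FreeAlgebra ℂ (Idx n m) → FreeAlgebra ℂ (Idx n m) → Prop
  | rel (a : Idx n m × Idx n m) :
      ExtRel n m q
        (∑ e : Idx n m × Idx n m,
          Pplus n m q a e • (FreeAlgebra.ι ℂ e.1 * FreeAlgebra.ι ℂ e.2)) 0

/-- The quantum exterior algebra `∧_q[X]`. -/
def QExt (n m : ℕ) (q : ℝ) : Type := RingQuot (ExtRel n m q)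

instance (n m : ℕ) (q : ℝ) : Ring (QExt n m q) :=
  inferInstanceAs (Ring (RingQuot (ExtRel n m q)))

instance (n m : ℕ) (q : ℝ) : Algebra ℂ (QExt n m q) :=
  inferInstanceAs (Algebra ℂ (RingQuot (ExtRel n m q)))

/-- The generators `x_i` of `∧_q[X]`. -/
def QExt.x {n m : ℕ} {q : ℝ} (i : Idx n m) : QExt n m q :=
  RingQuot.mkAlgHom ℂ (ExtRel n m q) (FreeAlgebra.ι ℂ i)

/-- The degree `r` component `∧^r_q[X]`. -/
def extPow (n m : ℕ) (q : ℝ) (r : ℕ) : Submodule ℂ (QExt n m q) :=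
  (Submodule.span ℂ (Set.range (QExt.x (n := n) (m := m) (q := q)))) ^ r

/-- The multiplication pairing `∧^r_q[X] × ∧^s_q[X] → ∧^{r+s}_q[X]`. -/
def wedgePairing (n m : ℕ) (q : ℝ) (r s : ℕ) :
    extPow n m q r →ₗ[ℂ] extPow n m q s →ₗ[ℂ] extPow n m q (r + s) :=
  LinearMap.mk₂ ℂ
    (fun y z => ⟨(y : QExt n m q) * (z : QExt n m q), by
      have h := Submodule.mul_mem_mul y.2 z.2
      unfold extPow at h ⊢
      rwa [pow_add]⟩)
    (fun y y' z => Subtype.ext (add_mul _ _ _))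
    (fun c y z => Subtype.ext (smul_mul_assoc _ _ _))
    (fun y z z' => Subtype.ext (mul_add _ _ _))
    (fun c y z => Subtype.ext (mul_smul_comm _ _ _))

/-- The product `x_1 x_2 ⋯ x_{nm}` of all the generators `x_{ij}` in lexicographic order. -/
def topForm (n m : ℕ) (q : ℝ) : QExt n m q :=
  (List.ofFn fun k : Fin (n * m) => QExt.x (q := q) (finProdFinEquiv.symm k)).prod

/-! ### The quantum matrix space -/

/-- The relations `P₊ (u ⊗ u) = (u ⊗ u) P₊`. -/
inductive MatRel (n m : ℕ) (q : ℝ) :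
    FreeAlgebra ℂ (Idx n m × Idx n m) → FreeAlgebra ℂ (Idx n m × Idx n m) → Prop
  | rel (a b : Idx n m × Idx n m) :
      MatRel n m q
        (∑ e : Idx n m × Idx n m, Pplus n m q a e •
          (FreeAlgebra.ι ℂ (e.1, b.1) * FreeAlgebra.ι ℂ (e.2, b.2)))
        (∑ e : Idx n m × Idx n m, Pplus n m q e b •
          (FreeAlgebra.ι ℂ (a.1, e.1) * FreeAlgebra.ι ℂ (a.2, e.2)))

/-- The coordinate algebra `O(M_q(X))`. -/
def OM (n m : ℕ) (q : ℝ) : Type := RingQuot (MatRel n m q)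

instance (n m : ℕ) (q : ℝ) : Ring (OM n m q) :=
  inferInstanceAs (Ring (RingQuot (MatRel n m q)))

instance (n m : ℕ) (q : ℝ) : Algebra ℂ (OM n m q) :=
  inferInstanceAs (Algebra ℂ (RingQuot (MatRel n m q)))

/-- The generic matrix `u`. -/
def OM.u (n m : ℕ) (q : ℝ) : Matrix (Idx n m) (Idx n m) (OM n m q) :=
  Matrix.of fun i j => RingQuot.mkAlgHom ℂ (MatRel n m q) (FreeAlgebra.ι ℂ (i, j))

theorem QExt.rel {n m : ℕ} {q : ℝ} (a : Idx n m × Idx n m) :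
    ∑ e : Idx n m × Idx n m,
      Pplus n m q a e • (QExt.x e.1 * QExt.x e.2 : QExt n m q) = 0 := by
  have h := RingQuot.mkAlgHom_rel ℂ (ExtRel.rel (n := n) (m := m) (q := q) a)
  simp only [map_sum, map_smul, map_mul, map_zero] at h
  exact h

theorem OM.rel {n m : ℕ} {q : ℝ} (a b : Idx n m × Idx n m) :
    ∑ e : Idx n m × Idx n m, Pplus n m q a e • (OM.u n m q e.1 b.1 * OM.u n m q e.2 b.2) =
      ∑ e : Idx n m × Idx n m, Pplus n m q e b • (OM.u n m q a.1 e.1 * OM.u n m q a.2 e.2) := by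
  have h := RingQuot.mkAlgHom_rel ℂ (MatRel.rel (n := n) (m := m) (q := q) a b)
  simp only [map_sum, map_smul, map_mul] at h
  exact h

theorem sum_tmul_mul_sum_tmul {ι A B : Type*} [Fintype ι] [Ring A] [Algebra ℂ A] [Ring B]
    [Algebra ℂ B] (f f' : ι → A) (g g' : ι → B) :
    (∑ i, f i ⊗ₜ[ℂ] g i) * (∑ i, f' i ⊗ₜ[ℂ] g' i) =
      ∑ b : ι × ι, (f b.1 * f' b.2) ⊗ₜ[ℂ] (g b.1 * g' b.2) := by
  rw [Finset.sum_mul_sum, Fintype.sum_prod_type]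
  simp only [Algebra.TensorProduct.tmul_mul_tmul]

theorem coactL_aux {n m : ℕ} {q : ℝ} (a : Idx n m × Idx n m) :
    ∑ e : Idx n m × Idx n m, Pplus n m q a e •
      ((∑ j, OM.u n m q e.1 j ⊗ₜ[ℂ] (QExt.x j : QExt n m q)) *
        (∑ j, OM.u n m q e.2 j ⊗ₜ[ℂ] (QExt.x j : QExt n m q))) = 0 := by
  simp only [sum_tmul_mul_sum_tmul, Finset.smul_sum]
  rw [Finset.sum_comm]
  have h (b : Idx n m × Idx n m) :
      ∑ e : Idx n m × Idx n m, Pplus n m q a e •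
        ((OM.u n m q e.1 b.1 * OM.u n m q e.2 b.2) ⊗ₜ[ℂ]
          (QExt.x b.1 * QExt.x b.2 : QExt n m q)) =
      ∑ e : Idx n m × Idx n m, (OM.u n m q a.1 e.1 * OM.u n m q a.2 e.2) ⊗ₜ[ℂ]
          (Pplus n m q e b • (QExt.x b.1 * QExt.x b.2 : QExt n m q)) := by
    simp only [TensorProduct.smul_tmul', ← TensorProduct.sum_tmul, OM.rel,
      ← TensorProduct.smul_tmul]
  simp only [h]
  rw [Finset.sum_comm]
  simp only [← TensorProduct.tmul_sum, QExt.rel, TensorProduct.tmul_zero, Finset.sum_const_zero]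

theorem coactR_aux {n m : ℕ} {q : ℝ} (a : Idx n m × Idx n m) :
    ∑ e : Idx n m × Idx n m, Pplus n m q a e •
      ((∑ i, (QExt.x i : QExt n m q) ⊗ₜ[ℂ] OM.u n m q i e.1) *
        (∑ i, (QExt.x i : QExt n m q) ⊗ₜ[ℂ] OM.u n m q i e.2)) = 0 := by
  simp only [sum_tmul_mul_sum_tmul, Finset.smul_sum]
  rw [Finset.sum_comm]
  have h (b : Idx n m × Idx n m) :
      ∑ e : Idx n m × Idx n m, Pplus n m q a e •
        ((QExt.x b.1 * QExt.x b.2 : QExt n m q) ⊗ₜ[ℂ]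
          (OM.u n m q b.1 e.1 * OM.u n m q b.2 e.2)) =
      ∑ e : Idx n m × Idx n m,
        (Pplus n m q e b • (QExt.x b.1 * QExt.x b.2 : QExt n m q)) ⊗ₜ[ℂ]
          (OM.u n m q e.1 a.1 * OM.u n m q e.2 a.2) := by
    simp only [← TensorProduct.tmul_smul, ← TensorProduct.tmul_sum, TensorProduct.smul_tmul]
    rw [Finset.sum_congr rfl (fun e _ => by rw [Pplus_symm n m q a e]), ← OM.rel]
    rw [Finset.sum_congr rfl (fun e _ => by rw [Pplus_symm n m q b e])]
  simp only [h]
  rw [Finset.sum_comm]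
  simp only [← TensorProduct.sum_tmul, QExt.rel, TensorProduct.zero_tmul, Finset.sum_const_zero]

/-- The left coaction `φ_L`, the algebra map with `x_i ↦ ∑ j, u_ij ⊗ x_j`. -/
def coactL (n m : ℕ) (q : ℝ) : QExt n m q →ₐ[ℂ] OM n m q ⊗[ℂ] QExt n m q :=
  RingQuot.liftAlgHom ℂ
    ⟨FreeAlgebra.lift ℂ fun i => ∑ j, OM.u n m q i j ⊗ₜ[ℂ] (QExt.x j : QExt n m q), by
      rintro _ _ ⟨a⟩
      simpa only [map_sum, map_smul, map_mul, FreeAlgebra.lift_ι_apply, map_zero]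
        using coactL_aux a⟩

/-- The right coaction `φ_R`, the algebra map with `x_j ↦ ∑ i, x_i ⊗ u_ij`. -/
def coactR (n m : ℕ) (q : ℝ) : QExt n m q →ₐ[ℂ] QExt n m q ⊗[ℂ] OM n m q :=
  RingQuot.liftAlgHom ℂ
    ⟨FreeAlgebra.lift ℂ fun j => ∑ i, (QExt.x i : QExt n m q) ⊗ₜ[ℂ] OM.u n m q i j, by
      rintro _ _ ⟨a⟩
      simpa only [map_sum, map_smul, map_mul, FreeAlgebra.lift_ι_apply, map_zero]
        using coactR_aux a⟩

/-- `D` is the left quantum determinant: the matrix coefficient of the left coaction on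
`∧^{nm}_q[X]`. -/
def IsLeftDet {n m : ℕ} {q : ℝ} (D : OM n m q) : Prop :=
  coactL n m q (topForm n m q) = D ⊗ₜ[ℂ] topForm n m q

/-- `D` is the right quantum determinant: the matrix coefficient of the right coaction on
`∧^{nm}_q[X]`. -/
def IsRightDet {n m : ℕ} {q : ℝ} (D : OM n m q) : Prop :=
  coactR n m q (topForm n m q) = topForm n m q ⊗ₜ[ℂ] D

/-- `ut` is the matrix form of the pairings between `∧^1_q[X]` and `∧^{nm-1}_q[X]`: with respect to
the basis `b` dual to the `x_i` under `∧^1 × ∧^{nm-1} → ∧^{nm}`, it is the (transposed) coefficient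
matrix of the left coaction on `∧^{nm-1}_q[X]`, and with respect to the basis `b'` dual to the `x_i`
under `∧^{nm-1} × ∧^1 → ∧^{nm}`, that of the right coaction. -/
def IsPairingMatrix {n m : ℕ} {q : ℝ} (ut : Matrix (Idx n m) (Idx n m) (OM n m q)) : Prop :=
  (∃ b : Module.Basis (Idx n m) ℂ (extPow n m q (n * m - 1)),
    (∀ r s, QExt.x r * (b s : QExt n m q) = if r = s then topForm n m q else 0) ∧
    ∀ s, coactL n m q (b s) = ∑ k, ut k s ⊗ₜ[ℂ] (b k : QExt n m q)) ∧
  ∃ b' : Module.Basis (Idx n m) ℂ (extPow n m q (n * m - 1)),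
    (∀ r s, (b' s : QExt n m q) * QExt.x r = if r = s then topForm n m q else 0) ∧
    ∀ s, coactR n m q (b' s) = ∑ k, (b' k : QExt n m q) ⊗ₜ[ℂ] ut s k

/-! ### Adjoining an inverse, and `O(GL_q(X))` -/

/-- The relations saying that `A → AdjoinInv d` is a `ℂ`-algebra map (`some a` stands for the image
of `a`) and that the extra generator `none` is a two-sided inverse of the image of `d`. -/
inductive AdjoinInvRel {A : Type*} [Ring A] [Algebra ℂ A] (d : A) :
    FreeAlgebra ℂ (Option A) → FreeAlgebra ℂ (Option A) → Prop
  | add (a b : A) : AdjoinInvRel d (FreeAlgebra.ι ℂ (some (a + b)))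
      (FreeAlgebra.ι ℂ (some a) + FreeAlgebra.ι ℂ (some b))
  | mul (a b : A) : AdjoinInvRel d (FreeAlgebra.ι ℂ (some (a * b)))
      (FreeAlgebra.ι ℂ (some a) * FreeAlgebra.ι ℂ (some b))
  | scalar (c : ℂ) : AdjoinInvRel d (FreeAlgebra.ι ℂ (some (algebraMap ℂ A c)))
      (algebraMap ℂ (FreeAlgebra ℂ (Option A)) c)
  | mul_inv : AdjoinInvRel d (FreeAlgebra.ι ℂ (some d) * FreeAlgebra.ι ℂ none) 1
  | inv_mul : AdjoinInvRel d (FreeAlgebra.ι ℂ none * FreeAlgebra.ι ℂ (some d)) 1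

/-- The universal `ℂ`-algebra obtained from `A` by adjoining a two-sided inverse of `d`. -/
def AdjoinInv {A : Type*} [Ring A] [Algebra ℂ A] (d : A) : Type _ := RingQuot (AdjoinInvRel d)

instance {A : Type*} [Ring A] [Algebra ℂ A] (d : A) : Ring (AdjoinInv d) :=
  inferInstanceAs (Ring (RingQuot (AdjoinInvRel d)))

instance AdjoinInv.instAlgebra {A : Type*} [Ring A] [Algebra ℂ A] (d : A) :
    Algebra ℂ (AdjoinInv d) :=
  inferInstanceAs (Algebra ℂ (RingQuot (AdjoinInvRel d)))

/-- The image of `a` in `AdjoinInv d`. -/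
def AdjoinInv.of {A : Type*} [Ring A] [Algebra ℂ A] (d : A) (a : A) : AdjoinInv d :=
  RingQuot.mkAlgHom ℂ (AdjoinInvRel d) (FreeAlgebra.ι ℂ (some a))

/-- The adjoined inverse `d⁻¹`. -/
def AdjoinInv.inv {A : Type*} [Ring A] [Algebra ℂ A] (d : A) : AdjoinInv d :=
  RingQuot.mkAlgHom ℂ (AdjoinInvRel d) (FreeAlgebra.ι ℂ none)

/-- The universal property: an algebra map `f` from `A` that makes `d` invertible extends uniquely
to `AdjoinInv d`. -/
theorem AdjoinInv.existsUnique_lift {A B : Type*} [Ring A] [Algebra ℂ A] [Ring B] [Algebra ℂ B]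
    (d : A) (f : A →ₐ[ℂ] B) (e : B) (h₁ : f d * e = 1) (h₂ : e * f d = 1) :
    ∃! g : AdjoinInv d →ₐ[ℂ] B, (∀ a, g (AdjoinInv.of d a) = f a) ∧ g (AdjoinInv.inv d) = e := by
  let F : FreeAlgebra ℂ (Option A) →ₐ[ℂ] B := FreeAlgebra.lift ℂ fun o => o.elim e f
  have hF : ∀ ⦃x y⦄, AdjoinInvRel d x y → F x = F y := by
    rintro _ _ (⟨a, b⟩ | ⟨a, b⟩ | c | _ | _) <;> simp [F, h₁, h₂]
  refine ⟨RingQuot.liftAlgHom ℂ ⟨F, hF⟩, ⟨fun a => ?_, ?_⟩, ?_⟩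
  · exact (RingQuot.liftAlgHom_mkAlgHom_apply ℂ F hF _).trans (by simp [F])
  · exact (RingQuot.liftAlgHom_mkAlgHom_apply ℂ F hF _).trans (by simp [F])
  · rintro g ⟨hg₁, hg₂⟩
    refine RingQuot.liftAlgHom_unique ℂ F hF g ?_
    ext o
    cases o with
    | none => exact hg₂.trans (by simp [F])
    | some a => exact (hg₁ a).trans (by simp [F])

/-- The coordinate algebra `O(GL_q(X))`, obtained from `O(M_q(X))` by adjoining the inverse of the
quantum determinant `D`. -/
abbrev OGL {n m : ℕ} {q : ℝ} (D : OM n m q) : Type := AdjoinInv D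

/-- A Hopf algebra structure satisfies `Δ(u) = u ⊗̇ u`, `ε(u) = 1`, `S(u) = ut d⁻¹` (entrywise)
and `S(d⁻¹) = d`. -/
def HopfFormulas {B ι : Type*} [Ring B] [Fintype ι] [DecidableEq ι] (H : HopfAlgebra ℂ B)
    (u ut : Matrix ι ι B) (d dinv : B) : Prop :=
  (∀ i j, (Coalgebra.comul (R := ℂ) (u i j) : B ⊗[ℂ] B) = ∑ k, u i k ⊗ₜ[ℂ] u k j) ∧
  (∀ i j, Coalgebra.counit (R := ℂ) (u i j) = (if i = j then 1 else 0 : ℂ)) ∧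
  (∀ i j, HopfAlgebra.antipode ℂ (u i j) = ut i j * dinv) ∧
  HopfAlgebra.antipode ℂ dinv = d

end QuantumKronecker

end

open QuantumKronecker

/-! Each `RhatStd` satisfies the Hecke and braid relations, and `P₊` has the same kernel as `R̂ +
1`. So the relations of `∧_q` amount to a straightening rule: for `i ≤ j`, the product `x_{jb}
x_{ia}` is, up to a scalar, `R̂_W` applied to the products `x_{ic} x_{jd}` (`rowRel_iff`).

The size of `∧_q` is bounded above by a filtration. With weight `ij` for `x_{ij}`, generators
commute up to a nonzero factor and a term of larger weight, and their squares vanish. Hence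
squarefree monomials span, and every word of degree `nm` is a real multiple of `ω`. That `ω ≠ 0`
comes from building `∧_q` one row at a time as a braided tensor product (`addRow_rowRel`,
`mon_rowWord_ne_zero`). The pairings are nondegenerate because an element can be multiplied by the
complement of a squarefree monomial of least weight in it (`exists_mul_mon_ne_zero`).

Let `t(w)` be the coefficient of `ω` in the word `w`. The coactions say that `t` is an eigenvector
of the matrix of all `u_{vw}` from either side, with eigenvalues `D^L` and `D^R`. Evaluating the
double sum of `t(v) t(w) u_{vw}` in both ways gives `|t|² D^L = |t|² D^R`, and `|t|² > 0` because
`t` is real and nonzero.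

Sums of the same kind give dual bases of degree `nm - 1`, where torus weights provide the
orthogonality. Applying the coactions to the duality relations yields `u * cofL = D` and `cofR * u =
D`. These alone do not give `cofL = cofR`, since `D` cannot be cancelled in `O(M_q)`. Comparing left
and right multiplication gives `cofL k c = (gramM k / gramM c) • cofR k c`. To see that `gramM` is
constant, `O(M_q)` is represented by blocks of `R̂_V` or `R̂_W`: there `D` is a nonzero scalar, so
both cofactor matrices become `D` times the inverse of `u`, and this inverse has nonzero
off-diagonal entries because `q² ≠ 1` (`gramM_eq_of_rep`).

Finally, `D` is grouplike by coassociativity of the coaction, the inverse of `u` satisfies the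
defining relations over the opposite algebra and so defines the antipode, and the Hopf axioms and
uniqueness are checked on generators. -/

open scoped TensorProduct

noncomputable section

namespace QuantumKronecker

/-! ### The action of the `R̂`-matrices on families -/

section Action

variable {B : Type*} [AddCommGroup B] [Module ℂ B]

/-- The action of `R̂` on a family indexed by pairs. -/
def rAct {n : ℕ} (q : ℝ) (F : Fin n → Fin n → B) (i j : Fin n) : B :=
  ∑ e : Fin n × Fin n, RhatStd n q (i, j) e • F e.1 e.2

theorem rAct_eq {n : ℕ} (q : ℝ) (F : Fin n → Fin n → B) (i j : Fin n) :
    rAct q F i j = (if i = j then (q : ℂ) • F j i else F j i) +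
      if i < j then ((q : ℂ) - (q : ℂ)⁻¹) • F i j else 0 := by
  simp only [rAct, RhatStd, Matrix.of_apply, add_smul, Finset.sum_add_distrib]
  congr 1
  · rw [Finset.sum_eq_single (j, i)]
    · by_cases h : i = j <;> simp [h]
    · rintro ⟨a, b⟩ - h
      rw [if_neg, zero_smul]
      rintro ⟨rfl, rfl⟩
      exact h rfl
    · simp
  · rw [Finset.sum_eq_single (i, j)]
    · by_cases h : i < j <;> simp [h]
    · rintro ⟨a, b⟩ - h
      rw [if_neg, zero_smul]
      rintro ⟨rfl, rfl, -⟩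
      exact h rfl
    · simp

theorem rAct_smul {n : ℕ} (q : ℝ) (c : ℂ) (F : Fin n → Fin n → B) (i j : Fin n) :
    rAct q (fun a b => c • F a b) i j = c • rAct q F i j := by
  simp only [rAct, Finset.smul_sum, smul_comm c]

theorem rAct_neg {n : ℕ} (q : ℝ) (F : Fin n → Fin n → B) (i j : Fin n) :
    rAct q (fun a b => -F a b) i j = -rAct q F i j := by
  simp only [rAct, smul_neg, Finset.sum_neg_distrib]

/-- The Hecke relation. -/
theorem rAct_rAct {n : ℕ} {q : ℝ} (hq : q ≠ 0) (F : Fin n → Fin n → B) (i j : Fin n) :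
    rAct q (rAct q F) i j = F i j + ((q : ℂ) - (q : ℂ)⁻¹) • rAct q F i j := by
  have hq' : (q : ℂ) ≠ 0 := by exact_mod_cast hq
  simp only [rAct_eq]
  rcases lt_trichotomy i j with h | rfl | h
  · simp only [h.ne, h.ne', h, h.not_gt, if_true, if_false]
    module
  · simp only [lt_irrefl, if_true, if_false, add_zero]
    match_scalars
    field_simp
    ring
  · simp only [h.ne, h.ne', h, h.not_gt, if_true, if_false]
    module

/-- The braid relation. -/
theorem rAct_braid {n : ℕ} {q : ℝ} (hq : q ≠ 0) (F : Fin n → Fin n → Fin n → B) (a b c : Fin n) :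
    rAct q (fun a' b' => rAct q (fun b₂ c₂ => rAct q (fun a₃ b₃ => F a₃ b₃ c₂) a' b₂) b' c) a b =
      rAct q (fun b' c' => rAct q (fun a₂ b₂ => rAct q (F a₂) b₂ c') a b') b c := by
  have hq' : (q : ℂ) ≠ 0 := by exact_mod_cast hq
  simp only [rAct_eq]
  -- The coefficients depend only on the relative order of `a`, `b`, `c`. Inconsistent orders are
  -- discarded; each remaining one is a linear identity with coefficients in `q`.
  rcases lt_trichotomy a b with h1 | h1 | h1 <;> rcases lt_trichotomy b c with h2 | h2 | h2 <;>
    rcases lt_trichotomy a c with h3 | h3 | h3 <;>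
    first
    | (exfalso; order)
    | (try subst h1
       try subst h2
       try subst h3
       simp only [*, lt_irrefl, ne_of_lt, ne_of_gt, not_lt_of_gt, if_true, if_false]
       try (match_scalars <;> field_simp <;> ring))

end Action

/-! ### The spectral projection `P₊` -/

theorem RhatStd_mul_self {n : ℕ} {q : ℝ} (hq : q ≠ 0) :
    RhatStd n q * RhatStd n q = 1 + ((q : ℂ) - (q : ℂ)⁻¹) • RhatStd n q := by
  ext ⟨i, j⟩ k
  -- The indicator family of `k` is sent to column `k` of the matrix, so the Hecke relation for
  -- families is the matrix identity read column by column.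
  have h (a b : Fin n) : rAct q (fun i j => if (i, j) = k then (1 : ℂ) else 0) a b =
      RhatStd n q (a, b) k := by
    simp [rAct]
  have h' := rAct_rAct hq (fun i j => if (i, j) = k then (1 : ℂ) else 0) i j
  rw [h, show rAct q (fun i j => if (i, j) = k then (1 : ℂ) else 0) =
    fun a b => RhatStd n q (a, b) k from funext₂ h] at h'
  simpa [rAct, Matrix.mul_apply, Matrix.one_apply] using h'

open scoped Kronecker in
theorem Rhat_eq_reindex (n m : ℕ) (q : ℝ) :
    Rhat n m q = Matrix.reindexAlgEquiv ℂ ℂ (Equiv.prodProdProdComm _ _ _ _)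
      (RhatStd n q ⊗ₖ RhatStd m q) := by
  ext a b
  simp [Rhat, Matrix.reindex_apply, Matrix.kroneckerMap_apply]

-- `R̂` is a product of commuting `V` and `W`, each with eigenvalues among `q` and `-q⁻¹`. The
-- products of these are `q²`, `-1`, `q⁻²`, and the quadratic factor has roots `q²` and `q⁻²`, since
-- `(q - q⁻¹)² + 2 = q² + q⁻²`.
open scoped Kronecker in
theorem Rhat_cubic {n m : ℕ} {q : ℝ} (hq : q ≠ 0) :
    (Rhat n m q * Rhat n m q - (((q : ℂ) - (q : ℂ)⁻¹) ^ 2 + 2) • Rhat n m q + 1) *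
      (Rhat n m q + 1) = 0 := by
  obtain ⟨V, W, hR, hVW, hV, hW⟩ : ∃ V W : Matrix (Idx n m × Idx n m) (Idx n m × Idx n m) ℂ,
      Rhat n m q = V * W ∧ V * W = W * V ∧ V * V = 1 + ((q : ℂ) - (q : ℂ)⁻¹) • V ∧
        W * W = 1 + ((q : ℂ) - (q : ℂ)⁻¹) • W := by
    refine ⟨Matrix.reindexAlgEquiv ℂ ℂ (Equiv.prodProdProdComm _ _ _ _) (RhatStd n q ⊗ₖ 1),
      Matrix.reindexAlgEquiv ℂ ℂ (Equiv.prodProdProdComm _ _ _ _) (1 ⊗ₖ RhatStd m q), ?_, ?_, ?_, ?_⟩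
    · rw [← map_mul, ← Matrix.mul_kronecker_mul, one_mul, mul_one, Rhat_eq_reindex]
    · rw [← map_mul, ← map_mul, ← Matrix.mul_kronecker_mul, ← Matrix.mul_kronecker_mul]
      simp only [one_mul, mul_one]
    · rw [← map_mul, ← Matrix.mul_kronecker_mul, RhatStd_mul_self hq, mul_one,
        Matrix.add_kronecker, Matrix.smul_kronecker, Matrix.one_kronecker_one, map_add, map_smul,
        map_one]
    · rw [← map_mul, ← Matrix.mul_kronecker_mul, RhatStd_mul_self hq, mul_one,
        Matrix.kronecker_add, Matrix.kronecker_smul, Matrix.one_kronecker_one, map_add, map_smul,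
        map_one]
  rw [hR]
  generalize (q : ℂ) - (q : ℂ)⁻¹ = h at *
  have h2 : V * W * (V * W) = 1 + h • V + h • W + h ^ 2 • (V * W) := by
    rw [show V * W * (V * W) = V * (W * V) * W by simp only [mul_assoc], ← hVW,
      show V * (V * W) * W = (V * V) * (W * W) by simp only [mul_assoc], hV, hW]
    simp only [add_mul, mul_add, one_mul, mul_one, smul_mul_assoc, mul_smul_comm]
    module
  have h3 : V * (V * W) = W + h • (V * W) := by rw [← mul_assoc, hV, add_mul, one_mul, smul_mul_assoc]
  have h4 : W * (V * W) = V + h • (V * W) := by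
    rw [← mul_assoc, ← hVW, mul_assoc, hW, mul_add, mul_one, mul_smul_comm]
  rw [h2]
  simp only [add_mul, sub_mul, mul_add, mul_one, one_mul, smul_mul_assoc, h2, h3, h4]
  module

section Projection

variable {n m : ℕ} {q : ℝ}

theorem inv_sq_add_ne {q : ℝ} (hq : q ≠ 0) :
    (-1 - (q : ℂ) ^ 2) * (-1 - ((q : ℂ) ^ 2)⁻¹) ≠ 0 := by
  have h : (-1 - q ^ 2) * (-1 - (q ^ 2)⁻¹) ≠ 0 := by
    have : 0 < (1 + q ^ 2) * (1 + (q ^ 2)⁻¹) := by positivity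
    intro h
    apply this.ne'
    linear_combination h
  exact_mod_cast h

/-- `P₊` is a multiple of `R̂ + 1`. -/
theorem exists_Pplus_eq (hq : q ≠ 0) : ∃ c d : ℂ,
    Pplus n m q = (c • Rhat n m q + d • 1) * (Rhat n m q + 1) := by
  have hq' : (q : ℂ) ≠ 0 := by exact_mod_cast hq
  have h0 := inv_sq_add_ne hq
  refine ⟨-((-1 - (q : ℂ) ^ 2) * (-1 - ((q : ℂ) ^ 2)⁻¹))⁻¹,
    ((-1 - (q : ℂ) ^ 2) * (-1 - ((q : ℂ) ^ 2)⁻¹))⁻¹ * ((q : ℂ) ^ 2 + ((q : ℂ) ^ 2)⁻¹ + 1), ?_⟩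
  set z := (q : ℂ) ^ 2 with hz
  set k := (-1 - z) * (-1 - z⁻¹) with hk
  have hz0 : z ≠ 0 := pow_ne_zero _ hq'
  have hk' : k = z + z⁻¹ + 2 := by
    rw [hk]
    field_simp
    ring
  have hk1 : k⁻¹ * (z + z⁻¹ + 2) = 1 := by rw [← hk', inv_mul_cancel₀ h0]
  simp only [Pplus, Pminus, ← hz, ← hk]
  simp only [sub_mul, mul_sub, add_mul, mul_add, one_mul, mul_one, smul_mul_assoc, mul_smul_comm]
  match_scalars
  all_goals clear_value k z
  · linear_combination -hk1 - k⁻¹ * mul_inv_cancel₀ hz0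
  · ring
  · ring

/-- The cubic identity says that `R̂ + 1` kills `P₋`. With `exists_Pplus_eq`, this shows that `P₊`
and `R̂ + 1` are left multiples of each other and so impose the same relations. -/
theorem Rhat_add_one_mul_Pplus (hq : q ≠ 0) :
    (Rhat n m q + 1) * Pplus n m q = Rhat n m q + 1 := by
  have hq' : (q : ℂ) ≠ 0 := by exact_mod_cast hq
  have h : Commute (Rhat n m q + 1)
      ((Rhat n m q - ((q : ℂ) ^ 2) • (1 : Matrix _ _ ℂ)) *
      (Rhat n m q - (((q : ℂ) ^ 2)⁻¹) • (1 : Matrix _ _ ℂ))) := by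
    have h1 : Commute (Rhat n m q + 1) (Rhat n m q) := (Commute.refl _).add_left (Commute.one_left _)
    have h2 (c : ℂ) : Commute (Rhat n m q + 1) (c • (1 : Matrix _ _ ℂ)) :=
      (Commute.one_right _).smul_right c
    exact (h1.sub_right (h2 _)).mul_right (h1.sub_right (h2 _))
  rw [Pplus, mul_sub, mul_one, Pminus, mul_smul_comm, h.eq]
  have : ((Rhat n m q - ((q : ℂ) ^ 2) • (1 : Matrix _ _ ℂ)) *
      (Rhat n m q - (((q : ℂ) ^ 2)⁻¹) • (1 : Matrix _ _ ℂ))) =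
      (Rhat n m q * Rhat n m q - (((q : ℂ) - (q : ℂ)⁻¹) ^ 2 + 2) • Rhat n m q + 1) := by
    simp only [sub_mul, mul_sub, one_mul, mul_one, smul_mul_assoc, mul_smul_comm]
    match_scalars
    · ring
    · field_simp
      ring
    · field_simp
  rw [this, Rhat_cubic hq, smul_zero, sub_zero]

variable {B : Type*} [AddCommGroup B] [Module ℂ B] {P : Type*} [Fintype P]

theorem sum_mul_smul (M N : Matrix P P ℂ) (f : P → B) (a : P) :
    ∑ e, (M * N) a e • f e = ∑ e, M a e • ∑ k, N e k • f k := by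
  simp only [Matrix.mul_apply, Finset.sum_smul, Finset.smul_sum, mul_smul]
  exact Finset.sum_comm

theorem sum_add_one_smul [DecidableEq P] (M : Matrix P P ℂ) (f : P → B) (a : P) :
    ∑ e, (M + 1) a e • f e = ∑ e, M a e • f e + f a := by
  simp [add_smul, Finset.sum_add_distrib, Matrix.one_apply, ite_smul]

theorem Pplus_smul_iff (hq : q ≠ 0) (f : Idx n m × Idx n m → B) :
    (∀ a, ∑ e, Pplus n m q a e • f e = 0) ↔ ∀ a, ∑ e, Rhat n m q a e • f e = -f a := by
  constructor
  · intro h a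
    rw [eq_neg_iff_add_eq_zero, ← sum_add_one_smul, ← Rhat_add_one_mul_Pplus hq, sum_mul_smul]
    simp [h]
  · intro h a
    obtain ⟨c, d, hcd⟩ := exists_Pplus_eq (n := n) (m := m) hq
    rw [hcd, sum_mul_smul]
    simp only [sum_add_one_smul, h, neg_add_cancel, smul_zero, Finset.sum_const_zero]

theorem sum_Rhat_smul (f : Idx n m × Idx n m → B) (j i : Fin n) (b a : Fin m) :
    ∑ e, Rhat n m q ((j, b), (i, a)) e • f e =
      rAct q (fun i' j' => rAct q (fun c d => f ((i', c), (j', d))) b a) j i := by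
  simp only [rAct, Finset.smul_sum, smul_smul]
  rw [← Fintype.sum_prod_type', ← (Equiv.prodProdProdComm _ _ _ _).sum_comp]
  rfl

/-- The relations of the quantum exterior algebra, sorted by rows. -/
def RowRel {B : Type*} [Ring B] [Algebra ℂ B] (q : ℝ) (x : Idx n m → B) : Prop :=
  ∀ i j : Fin n, ∀ b a : Fin m, i ≤ j → x (j, b) * x (i, a) =
    -((if i = j then (q : ℂ) else 1) • rAct q (fun c d => x (i, c) * x (j, d)) b a)

/-- Read at a pair of rows in weakly decreasing order, the equation `R̂ x x = -x x` is the
straightening rule. At a strictly increasing pair it is then automatic, by the Hecke relation for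
`R̂_W`. -/
theorem rowRel_iff {B : Type*} [Ring B] [Algebra ℂ B] (hq : q ≠ 0) (x : Idx n m → B) :
    RowRel q x ↔ ∀ a, ∑ e, Pplus n m q a e • (x e.1 * x e.2) = 0 := by
  have hq' : (q : ℂ) ≠ 0 := by exact_mod_cast hq
  rw [Pplus_smul_iff hq (fun e => x e.1 * x e.2)]
  constructor
  · rintro h ⟨⟨j, b⟩, ⟨i, a⟩⟩
    rw [sum_Rhat_smul, rAct_eq]
    rcases lt_trichotomy i j with hij | rfl | hij
    · rw [if_neg hij.ne', if_neg hij.not_gt, h i j b a hij.le, if_neg hij.ne]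
      simp
    · rw [if_pos rfl, if_neg (lt_irrefl _), h i i b a le_rfl, if_pos rfl]
      simp
    · rw [if_neg hij.ne, if_pos hij]
      have h1 (c d : Fin m) := h j i c d hij.le
      simp only [if_neg hij.ne, one_smul] at h1
      simp only [h1]
      rw [rAct_neg, rAct_rAct hq]
      abel
  · intro h i j b a hij
    have h1 := h ((j, b), (i, a))
    rw [sum_Rhat_smul, rAct_eq] at h1
    rcases hij.lt_or_eq with hij | rfl
    · rw [if_neg hij.ne', if_neg hij.not_gt, add_zero] at h1
      rw [if_neg hij.ne, one_smul, h1, neg_neg]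
    · rw [if_pos rfl, if_neg (lt_irrefl _), add_zero] at h1
      rw [if_pos rfl, h1, neg_neg]

end Projection

/-! ### The universal property of the quantum exterior algebra -/

section Lift

variable {n m : ℕ} {q : ℝ} {B : Type*} [Ring B] [Algebra ℂ B]

theorem QExt.rowRel (hq : q ≠ 0) : RowRel q (QExt.x : Idx n m → QExt n m q) :=
  (rowRel_iff hq _).2 QExt.rel

theorem QExt.exists_lift (hq : q ≠ 0) (y : Idx n m → B) (hy : RowRel q y) :
    ∃ f : QExt n m q →ₐ[ℂ] B, ∀ a, f (QExt.x a) = y a := by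
  refine ⟨RingQuot.liftAlgHom ℂ ⟨FreeAlgebra.lift ℂ y, ?_⟩, fun a => ?_⟩
  · rintro _ _ ⟨a⟩
    simpa only [map_sum, map_smul, map_mul, FreeAlgebra.lift_ι_apply, map_zero]
      using (rowRel_iff hq y).1 hy a
  · exact (RingQuot.liftAlgHom_mkAlgHom_apply ℂ _ _ _).trans (by simp)

/-- The quotient map onto the quantum exterior algebra. -/
def QExt.mk : FreeAlgebra ℂ (Idx n m) →ₐ[ℂ] QExt n m q := RingQuot.mkAlgHom ℂ (ExtRel n m q)

theorem QExt.induction {p : QExt n m q → Prop} (h1 : p 1) (hadd : ∀ u v, p u → p v → p (u + v))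
    (hsmul : ∀ (c : ℂ) u, p u → p (c • u)) (hx : ∀ a u, p u → p (QExt.x a * u)) (u : QExt n m q) :
    p u := by
  -- The stronger claim, with an arbitrary right factor `u`, lets the product case of the free
  -- algebra peel off one factor at a time.
  suffices ∀ (f : FreeAlgebra ℂ (Idx n m)) (u : QExt n m q), p u →
      p (QExt.mk f * u) by
    obtain ⟨f, rfl⟩ := RingQuot.mkAlgHom_surjective ℂ (ExtRel n m q) u
    have := this f 1 h1
    rwa [mul_one] at this
  intro f
  induction f using FreeAlgebra.induction with
  | grade0 c =>
    intro u hu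
    rw [AlgHom.commutes]
    have := hsmul c u hu
    rwa [Algebra.smul_def] at this
  | grade1 a => exact fun u hu => hx a u hu
  | mul f g hf hg =>
    intro u hu
    rw [map_mul]
    have := hf _ (hg u hu)
    rwa [← mul_assoc] at this
  | add f g hf hg =>
    intro u hu
    rw [map_add]
    have := hadd _ _ (hf u hu) (hg u hu)
    rwa [← add_mul] at this

theorem QExt.algHom_ext {f g : QExt n m q →ₐ[ℂ] B} (h : ∀ a, f (QExt.x a) = g (QExt.x a)) :
    f = g := by
  ext u
  induction u using QExt.induction with
  | h1 => simp
  | hadd u v hu hv => simp [hu, hv]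
  | hsmul c u hu => simp [hu]
  | hx a u hu => simp [hu, h]

end Lift

/-! ### Linearity of the action of `R̂` on families. -/

section ActionLemmas

variable {B C : Type*} [AddCommGroup B] [Module ℂ B] [AddCommGroup C] [Module ℂ C] {n m : ℕ} {q : ℝ}

theorem map_rAct (f : B →ₗ[ℂ] C) (F : Fin n → Fin n → B) (i j : Fin n) :
    f (rAct q F i j) = rAct q (fun a b => f (F a b)) i j := by
  simp [rAct]

theorem rAct_comm (F : Fin n → Fin n → Fin m → Fin m → B) (i j : Fin n) (k l : Fin m) :
    rAct q (fun a b => rAct q (fun c d => F a b c d) k l) i j =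
      rAct q (fun c d => rAct q (fun a b => F a b c d) i j) k l := by
  simp only [rAct, Finset.smul_sum]
  rw [Finset.sum_comm]
  exact Finset.sum_congr rfl fun _ _ => Finset.sum_congr rfl fun _ _ => smul_comm _ _ _

theorem rAct_sum {ι : Type*} (s : Finset ι) (F : ι → Fin n → Fin n → B) (i j : Fin n) :
    rAct q (fun a b => ∑ k ∈ s, F k a b) i j = ∑ k ∈ s, rAct q (F k) i j := by
  simp only [rAct, Finset.smul_sum]
  exact Finset.sum_comm

theorem rAct_add (F G : Fin n → Fin n → B) (i j : Fin n) :
    rAct q (fun a b => F a b + G a b) i j = rAct q F i j + rAct q G i j := by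
  simp [rAct, Finset.sum_add_distrib]

theorem mul_rAct {A : Type*} [Ring A] [Algebra ℂ A] (y : A) (F : Fin n → Fin n → A) (i j : Fin n) :
    y * rAct q F i j = rAct q (fun a b => y * F a b) i j :=
  map_rAct (LinearMap.mulLeft ℂ y) F i j

theorem rAct_matrix_apply {κ : Type*} (F : Fin n → Fin n → Matrix κ κ B) (i j : Fin n) (k l : κ) :
    rAct q F i j k l = rAct q (fun a b => F a b k l) i j := by
  simp [rAct, Matrix.sum_apply]

end ActionLemmas

/-! ### The braiding of a row with the quantum exterior algebra -/

section Braiding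

variable {n m : ℕ} {q : ℝ}

/-- The matrix through which a generator is moved past a new row. -/
def braidMat (q : ℝ) (i : Fin n) (a : Fin m) : Matrix (Fin m) (Fin m) (QExt n m q) :=
  Matrix.of fun b d => -rAct q (fun c d' => if d' = d then QExt.x (i, c) else 0) b a

theorem braidMat_mul (i : Fin n) (a : Fin m) (M : Matrix (Fin m) (Fin m) (QExt n m q))
    (b l : Fin m) :
    (braidMat q i a * M) b l = -rAct q (fun c d => QExt.x (i, c) * M d l) b a := by
  simp only [Matrix.mul_apply, braidMat, Matrix.of_apply, neg_mul, Finset.sum_neg_distrib, rAct,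
    Finset.sum_mul]
  rw [Finset.sum_comm]
  simp [ite_mul]

/-- A product of two such matrices applies `R̂_W` twice, once for each generator passed by the new
row. The relation between the two generators inserts a third `R̂_W`, and the braid relation moves it
to the other end. -/
theorem braidMat_rowRel (hq : q ≠ 0) :
    RowRel q (fun p : Idx n m => braidMat q p.1 p.2) := by
  intro i j a a' hij
  ext b d
  rw [braidMat_mul]
  simp only [Matrix.neg_apply, Matrix.smul_apply]
  rw [rAct_matrix_apply]
  simp only [braidMat_mul]
  simp only [braidMat, Matrix.of_apply, mul_neg, mul_rAct, mul_ite, mul_zero, rAct_neg]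
  have key (c c' d' : Fin m) :
      (if d' = d then QExt.x (j, c) * QExt.x (i, c') else 0 : QExt n m q) =
        (-(if i = j then (q : ℂ) else 1)) • rAct q (fun f g =>
          if d' = d then QExt.x (i, f) * QExt.x (j, g) else 0) c c' := by
    by_cases h : d' = d
    · simp only [h, if_true]
      rw [QExt.rowRel hq i j c c' hij, neg_smul]
    · simp [h, rAct]
  simp only [key, rAct_smul]
  rw [rAct_braid hq (fun f g d' => if d' = d then QExt.x (i, f) * QExt.x (j, g) else 0) b a a']
  simp

theorem exists_braidHom (hq : q ≠ 0) :
    ∃ ρ : QExt n m q →ₐ[ℂ] Matrix (Fin m) (Fin m) (QExt n m q),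
      ∀ i a, ρ (QExt.x (i, a)) = braidMat q i a := by
  obtain ⟨ρ, h⟩ := QExt.exists_lift hq _ (braidMat_rowRel (n := n) (m := m) hq)
  exact ⟨ρ, fun i a => h (i, a)⟩

/-- The algebra map through which the quantum exterior algebra is moved past a new row. -/
def braidHom (hq : q ≠ 0) : QExt n m q →ₐ[ℂ] Matrix (Fin m) (Fin m) (QExt n m q) :=
  (exists_braidHom hq).choose

theorem braidHom_x (hq : q ≠ 0) (i : Fin n) (a : Fin m) :
    braidHom hq (QExt.x (i, a)) = braidMat q i a :=
  (exists_braidHom hq).choose_spec i a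

/-- The entries of `braidHom`, as linear operators. -/
def braidOp (hq : q ≠ 0) (b l : Fin m) : Module.End ℂ (QExt n m q) :=
  (Matrix.entryLinearMap ℂ (QExt n m q) b l).comp (braidHom hq).toLinearMap

theorem braidOp_apply (hq : q ≠ 0) (b l : Fin m) (v : QExt n m q) :
    braidOp hq b l v = braidHom hq v b l := rfl

theorem braidOp_one (hq : q ≠ 0) (b l : Fin m) :
    braidOp hq b l (1 : QExt n m q) = if b = l then 1 else 0 := by
  rw [braidOp_apply, map_one, Matrix.one_apply]

theorem braidOp_x_mul (hq : q ≠ 0) (b l : Fin m) (i : Fin n) (a : Fin m) (v : QExt n m q) :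
    braidOp hq b l (QExt.x (i, a) * v) =
      -rAct q (fun c d => QExt.x (i, c) * braidOp hq d l v) b a := by
  simp only [braidOp_apply]
  rw [map_mul, braidHom_x, braidMat_mul]

/-- The relation `R̂ L₁ L₂ = L₁ L₂ R̂`. -/
theorem braidOp_braidOp (hq : q ≠ 0) (v : QExt n m q) (b a l l' : Fin m) :
    rAct q (fun c d => braidOp hq c l (braidOp hq d l' v)) b a =
      rAct q (fun c d => braidOp hq b c (braidOp hq a d v)) l l' := by
  induction v using QExt.induction generalizing b a l l' with
  | h1 =>
    have h (u v u' v' : Fin m) :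
        braidOp hq u u' (braidOp hq v v' (1 : QExt n m q)) =
          if (u, v) = (u', v') then 1 else 0 := by
      simp only [braidOp_one, Prod.mk.injEq]
      by_cases hv : v = v' <;> simp [hv, braidOp_one]
    simp only [h, rAct, smul_ite, smul_zero]
    -- On `1` the operators are Kronecker deltas, so the claim reduces to the symmetry of `R̂_W`.
    simp [RhatStd_symm m q (b, a)]
  | hadd u v hu hv => simp only [map_add, rAct_add, hu, hv]
  | hsmul c u hu => simp only [map_smul, rAct_smul, hu]
  | hx p u hu =>
    obtain ⟨i, e⟩ := p
    simp only [braidOp_x_mul, map_neg, map_rAct]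
    simp only [rAct_neg, neg_neg]
    -- The braid relation carries the outer `R̂` past the generator, onto the two operators acting
    -- on `u`, where the induction hypothesis applies.
    rw [rAct_braid hq (fun f g d => QExt.x (i, f) * braidOp hq g l (braidOp hq d l' u)) b a e]
    simp only [← mul_rAct, hu]
    simp only [mul_rAct]
    rw [rAct_comm]
    congr 1
    ext c d
    rw [rAct_comm]

/-- The generators of `∧_q` with one more row. -/
def addRow (hq : q ≠ 0) : Idx (n + 1) m → Module.End ℂ (QExt n m q) ⊗[ℂ] QExt 1 m q :=
  fun p => Fin.lastCases (∑ l, braidOp hq p.2 l ⊗ₜ[ℂ] (QExt.x (0, l) : QExt 1 m q))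
    (fun i => LinearMap.mulLeft ℂ (QExt.x (i, p.2)) ⊗ₜ[ℂ] 1) p.1

theorem addRow_castSucc (hq : q ≠ 0) (i : Fin n) (a : Fin m) :
    addRow hq (i.castSucc, a) =
      LinearMap.mulLeft ℂ (QExt.x (i, a) : QExt n m q) ⊗ₜ[ℂ] (1 : QExt 1 m q) := by
  simp [addRow]

theorem addRow_last (hq : q ≠ 0) (a : Fin m) :
    addRow hq (Fin.last n, a) =
      ∑ l, (braidOp hq a l : Module.End ℂ (QExt n m q)) ⊗ₜ[ℂ] (QExt.x (0, l) : QExt 1 m q) := by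
  simp [addRow]

theorem rAct_tmul_left {A C : Type*} [Ring A] [Algebra ℂ A] [Ring C] [Algebra ℂ C]
    (F : Fin n → Fin n → A) (y : C) (i j : Fin n) :
    rAct q F i j ⊗ₜ[ℂ] y = rAct q (fun a b => F a b ⊗ₜ[ℂ] y) i j :=
  map_rAct ((TensorProduct.mk ℂ A C).flip y) F i j

theorem rAct_end_apply {A : Type*} [AddCommGroup A] [Module ℂ A]
    (F : Fin n → Fin n → Module.End ℂ A) (v : A) (i j : Fin n) :
    rAct q F i j v = rAct q (fun a b => F a b v) i j :=
  map_rAct (LinearMap.applyₗ v) F i j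

theorem sum_rAct_tmul {A C : Type*} [Ring A] [Algebra ℂ A] [Ring C] [Algebra ℂ C]
    (F : Fin n → Fin n → A) (G : Fin n → Fin n → C) :
    ∑ p : Fin n × Fin n, rAct q F p.1 p.2 ⊗ₜ[ℂ] G p.1 p.2 =
      ∑ p : Fin n × Fin n, F p.1 p.2 ⊗ₜ[ℂ] rAct q G p.1 p.2 := by
  simp only [rAct, TensorProduct.sum_tmul, TensorProduct.tmul_sum, TensorProduct.smul_tmul]
  rw [Finset.sum_comm]
  refine Finset.sum_congr rfl fun p _ => Finset.sum_congr rfl fun p' _ => ?_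
  rw [RhatStd_symm]

theorem RowRel.map {B C : Type*} [Ring B] [Algebra ℂ B] [Ring C] [Algebra ℂ C]
    {x : Idx n m → B} (hx : RowRel q x) (f : B →ₐ[ℂ] C) : RowRel q (fun a => f (x a)) := by
  intro i j b a hij
  simp only [← map_mul]
  rw [hx i j b a hij, map_neg, map_smul, ← AlgHom.toLinearMap_apply, map_rAct]
  rfl

/-- Two old rows satisfy their own relations. A new row against an old one is the rule
`braidOp_x_mul`. For the new row with itself, `braidOp_braidOp` and the symmetry of `R̂` transfer
`R̂` from the operators to the tensor factor `∧_q` of a single row. -/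
theorem addRow_rowRel (hq : q ≠ 0) : RowRel q (addRow (n := n) (m := m) hq) := by
  intro i j b a hij
  induction j using Fin.lastCases with
  | last =>
    induction i using Fin.lastCases with
    | last =>
      simp only [addRow_last, sum_tmul_mul_sum_tmul, rAct_sum, if_true]
      have h (p : Fin m × Fin m) : rAct q (fun c d => ((braidOp hq c p.1 * braidOp hq d p.2 :
          Module.End ℂ (QExt n m q)) ⊗ₜ[ℂ] (QExt.x (0, p.1) * QExt.x (0, p.2) : QExt 1 m q))) b a =
          rAct q (fun c d => braidOp hq b c * braidOp hq a d) p.1 p.2 ⊗ₜ[ℂ]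
            (QExt.x (0, p.1) * QExt.x (0, p.2)) := by
        rw [← rAct_tmul_left]
        congr 1
        ext v
        simp only [rAct_end_apply]
        exact braidOp_braidOp hq v b a p.1 p.2
      simp only [h]
      rw [sum_rAct_tmul (fun c d => braidOp hq b c * braidOp hq a d)
        (fun c d => (QExt.x (0, c) * QExt.x (0, d) : QExt 1 m q)), Finset.smul_sum]
      rw [← neg_one_smul ℂ, Finset.smul_sum]
      refine Finset.sum_congr rfl fun p _ => ?_
      rw [QExt.rowRel (n := 1) (m := m) hq 0 0 p.1 p.2 le_rfl, if_pos rfl, TensorProduct.tmul_neg,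
        TensorProduct.tmul_smul]
      exact (neg_one_smul ℂ (M := Module.End ℂ (QExt n m q) ⊗[ℂ] QExt 1 m q) _).symm
    | cast i =>
      rw [if_neg (Fin.castSucc_lt_last i).ne, one_smul]
      simp only [addRow_castSucc, addRow_last, Finset.sum_mul, Finset.mul_sum, rAct_sum,
        Algebra.TensorProduct.tmul_mul_tmul, mul_one, one_mul]
      rw [← neg_one_smul ℂ, Finset.smul_sum]
      refine Finset.sum_congr rfl fun l _ => ?_
      rw [← rAct_tmul_left, neg_one_smul, ← TensorProduct.neg_tmul]
      congr 1
      ext v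
      rw [LinearMap.neg_apply, rAct_end_apply]
      exact braidOp_x_mul hq b l i a v
  | cast j =>
    induction i using Fin.lastCases with
    | last => exact absurd (Fin.castSucc_lt_last j) hij.not_gt
    | cast i =>
      simp only [addRow_castSucc, Fin.castSucc_inj]
      exact (QExt.rowRel (n := n) (m := m) hq).map
        (C := Module.End ℂ (QExt n m q) ⊗[ℂ] QExt 1 m q)
          ((Algebra.TensorProduct.includeLeft (S := ℂ) (B := QExt 1 m q)).comp
          (Algebra.lmul ℂ (QExt n m q))) i j b a (Fin.castSucc_le_castSucc_iff.1 hij)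

end Braiding

/-! ### The top form does not vanish -/

section TopForm

variable {n m : ℕ} {q : ℝ}

/-- The monomial of a word. -/
def mon (q : ℝ) (w : List (Idx n m)) : QExt n m q := (w.map QExt.x).prod

theorem mon_nil : mon q ([] : List (Idx n m)) = 1 := rfl

theorem mon_cons (a : Idx n m) (w : List (Idx n m)) : mon q (a :: w) = QExt.x a * mon q w := by
  simp [mon]

theorem mon_append (v w : List (Idx n m)) : mon q (v ++ w) = mon q v * mon q w := by
  simp [mon]

/-- All the indices, in lexicographic order. -/
def rowWord (n m : ℕ) : List (Idx n m) :=
  (List.finRange n).flatMap fun i => (List.finRange m).map fun j => (i, j)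

theorem rowWord_succ : rowWord (n + 1) m =
    (rowWord n m).map (fun p => (p.1.castSucc, p.2)) ++
      (List.finRange m).map fun j => (Fin.last n, j) := by
  simp [rowWord, List.finRange_succ_last, List.flatMap_append, List.map_flatMap, List.flatMap_map,
    Function.comp_def]

theorem topForm_eq : topForm n m q = mon q (rowWord n m) := by
  have h : (List.ofFn fun k : Fin (n * m) => finProdFinEquiv.symm k) = rowWord n m := by
    rw [List.ofFn_mul, rowWord, List.flatMap_def, ← List.ofFn_eq_map]
    congr 2
    ext1 i
    rw [← List.ofFn_eq_map]
    congr 1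
    ext1 j
    rw [Equiv.symm_apply_eq]
    ext
    simp [finProdFinEquiv, mul_comm, add_comm]
  rw [topForm, mon, ← h, List.map_ofFn]
  rfl

theorem mem_rowWord (a : Idx n m) : a ∈ rowWord n m := by
  simp [rowWord, Prod.ext_iff]

theorem length_rowWord : (rowWord n m).length = n * m := by
  simp [rowWord, List.length_flatMap]

theorem nodup_rowWord : (rowWord n m).Nodup := by
  rw [rowWord, List.nodup_flatMap]
  refine ⟨fun i _ => (List.nodup_finRange m).map fun _ _ h => (Prod.ext_iff.1 h).2,
    (List.nodup_finRange n).imp fun {i j} hij => ?_⟩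
  rintro ⟨a, b⟩ h1 h2
  simp only [List.mem_map, Prod.mk.injEq] at h1 h2
  grind

theorem map_mon {B : Type*} [Ring B] [Algebra ℂ B] (f : QExt n m q →ₐ[ℂ] B)
    (w : List (Idx n m)) : f (mon q w) = (w.map fun a => f (QExt.x a)).prod := by
  rw [mon, map_list_prod, List.map_map]
  rfl

theorem QExt.nontrivial (hq : q ≠ 0) : Nontrivial (QExt n m q) := by
  obtain ⟨f, -⟩ := QExt.exists_lift (n := n) (m := m) (B := ℂ) hq (fun _ => 0) (by
    intro i j b a _
    simp [rAct])
  exact f.toRingHom.domain_nontrivial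

/-- In the representation by `addRow`, evaluating the operators at `1` sends the new top form to the
tensor product of the top forms for `n` rows and for one row. -/
theorem mon_rowWord_succ_ne_zero (hq : q ≠ 0) (h : mon q (rowWord n m) ≠ 0)
    (h1 : mon q (rowWord 1 m) ≠ 0) : mon q (rowWord (n + 1) m) ≠ 0 := by
  obtain ⟨f, hf⟩ := QExt.exists_lift hq _ (addRow_rowRel (n := n) (m := m) hq)
  let ev : Module.End ℂ (QExt n m q) ⊗[ℂ] QExt 1 m q →ₗ[ℂ] QExt n m q ⊗[ℂ] QExt 1 m q :=
    LinearMap.rTensor _ (LinearMap.applyₗ 1)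
  -- At `1` the braiding operators become Kronecker deltas, so a new-row generator on the right acts
  -- only on the second tensor factor.
  have hev (Z : Module.End ℂ (QExt n m q) ⊗[ℂ] QExt 1 m q) (b : Fin m) :
      ev (Z * addRow hq (Fin.last n, b)) = ev Z * (1 ⊗ₜ[ℂ] QExt.x (0, b)) := by
    induction Z with
    | zero => simp
    | add Z Z' hZ hZ' => rw [add_mul, map_add, hZ, hZ', map_add, add_mul]
    | tmul T y =>
      simp [addRow_last, Finset.mul_sum, ev, braidOp_one, TensorProduct.ite_tmul, apply_ite T]
  have hev' (l : List (Fin m)) (Z : Module.End ℂ (QExt n m q) ⊗[ℂ] QExt 1 m q) :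
      ev (Z * (l.map fun b => addRow hq (Fin.last n, b)).prod) =
        ev Z * (1 ⊗ₜ[ℂ] mon q (l.map fun b => (0, b))) := by
    induction l generalizing Z with
    | nil => simp [mon_nil, ← Algebra.TensorProduct.one_def]
    | cons b l ih =>
      rw [List.map_cons, List.prod_cons, ← mul_assoc, ih, hev, mul_assoc, List.map_cons, mon_cons,
        Algebra.TensorProduct.tmul_mul_tmul, one_mul]
  have hl (w : List (Idx n m)) : (w.map fun p => addRow hq (p.1.castSucc, p.2)).prod =
      LinearMap.mulLeft ℂ (mon q w) ⊗ₜ[ℂ] (1 : QExt 1 m q) := by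
    induction w with
    | nil => simp [mon_nil, Algebra.TensorProduct.one_def]; rfl
    | cons a w ih =>
      rw [List.map_cons, List.prod_cons, ih, addRow_castSucc, mon_cons, LinearMap.mulLeft_mul,
        Algebra.TensorProduct.tmul_mul_tmul, one_mul]
      rfl
  have key : ev (f (mon q (rowWord (n + 1) m))) =
      mon q (rowWord n m) ⊗ₜ[ℂ] mon q (rowWord 1 m) := by
    rw [map_mon (B := Module.End ℂ (QExt n m q) ⊗[ℂ] QExt 1 m q) f, rowWord_succ,
    List.map_append, List.prod_append, List.map_map, List.map_map]
    simp only [hf, Function.comp_def]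
    rw [hev', hl]
    simp [ev, rowWord, List.finRange_succ]
  intro h0
  rw [h0, map_zero, map_zero] at key
  obtain ⟨φ, hφ⟩ : ∃ φ : Module.Dual ℂ (QExt n m q), φ (mon q (rowWord n m)) ≠ 0 := by
    by_contra! h'
    exact h ((Module.forall_dual_apply_eq_zero_iff ℂ _).1 h')
  have := congr_arg (TensorProduct.lid ℂ _ ∘ LinearMap.rTensor (QExt 1 m q) φ) key
  simp only [Function.comp_apply, map_zero, LinearMap.rTensor_tmul, TensorProduct.lid_tmul] at this
  exact smul_ne_zero hφ h1 this.symm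

/-- The isomorphism that exchanges `V` and `W`. -/
theorem exists_swap (hq : q ≠ 0) :
    ∃ f : QExt n m q →ₐ[ℂ] QExt m n q, ∀ a, f (QExt.x a) = QExt.x a.swap := by
  refine QExt.exists_lift hq (fun a => QExt.x a.swap) ((rowRel_iff hq _).2 ?_)
  rw [Pplus_smul_iff hq (fun e => (QExt.x e.1.swap * QExt.x e.2.swap : QExt m n q))]
  intro a
  have h := (Pplus_smul_iff hq (fun e => (QExt.x e.1 * QExt.x e.2 : QExt m n q))).1 QExt.rel
    (a.1.swap, a.2.swap)
  rw [← h, ← (Equiv.prodCongr (Equiv.prodComm (Fin n) (Fin m))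
    (Equiv.prodComm (Fin n) (Fin m))).sum_comp]
  refine Finset.sum_congr rfl fun e _ => ?_
  congr 1
  simp [Rhat, mul_comm]

/-- Adding rows reduces the claim to one row. Exchanging `V` and `W` turns one row into one column,
and adding rows again reduces that to `n = m = 1`. -/
theorem mon_rowWord_ne_zero (hq : q ≠ 0) : mon q (rowWord n m) ≠ 0 := by
  have key (m : ℕ) (h : mon q (rowWord 1 m) ≠ 0) (n : ℕ) : mon q (rowWord n m) ≠ 0 := by
    induction n with
    | zero =>
      have := QExt.nontrivial (n := 0) (m := m) hq
      simp [rowWord, mon]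
    | succ n ih => exact mon_rowWord_succ_ne_zero hq ih h
  refine key m ?_ n
  have h1 : mon q (rowWord m 1) ≠ 0 := by
    refine key 1 ?_ m
    -- For `n = m = 1` the only relation is `x² = 0`, and the dual numbers provide a nonzero `x`.
    obtain ⟨f, hf⟩ := QExt.exists_lift (n := 1) (m := 1) (B := TrivSqZeroExt ℂ ℂ) hq
      (fun _ => TrivSqZeroExt.inr 1) (by
        intro i j b a _
        simp [rAct])
    intro h
    have := hf (0, 0)
    rw [show (QExt.x (0, 0) : QExt 1 1 q) = 0 by
      simpa [rowWord, mon, List.finRange_succ] using h, map_zero] at this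
    simpa using congr_arg TrivSqZeroExt.snd this
  intro h
  obtain ⟨f, hf⟩ := exists_swap (n := 1) (m := m) hq
  apply h1
  rw [← map_zero f, ← h, map_mon]
  simp [hf, mon, rowWord, List.finRange_succ, List.map_eq_flatMap,
    List.flatMap_assoc]

end TopForm

/-! ### The weight filtration -/

section Weight

variable {n m : ℕ} {q : ℝ}

/-- The weight of an index. -/
def wt (a : Idx n m) : ℕ := a.1 * a.2

/-- The straightening rule reads `x² = -q² x²`, and `1 + q² ≠ 0` because `q` is real. -/
theorem QExt.x_mul_self (hq : q ≠ 0) (a : Idx n m) : (QExt.x a * QExt.x a : QExt n m q) = 0 := by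
  obtain ⟨i, b⟩ := a
  have h := QExt.rowRel (q := q) hq i i b b le_rfl
  rw [if_pos rfl, rAct_eq, if_pos rfl, if_neg (lt_irrefl _), add_zero, eq_neg_iff_add_eq_zero,
    smul_smul] at h
  have h2 : (1 + (q : ℂ) * q) • (QExt.x (i, b) * QExt.x (i, b) : QExt n m q) = 0 := by
    rw [add_smul, one_smul, h]
  refine (smul_eq_zero.1 h2).resolve_left ?_
  have : 1 + q * q ≠ 0 := by nlinarith [sq_nonneg q]
  exact_mod_cast this

/-- Two generators commute up to a factor and a term of larger weight. -/
theorem QExt.exists_x_mul_x (hq : q ≠ 0) (a b : Idx n m) (hab : a ≠ b) :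
    ∃ c d : ℝ, ∃ a' b' : Idx n m, c ≠ 0 ∧ (d ≠ 0 → wt a + wt b < wt a' + wt b') ∧
      (QExt.x a * QExt.x b : QExt n m q) =
        c • (QExt.x b * QExt.x a) + d • (QExt.x a' * QExt.x b') := by
  have key (i j : Fin n) (b a : Fin m) (hij : i ≤ j) (hab : ¬(j = i ∧ b = a)) :
      ∃ c d : ℝ, ∃ a' b' : Idx n m, c ≠ 0 ∧ (d ≠ 0 → wt (j, b) + wt (i, a) < wt a' + wt b') ∧
      (QExt.x (j, b) * QExt.x (i, a) : QExt n m q) =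
        c • (QExt.x (i, a) * QExt.x (j, b)) + d • (QExt.x a' * QExt.x b') := by
    have hq' : (q : ℂ) ≠ 0 := by exact_mod_cast hq
    have h := QExt.rowRel (q := q) hq i j b a hij
    rw [rAct_eq] at h
    by_cases hba : b = a
    · have hji : i ≠ j := fun h' => hab ⟨h'.symm, hba⟩
      rw [if_neg hji, if_pos hba, if_neg hba.not_lt, add_zero, one_smul] at h
      refine ⟨-q, 0, (i, a), (i, a), neg_ne_zero.2 hq, fun h => absurd rfl h, ?_⟩
      rw [h, zero_smul, add_zero, neg_smul, Complex.coe_smul]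
    rw [if_neg hba] at h
    rcases hij.lt_or_eq with hij | rfl
    · rw [if_neg hij.ne, one_smul] at h
      by_cases hlt : b < a
      -- The only case with a correction term: the weight grows by `(j - i)(a - b) > 0`. In the
      -- other cases `d = 0`, and `(i, a), (i, a)` is a filler.
      · refine ⟨-1, -(q - q⁻¹), (i, b), (j, a), by simp, fun _ => ?_, ?_⟩
        · obtain ⟨k, hk⟩ := Nat.exists_eq_add_of_lt hij
          obtain ⟨l, hl⟩ := Nat.exists_eq_add_of_lt hlt
          simp only [wt, hk, hl]
          ring_nf
          omega
        · rw [if_pos hlt, ← Complex.ofReal_inv, ← Complex.ofReal_sub, Complex.coe_smul] at h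
          rw [h]
          module
      · rw [if_neg hlt, add_zero] at h
        exact ⟨-1, 0, (i, a), (i, a), by simp, fun h => absurd rfl h, by rw [h]; simp⟩
    · rw [if_pos rfl] at h
      by_cases hlt : b < a
      · refine ⟨-q⁻¹, 0, (i, a), (i, a), by simpa using hq, fun h => absurd rfl h, ?_⟩
        rw [if_pos hlt] at h
        -- Within one row, the extra term of `R̂` is a multiple of the left-hand side. Collecting
        -- gives the factor `1 + q (q - q⁻¹) = q²`.
        have h2 : (q : ℂ) • (q : ℂ) • (QExt.x (i, b) * QExt.x (i, a) : QExt n m q) =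
            -((q : ℂ) • (QExt.x (i, a) * QExt.x (i, b))) := by
          have h3 := sub_eq_zero.2 h
          rw [← sub_eq_zero, ← h3]
          match_scalars
          · field_simp
            ring
          · ring
        rw [← smul_neg, smul_right_injective _ hq' |>.eq_iff] at h2
        rw [← Complex.coe_smul, zero_smul, add_zero]
        push_cast
        rw [neg_smul, ← smul_neg, ← h2, smul_smul, inv_mul_cancel₀ hq', one_smul]
      · refine ⟨-q, 0, (i, a), (i, a), by simpa using hq, fun h => absurd rfl h, ?_⟩
        rw [if_neg hlt, add_zero] at h
        rw [h, zero_smul, add_zero, neg_smul, Complex.coe_smul]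
  have hsymm : a.1 ≤ b.1 → _ := fun h => key a.1 b.1 b.2 a.2 h
    (fun h' => hab (Prod.ext h'.1.symm h'.2.symm))
  rcases le_total b.1 a.1 with h | h
  · exact key b.1 a.1 a.2 b.2 h (fun h' => hab (Prod.ext h'.1 h'.2))
  · obtain ⟨c, d, a', b', hc, hd, he⟩ := hsymm h
    -- The other order comes from solving the same relation for the other product, which is possible
    -- since `c ≠ 0`.
    refine ⟨c⁻¹, -(c⁻¹ * d), a', b', inv_ne_zero hc, fun h' => ?_, ?_⟩
    · rw [add_comm]
      exact hd (by rintro rfl; simp at h')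
    · rw [he, smul_add, smul_smul, smul_smul, inv_mul_cancel₀ hc]
      simp

/-- The weight of a word. -/
def wtWord (w : List (Idx n m)) : ℕ := (w.map wt).sum

theorem wtWord_cons (a : Idx n m) (w : List (Idx n m)) : wtWord (a :: w) = wt a + wtWord w := by
  simp [wtWord]

theorem wtWord_append (v w : List (Idx n m)) : wtWord (v ++ w) = wtWord v + wtWord w := by
  simp [wtWord]

theorem wtWord_perm {v w : List (Idx n m)} (h : v.Perm w) : wtWord v = wtWord w :=
  (h.map wt).sum_eq

theorem wtWord_le (w : List (Idx n m)) : wtWord w ≤ w.length * (n * m) := by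
  induction w with
  | nil => simp [wtWord]
  | cons a w ih =>
    rw [wtWord_cons, List.length_cons, add_mul, one_mul, add_comm]
    exact add_le_add ih (Nat.mul_le_mul a.1.2.le a.2.2.le)

variable (n m q) in
/-- The real span of the monomials of degree `r` and weight at least `k`. -/
def fil (r k : ℕ) : Submodule ℝ (QExt n m q) :=
  Submodule.span ℝ (mon q '' {w | w.length = r ∧ k ≤ wtWord w})

theorem mon_mem_fil {r k : ℕ} {w : List (Idx n m)} (h : w.length = r) (hk : k ≤ wtWord w) :
    mon q w ∈ fil n m q r k :=
  Submodule.subset_span ⟨w, ⟨h, hk⟩, rfl⟩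

theorem fil_anti (r : ℕ) : Antitone (fil n m q r) := fun _ _ h =>
  Submodule.span_mono (Set.image_mono fun _ hw => ⟨hw.1, h.trans hw.2⟩)

theorem x_mul_mem_fil {r k : ℕ} {y : QExt n m q} (a : Idx n m) (hy : y ∈ fil n m q r k) :
    QExt.x a * y ∈ fil n m q (r + 1) (wt a + k) := by
  induction hy using Submodule.span_induction with
  | mem y hy =>
    obtain ⟨w, ⟨hw, hk⟩, rfl⟩ := hy
    rw [← mon_cons]
    exact mon_mem_fil (by simp [hw]) (by rw [wtWord_cons]; omega)
  | zero => simp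
  | add y z _ _ hy hz => rw [mul_add]; exact add_mem hy hz
  | smul c y _ hy => rw [mul_smul_comm]; exact Submodule.smul_mem _ _ hy

/-- An adjacent transposition changes the monomial by a nonzero factor and a term of larger weight.
Since the weight of a word is invariant under permutation, these errors accumulate in a single
filtration step. -/
theorem exists_mon_perm (hq : q ≠ 0) {v w : List (Idx n m)} (h : v.Perm w) :
    ∃ c : ℝ, c ≠ 0 ∧ mon q v - c • mon q w ∈ fil n m q v.length (wtWord v + 1) := by
  induction h with
  | nil => exact ⟨1, one_ne_zero, by simp⟩
  | cons a h ih =>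
    obtain ⟨c, hc, h⟩ := ih
    refine ⟨c, hc, ?_⟩
    rw [mon_cons, mon_cons, ← mul_smul_comm, ← mul_sub, wtWord_cons, add_assoc]
    exact x_mul_mem_fil a h
  | swap a b w =>
    by_cases hab : b = a
    · subst hab
      exact ⟨1, one_ne_zero, by simp⟩
    obtain ⟨c, d, a', b', hc, hd, he⟩ := QExt.exists_x_mul_x (q := q) hq b a hab
    refine ⟨c, hc, ?_⟩
    simp only [mon_cons, ← mul_assoc]
    rw [he, add_mul, smul_mul_assoc, add_sub_cancel_left, smul_mul_assoc]
    by_cases hd0 : d = 0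
    · simp [hd0]
    · refine Submodule.smul_mem _ _ ?_
      rw [mul_assoc, ← mon_cons, ← mon_cons]
      refine mon_mem_fil (by simp) ?_
      have := hd hd0
      simp only [wtWord_cons]
      omega
  | trans h1 h2 ih1 ih2 =>
    obtain ⟨c, hc, h⟩ := ih1
    obtain ⟨c', hc', h'⟩ := ih2
    refine ⟨c * c', mul_ne_zero hc hc', ?_⟩
    rw [← wtWord_perm h1, ← h1.length_eq] at h'
    have := add_mem h (Submodule.smul_mem _ c h')
    rwa [smul_sub, smul_smul, sub_add_sub_cancel] at this

/-- Two equal letters can be brought to the front modulo larger weight, and there their product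
vanishes. -/
theorem mon_mem_of_not_nodup (hq : q ≠ 0) {w : List (Idx n m)} (h : ¬w.Nodup) :
    mon q w ∈ fil n m q w.length (wtWord w + 1) := by
  rw [← List.exists_duplicate_iff_not_nodup] at h
  obtain ⟨a, ha⟩ := h
  obtain ⟨l, hl⟩ := (List.duplicate_iff_sublist.1 ha).exists_perm_append
  obtain ⟨c, -, h⟩ := exists_mon_perm (q := q) hq hl
  rw [show mon q ([a, a] ++ l) = 0 by
    rw [mon_append, mon_cons, mon_cons, mon_nil, mul_one, QExt.x_mul_self hq, zero_mul]] at h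
  simpa using h

variable (n m q) in
/-- The real span of the squarefree monomials of degree `r` and weight at least `k`. -/
def stdFil (r k : ℕ) : Submodule ℝ (QExt n m q) :=
  Submodule.span ℝ ((fun S : Finset (Idx n m) => mon q S.toList) ''
    {S | S.card = r ∧ k ≤ wtWord S.toList})

theorem stdFil_anti (r : ℕ) : Antitone (stdFil n m q r) := fun _ _ h =>
  Submodule.span_mono (Set.image_mono fun _ hw => ⟨hw.1, h.trans hw.2⟩)

/-- Descending induction on `k`: sorting a squarefree word, or dropping one with a repetition, costs
only terms of larger weight. Words of length `r` have weight at most `r * (n * m)`, so this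
terminates. -/
theorem fil_le_stdFil (hq : q ≠ 0) (r k : ℕ) : fil n m q r k ≤ stdFil n m q r k := by
  by_cases hk : r * (n * m) < k
  · refine Submodule.span_le.2 ?_
    rintro _ ⟨w, ⟨rfl, hw⟩, rfl⟩
    have := wtWord_le w
    omega
  · refine Submodule.span_le.2 ?_
    rintro _ ⟨w, ⟨hr, hw⟩, rfl⟩
    have ih := (fil_le_stdFil hq r (k + 1)).trans (stdFil_anti r k.le_succ)
    have hle : fil n m q w.length (wtWord w + 1) ≤ fil n m q r (k + 1) := by
      rw [hr]
      exact fil_anti r (by omega)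
    by_cases hd : w.Nodup
    · have hp : w.Perm w.toFinset.toList :=
        (List.perm_ext_iff_of_nodup hd (Finset.nodup_toList _)).2 (by simp)
      obtain ⟨c, -, h⟩ := exists_mon_perm (q := q) hq hp
      have h1 : mon q w.toFinset.toList ∈ stdFil n m q r k :=
        Submodule.subset_span ⟨w.toFinset, ⟨by rw [List.toFinset_card_of_nodup hd, hr],
          by rwa [← wtWord_perm hp]⟩, rfl⟩
      have := add_mem (ih (hle h)) (Submodule.smul_mem _ c h1)
      rwa [sub_add_cancel] at this
    · exact ih (hle (mon_mem_of_not_nodup hq hd))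
  termination_by r * (n * m) + 1 - k

/-! ### The top degree -/

variable (n m) in
/-- The weight of the top form. -/
def wtTop : ℕ := wtWord (rowWord n m)

theorem perm_rowWord_of_nodup {w : List (Idx n m)} (hw : w.Nodup) (hl : w.length = n * m) :
    w.Perm (rowWord n m) := by
  refine (List.subperm_of_subset hw fun a _ => mem_rowWord a).perm_of_length_le ?_
  rw [length_rowWord, hl]

/-- A squarefree word of length `nm` uses every index once, so its weight is exactly `wtTop`;
nothing squarefree lies above. Therefore all reorderings in top degree are exact up to a scalar. -/
theorem fil_top (hq : q ≠ 0) : fil n m q (n * m) (wtTop n m + 1) = ⊥ := by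
  rw [eq_bot_iff]
  refine (fil_le_stdFil hq _ _).trans (Submodule.span_le.2 ?_)
  rintro _ ⟨S, ⟨hS, hw⟩, rfl⟩
  have := wtWord_perm (perm_rowWord_of_nodup S.nodup_toList (by rw [Finset.length_toList, hS]))
  rw [wtTop] at hw
  omega

theorem mon_eq_zero (hq : q ≠ 0) {w : List (Idx n m)} (hl : w.length = n * m) (hw : ¬w.Nodup)
    (hwt : wtTop n m ≤ wtWord w) : mon q w = 0 := by
  have h := mon_mem_of_not_nodup (q := q) hq hw
  rw [hl] at h
  simpa using (fil_top (q := q) hq).le (fil_anti _ (by omega) h)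

theorem exists_mon_eq_smul_topForm (hq : q ≠ 0) {w : List (Idx n m)} (hw : w.Nodup)
    (hl : w.length = n * m) : ∃ c : ℝ, c ≠ 0 ∧ mon q w = c • topForm n m q := by
  have hp := perm_rowWord_of_nodup hw hl
  obtain ⟨c, hc, h⟩ := exists_mon_perm (q := q) hq hp
  rw [hl, wtWord_perm hp, show wtWord (rowWord n m) = wtTop n m from rfl, fil_top hq,
    Submodule.mem_bot, sub_eq_zero] at h
  exact ⟨c, hc, by rw [h, topForm_eq]⟩

theorem exists_mon_eq_smul (hq : q ≠ 0) {w : List (Idx n m)} (hl : w.length = n * m) :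
    ∃ c : ℝ, mon q w = c • topForm n m q := by
  have h : mon q w ∈ Submodule.span ℝ {topForm n m q} := by
    have h1 := fil_le_stdFil hq _ _ (mon_mem_fil (q := q) hl (Nat.zero_le _))
    refine (Submodule.span_le.2 ?_ : stdFil n m q (n * m) 0 ≤ _) h1
    rintro _ ⟨S, ⟨hS, -⟩, rfl⟩
    obtain ⟨c, -, hc⟩ := exists_mon_eq_smul_topForm (q := q) hq S.nodup_toList
      (by rw [Finset.length_toList, hS])
    rw [SetLike.mem_coe, Submodule.mem_span_singleton]
    exact ⟨c, hc.symm⟩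
  obtain ⟨c, hc⟩ := Submodule.mem_span_singleton.1 h
  exact ⟨c, hc.symm⟩

theorem topForm_ne_zero (hq : q ≠ 0) : topForm n m q ≠ 0 := by
  rw [topForm_eq]
  exact mon_rowWord_ne_zero hq

/-! ### The graded components and the pairings -/

theorem mon_mem_extPow (w : List (Idx n m)) : mon q w ∈ extPow n m q w.length := by
  induction w with
  | nil => exact Submodule.one_le.1 (pow_zero _).ge
  | cons a w ih =>
    rw [mon_cons, List.length_cons, extPow, pow_succ']
    exact Submodule.mul_mem_mul (Submodule.subset_span ⟨a, rfl⟩) ih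

theorem extPow_le (r : ℕ) : extPow n m q r ≤
    Submodule.span ℂ (mon q '' {w : List (Idx n m) | w.length = r}) := by
  induction r with
  | zero =>
    rw [extPow, pow_zero, Submodule.one_le]
    exact Submodule.subset_span ⟨[], rfl, rfl⟩
  | succ r ih =>
    rw [extPow, pow_succ']
    refine (mul_le_mul_right ih _).trans ?_
    rw [Submodule.span_mul_span, Submodule.span_le]
    rintro _ ⟨_, ⟨a, rfl⟩, _, ⟨w, hw, rfl⟩, rfl⟩
    refine Submodule.subset_span ⟨a :: w, ?_, mon_cons a w⟩
    simpa using hw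

theorem exists_eq_sum (hq : q ≠ 0) {r : ℕ} {y : QExt n m q} (hy : y ∈ extPow n m q r) :
    ∃ c : Finset (Idx n m) → ℂ, y = ∑ S with S.card = r, c S • mon q S.toList := by
  have h : y ∈ Submodule.span ℂ ((fun S : Finset (Idx n m) => mon q S.toList) ''
      (Finset.univ.filter fun S : Finset (Idx n m) => S.card = r)) := by
    refine (extPow_le r).trans (Submodule.span_le.2 ?_) hy
    rintro _ ⟨w, hw, rfl⟩
    have h1 := fil_le_stdFil hq _ _ (mon_mem_fil (q := q) hw (Nat.zero_le _))
    refine Submodule.span_le_restrictScalars ℝ ℂ _ (Submodule.span_mono (Set.image_mono ?_) h1)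
    rintro S ⟨hS, -⟩
    simpa using hS
  rw [Submodule.mem_span_image_finset_iff_exists_fun] at h
  obtain ⟨c, hc⟩ := h
  refine ⟨fun S => if h : S ∈ Finset.univ.filter fun S : Finset (Idx n m) => S.card = r then c ⟨S, h⟩
    else 0, ?_⟩
  rw [← hc, ← Finset.sum_attach (Finset.univ.filter fun S : Finset (Idx n m) => S.card = r)]
  refine Finset.sum_congr rfl fun S _ => ?_
  simp only [dif_pos S.2]

theorem nodup_append_iff_eq_compl {S T : Finset (Idx n m)} (h : T.card = S.card) :
    (T.toList ++ Sᶜ.toList).Nodup ↔ T = S := by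
  rw [List.nodup_append']
  simp only [Finset.nodup_toList, true_and]
  constructor
  · intro hd
    refine Finset.eq_of_subset_of_card_le (fun a ha => ?_) h.ge
    by_contra haS
    exact hd (Finset.mem_toList.2 ha) (by simpa using haS)
  · rintro rfl a h1 h2
    simp at h1 h2
    exact h2 h1

theorem length_append_compl {S T : Finset (Idx n m)} (h : T.card = S.card) :
    (T.toList ++ Sᶜ.toList).length = n * m := by
  have := Finset.card_le_univ S
  simp [Finset.card_compl, h] at *
  omega

theorem wtWord_append_compl (S : Finset (Idx n m)) :
    wtWord (S.toList ++ Sᶜ.toList) = wtTop n m :=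
  wtWord_perm (perm_rowWord_of_nodup ((nodup_append_iff_eq_compl rfl).2 rfl)
    (length_append_compl rfl))

/-- Every nonzero element of degree `r` has a multiple by a squarefree monomial on each side that is
a nonzero multiple of the top form. -/
theorem exists_mul_mon_ne_zero (hq : q ≠ 0) {r : ℕ} {y : QExt n m q} (hy : y ∈ extPow n m q r)
    (hy0 : y ≠ 0) : ∃ S : Finset (Idx n m), S.card = r ∧
      y * mon q Sᶜ.toList ≠ 0 ∧ mon q Sᶜ.toList * y ≠ 0 := by
  obtain ⟨c, rfl⟩ := exists_eq_sum hq hy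
  -- `S` is a monomial of least weight occurring in `y`. Multiplying by its complement, any other
  -- term acquires a repeated letter while its weight stays at least `wtTop`, so `mon_eq_zero` kills
  -- it.
  obtain ⟨S, hS, hmin⟩ : ∃ S : Finset (Idx n m), (S.card = r ∧ c S ≠ 0) ∧
      ∀ T : Finset (Idx n m), T.card = r → c T ≠ 0 → wtWord S.toList ≤ wtWord T.toList := by
    obtain ⟨S, hS, hmin⟩ := Finset.exists_min_image
      (Finset.univ.filter fun S : Finset (Idx n m) => S.card = r ∧ c S ≠ 0)
      (fun S => wtWord S.toList) (by
        by_contra h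
        rw [Finset.not_nonempty_iff_eq_empty, Finset.filter_eq_empty_iff] at h
        refine hy0 (Finset.sum_eq_zero fun S hS => ?_)
        have := h (Finset.mem_univ S)
        rw [Finset.mem_filter] at hS
        simp only [hS.2, true_and, not_not] at this
        simp [this])
    simp only [Finset.mem_filter, Finset.mem_univ, true_and] at hS hmin
    exact ⟨S, hS, fun T h1 h2 => hmin T ⟨h1, h2⟩⟩
  have hdup (T : Finset (Idx n m)) (hT : T.card = r) (hTS : T ≠ S) (w : List (Idx n m))
      (hw : w.Perm (T.toList ++ Sᶜ.toList)) : c T • mon q w = 0 := by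
    by_cases hc : c T = 0
    · rw [hc, zero_smul]
    rw [mon_eq_zero hq, smul_zero]
    · rw [hw.length_eq, length_append_compl (hT.trans hS.1.symm)]
    · rw [hw.nodup_iff, nodup_append_iff_eq_compl (hT.trans hS.1.symm)]
      exact hTS
    · rw [wtWord_perm hw, ← wtWord_append_compl S, wtWord_append, wtWord_append]
      exact Nat.add_le_add_right (hmin T hT hc) _
  have hne (w : List (Idx n m)) (hw : w.Perm (S.toList ++ Sᶜ.toList)) : c S • mon q w ≠ 0 := by
    obtain ⟨k, hk, h⟩ := exists_mon_eq_smul_topForm (q := q) hq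
      (hw.nodup_iff.2 ((nodup_append_iff_eq_compl rfl).2 rfl))
      (hw.length_eq.trans (length_append_compl rfl))
    rw [h]
    exact smul_ne_zero hS.2 (smul_ne_zero hk (topForm_ne_zero hq))
  refine ⟨S, hS.1, ?_, ?_⟩
  · rw [Finset.sum_mul, Finset.sum_eq_single S]
    · rw [smul_mul_assoc, ← mon_append]
      exact hne _ (List.Perm.refl _)
    · intro T hT hTS
      rw [smul_mul_assoc, ← mon_append]
      exact hdup T (Finset.mem_filter.1 hT).2 hTS _ (List.Perm.refl _)
    · simp [hS.1]
  · rw [Finset.mul_sum, Finset.sum_eq_single S]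
    · rw [mul_smul_comm, ← mon_append]
      exact hne _ List.perm_append_comm
    · intro T hT hTS
      rw [mul_smul_comm, ← mon_append]
      exact hdup T (Finset.mem_filter.1 hT).2 hTS _ List.perm_append_comm
    · simp [hS.1]

theorem mon_compl_mem_extPow {r s : ℕ} (h : r + s = n * m) {S : Finset (Idx n m)}
    (hS : S.card = r) : mon q Sᶜ.toList ∈ extPow n m q s := by
  have := mon_mem_extPow (q := q) Sᶜ.toList
  rwa [Finset.length_toList, Finset.card_compl, hS, Fintype.card_prod, Fintype.card_fin,
    Fintype.card_fin, ← h, Nat.add_sub_cancel_left] at this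

theorem wedgePairing_nondegenerate (hq : q ≠ 0) {r s : ℕ} (h : r + s = n * m) :
    (wedgePairing n m q r s).Nondegenerate := by
  constructor
  · rintro ⟨y, hy⟩ hy0
    by_contra hne
    obtain ⟨S, hS, h1, -⟩ := exists_mul_mon_ne_zero hq hy (fun h => hne (Subtype.ext h))
    exact h1 (congr_arg Subtype.val (hy0 ⟨_, mon_compl_mem_extPow h hS⟩))
  · rintro ⟨y, hy⟩ hy0
    by_contra hne
    obtain ⟨S, hS, -, h1⟩ := exists_mul_mon_ne_zero hq hy (fun h => hne (Subtype.ext h))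
    exact h1 (congr_arg Subtype.val (hy0 ⟨_, mon_compl_mem_extPow (by rwa [add_comm]) hS⟩))

theorem extPow_top (hq : q ≠ 0) : extPow n m q (n * m) = ℂ ∙ topForm n m q := by
  apply le_antisymm
  · refine (extPow_le _).trans (Submodule.span_le.2 ?_)
    rintro _ ⟨w, hw, rfl⟩
    obtain ⟨c, hc⟩ := exists_mon_eq_smul (q := q) hq hw
    rw [hc, SetLike.mem_coe, Submodule.mem_span_singleton]
    exact ⟨c, Complex.coe_smul c _⟩
  · rw [Submodule.span_singleton_le_iff_mem, topForm_eq]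
    have := mon_mem_extPow (q := q) (rowWord n m)
    rwa [length_rowWord] at this

theorem finrank_extPow_top (hq : q ≠ 0) : Module.finrank ℂ (extPow n m q (n * m)) = 1 := by
  rw [extPow_top hq]
  exact finrank_span_singleton (topForm_ne_zero hq)

end Weight

/-! ### Words and coactions -/

section Words

theorem cons_prod_injective {ι : Type*} : Function.Injective fun p : ι × List ι => p.1 :: p.2 := by
  rintro ⟨a, w⟩ ⟨b, v⟩ h
  simpa using h

/-- The words of length `r`. -/
def words (ι : Type*) [Fintype ι] : ℕ → Finset (List ι)
  | 0 => {[]}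
  | r + 1 => (Finset.univ ×ˢ words ι r).map ⟨fun p => p.1 :: p.2, cons_prod_injective⟩

theorem mem_words {ι : Type*} [Fintype ι] {r : ℕ} {w : List ι} :
    w ∈ words ι r ↔ w.length = r := by
  induction r generalizing w with
  | zero => simp [words]
  | succ r ih =>
    simp only [words, Finset.mem_map, Finset.mem_product, Finset.mem_univ, true_and, ih,
      Function.Embedding.coeFn_mk, Prod.exists]
    cases w <;> simp

theorem sum_words_zero {ι M : Type*} [Fintype ι] [AddCommMonoid M] (f : List ι → M) :
    ∑ w ∈ words ι 0, f w = f [] := by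
  simp [words]

theorem sum_words_succ {ι M : Type*} [Fintype ι] [AddCommMonoid M] (r : ℕ) (f : List ι → M) :
    ∑ w ∈ words ι (r + 1), f w = ∑ a, ∑ w ∈ words ι r, f (a :: w) := by
  rw [words, Finset.sum_map, Finset.sum_product]
  rfl

variable {ι B : Type*} [Monoid B]

/-- The product of the entries of a matrix along two words. -/
def matMon (U : Matrix ι ι B) (v w : List ι) : B :=
  (List.zipWith (fun a b => U a b) v w).prod

theorem matMon_nil (U : Matrix ι ι B) : matMon U [] [] = 1 := rfl

theorem matMon_cons (U : Matrix ι ι B) (a b : ι) (v w : List ι) :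
    matMon U (a :: v) (b :: w) = U a b * matMon U v w := by
  simp [matMon]

theorem map_matMon {C F : Type*} [Monoid C] [FunLike F B C] [MonoidHomClass F B C]
    (f : F) (U : Matrix ι ι B) (v w : List ι) : f (matMon U v w) = matMon (U.map f) v w := by
  rw [matMon, map_list_prod, List.map_zipWith]
  rfl

end Words

section Coaction

variable {n m : ℕ} {q : ℝ}

theorem coactL_x (a : Idx n m) :
    coactL n m q (QExt.x a) = ∑ b, OM.u n m q a b ⊗ₜ[ℂ] (QExt.x b : QExt n m q) :=
  (RingQuot.liftAlgHom_mkAlgHom_apply ℂ _ _ _).trans (by simp)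

theorem coactR_x (a : Idx n m) :
    coactR n m q (QExt.x a) = ∑ b, (QExt.x b : QExt n m q) ⊗ₜ[ℂ] OM.u n m q b a :=
  (RingQuot.liftAlgHom_mkAlgHom_apply ℂ _ _ _).trans (by simp)

theorem coactL_mon (v : List (Idx n m)) : coactL n m q (mon q v) =
    ∑ w ∈ words (Idx n m) v.length, matMon (OM.u n m q) v w ⊗ₜ[ℂ] mon q w := by
  induction v with
  | nil => rw [List.length_nil, sum_words_zero, mon_nil, map_one]; rfl
  | cons a v ih =>
    rw [List.length_cons, sum_words_succ, mon_cons, map_mul, ih, coactL_x, Finset.sum_mul]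
    simp only [Finset.mul_sum, Algebra.TensorProduct.tmul_mul_tmul, matMon_cons, mon_cons]

theorem coactR_mon (v : List (Idx n m)) : coactR n m q (mon q v) =
    ∑ w ∈ words (Idx n m) v.length, mon q w ⊗ₜ[ℂ] matMon (OM.u n m q) w v := by
  induction v with
  | nil => rw [List.length_nil, sum_words_zero, mon_nil, map_one]; rfl
  | cons a v ih =>
    rw [List.length_cons, sum_words_succ, mon_cons, map_mul, ih, coactR_x, Finset.sum_mul]
    simp only [Finset.mul_sum, Algebra.TensorProduct.tmul_mul_tmul, matMon_cons, mon_cons]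

end Coaction

/-! ### The coefficients of the top form -/

section TopCoeff

variable {n m : ℕ} {q : ℝ}

open Classical in
variable (q) in
/-- The coefficient of a monomial of top degree with respect to the top form. -/
def topCoeff (w : List (Idx n m)) : ℝ :=
  if h : ∃ c : ℝ, mon q w = c • topForm n m q then h.choose else 0

theorem mon_eq_topCoeff_smul (hq : q ≠ 0) {w : List (Idx n m)} (hl : w.length = n * m) :
    mon q w = (topCoeff q w : ℂ) • topForm n m q := by
  have h := exists_mon_eq_smul (q := q) hq hl
  rw [topCoeff, dif_pos h, Complex.coe_smul]
  exact h.choose_spec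

theorem topForm_smul_injective (hq : q ≠ 0) {c d : ℂ}
    (h : c • topForm n m q = d • topForm n m q) : c = d :=
  smul_left_injective ℂ (topForm_ne_zero hq) h

theorem topCoeff_rowWord (hq : q ≠ 0) : topCoeff q (rowWord n m) = 1 := by
  have h := mon_eq_topCoeff_smul (q := q) hq (length_rowWord (n := n) (m := m))
  rw [← topForm_eq] at h
  have := topForm_smul_injective hq ((one_smul ℂ _).trans h)
  exact_mod_cast this.symm

theorem topCoeff_ne_zero (hq : q ≠ 0) {w : List (Idx n m)} (hw : w.Nodup)
    (hl : w.length = n * m) : topCoeff q w ≠ 0 := by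
  intro h0
  obtain ⟨c, hc, h⟩ := exists_mon_eq_smul_topForm (q := q) hq hw hl
  rw [mon_eq_topCoeff_smul hq hl, h0, ← Complex.coe_smul] at h
  exact hc (by exact_mod_cast (topForm_smul_injective hq h).symm)

theorem tmul_topForm_injective (hq : q ≠ 0) {A : Type*} [AddCommGroup A] [Module ℂ A] {y z : A}
    (h : y ⊗ₜ[ℂ] topForm n m q = z ⊗ₜ[ℂ] topForm n m q) : y = z := by
  obtain ⟨φ, hφ⟩ : ∃ φ : Module.Dual ℂ (QExt n m q), φ (topForm n m q) ≠ 0 := by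
    by_contra! h'
    exact topForm_ne_zero hq ((Module.forall_dual_apply_eq_zero_iff ℂ _).1 h')
  have := congr_arg (TensorProduct.rid ℂ A ∘ LinearMap.lTensor A φ) h
  simp only [Function.comp_apply, LinearMap.lTensor_tmul, TensorProduct.rid_tmul] at this
  exact smul_right_injective A hφ this

theorem topForm_tmul_injective (hq : q ≠ 0) {A : Type*} [AddCommGroup A] [Module ℂ A] {y z : A}
    (h : topForm n m q ⊗ₜ[ℂ] y = topForm n m q ⊗ₜ[ℂ] z) : y = z :=
  tmul_topForm_injective hq (congr_arg (TensorProduct.comm ℂ _ _) h)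

/-- `R̂` only permutes the two indices of a pair, so it preserves torus weights. -/
theorem rAct_torus (g : Fin m → ℂ) {B : Type*} [AddCommGroup B] [Module ℂ B]
    (F : Fin m → Fin m → B) (b a : Fin m) :
    rAct q (fun c d => (g c * g d) • F c d) b a = (g b * g a) • rAct q F b a := by
  simp only [rAct_eq]
  split_ifs <;> module

/-- The torus acts on the top coefficients by a character. -/
theorem prod_eq_of_topCoeff_ne_zero (hq : q ≠ 0) (f : Fin n → ℂ) (g : Fin m → ℂ)
    {w : List (Idx n m)} (hl : w.length = n * m) (hw : topCoeff q w ≠ 0) :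
    (w.map fun a => f a.1 * g a.2).prod = ((rowWord n m).map fun a => f a.1 * g a.2).prod := by
  -- `θ` rescales each generator by its torus character. Every monomial is an eigenvector, so one
  -- that is a nonzero multiple of `ω` has the same eigenvalue as `ω`.
  obtain ⟨θ, hθ⟩ := QExt.exists_lift hq
    (fun a : Idx n m => (f a.1 * g a.2) • (QExt.x a : QExt n m q)) (by
      intro i j b a hij
      dsimp only
      simp only [smul_mul_smul_comm]
      rw [QExt.rowRel hq i j b a hij]
      have h (c d : Fin m) : (f i * g c * (f j * g d)) • (QExt.x (i, c) * QExt.x (j, d)) =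
          (g c * g d) • ((f i * f j) • (QExt.x (i, c) * QExt.x (j, d)) : QExt n m q) := by
        rw [smul_smul]
        congr 1
        ring
      simp only [h]
      rw [rAct_torus, rAct_smul]
      module)
  have key (w : List (Idx n m)) :
      θ (mon q w) = (w.map fun a => f a.1 * g a.2).prod • mon q w := by
    induction w with
    | nil => simp [mon_nil]
    | cons a w ih =>
      rw [mon_cons, map_mul, hθ, ih, smul_mul_smul_comm, List.map_cons, List.prod_cons]
  have h := key w
  rw [mon_eq_topCoeff_smul hq hl, map_smul, topForm_eq, key, ← topForm_eq, smul_smul,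
    smul_smul, mul_comm] at h
  exact (mul_right_cancel₀ (by exact_mod_cast hw) (topForm_smul_injective hq h)).symm

theorem eq_of_topCoeff_ne_zero (hq : q ≠ 0) {a c : Idx n m} {v w A : List (Idx n m)}
    (hv : v.Perm (a :: A)) (hw : w.Perm (c :: A)) (hA : A.length + 1 = n * m)
    (h1 : topCoeff q v ≠ 0) (h2 : topCoeff q w ≠ 0) : a = c := by
  have key (f : Fin n → ℂ) (g : Fin m → ℂ) (hf : ∀ i, f i ≠ 0) (hg : ∀ j, g j ≠ 0) :
      f a.1 * g a.2 = f c.1 * g c.2 := by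
    have e1 := prod_eq_of_topCoeff_ne_zero hq f g (hv.length_eq.trans hA) h1
    have e2 := prod_eq_of_topCoeff_ne_zero hq f g (hw.length_eq.trans hA) h2
    rw [(hv.map _).prod_eq, List.map_cons, List.prod_cons] at e1
    rw [(hw.map _).prod_eq, List.map_cons, List.prod_cons, ← e1] at e2
    refine (mul_right_cancel₀ (List.prod_ne_zero ?_) e2).symm
    simp [hf, hg]
  ext1
  · by_contra hne
    -- Any nonzero value other than `1` separates the two rows.
    have h1 := key (fun i => if i = a.1 then 2 else 1) (fun _ => 1)
      (by intro i; split_ifs <;> simp) (by simp)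
    simp [Ne.symm hne] at h1
  · by_contra hne
    have h1 := key (fun _ => 1) (fun i => if i = a.2 then 2 else 1)
      (by simp) (by intro i; split_ifs <;> simp)
    simp [Ne.symm hne] at h1

/-! ### The quantum determinant -/

variable (n m q) in
/-- The quantum determinant. -/
def qdet : OM n m q :=
  ∑ w ∈ words (Idx n m) (n * m), (topCoeff q w : ℂ) • matMon (OM.u n m q) (rowWord n m) w

theorem coactL_topForm_aux (hq : q ≠ 0) {v : List (Idx n m)} (hv : v.length = n * m) :
    coactL n m q (mon q v) = (∑ w ∈ words (Idx n m) (n * m),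
      (topCoeff q w : ℂ) • matMon (OM.u n m q) v w) ⊗ₜ[ℂ] topForm n m q := by
  rw [coactL_mon, hv, TensorProduct.sum_tmul]
  refine Finset.sum_congr rfl fun w hw => ?_
  rw [mon_eq_topCoeff_smul hq (mem_words.1 hw), TensorProduct.tmul_smul, TensorProduct.smul_tmul']

theorem coactR_topForm_aux (hq : q ≠ 0) {v : List (Idx n m)} (hv : v.length = n * m) :
    coactR n m q (mon q v) = topForm n m q ⊗ₜ[ℂ] (∑ w ∈ words (Idx n m) (n * m),
      (topCoeff q w : ℂ) • matMon (OM.u n m q) w v) := by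
  rw [coactR_mon, hv, TensorProduct.tmul_sum]
  refine Finset.sum_congr rfl fun w hw => ?_
  rw [mon_eq_topCoeff_smul hq (mem_words.1 hw), TensorProduct.smul_tmul]

theorem coactL_topForm (hq : q ≠ 0) :
    coactL n m q (topForm n m q) = qdet n m q ⊗ₜ[ℂ] topForm n m q := by
  nth_rw 1 [topForm_eq]
  exact coactL_topForm_aux hq length_rowWord

/-- The top coefficients are an eigenvector of the left action on words. -/
theorem sum_matMon_left (hq : q ≠ 0) {v : List (Idx n m)} (hv : v.length = n * m) :
    ∑ w ∈ words (Idx n m) (n * m), (topCoeff q w : ℂ) • matMon (OM.u n m q) v w =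
      (topCoeff q v : ℂ) • qdet n m q := by
  apply tmul_topForm_injective hq
  rw [← coactL_topForm_aux hq hv, mon_eq_topCoeff_smul hq hv, map_smul, coactL_topForm hq,
    TensorProduct.smul_tmul']

theorem sum_topCoeff_sq_ne_zero (hq : q ≠ 0) :
    ∑ w ∈ words (Idx n m) (n * m), (topCoeff q w : ℂ) * (topCoeff q w : ℂ) ≠ 0 := by
  have : 0 < ∑ w ∈ words (Idx n m) (n * m), topCoeff q w * topCoeff q w := by
    refine Finset.sum_pos' (fun w _ => mul_self_nonneg _)
      ⟨rowWord n m, mem_words.2 length_rowWord, ?_⟩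
    rw [topCoeff_rowWord hq]
    norm_num
  exact_mod_cast this.ne'

theorem sum_matMon_right (hq : q ≠ 0) {v : List (Idx n m)} (hv : v.length = n * m) :
    ∑ w ∈ words (Idx n m) (n * m), (topCoeff q w : ℂ) • matMon (OM.u n m q) w v =
      (topCoeff q v : ℂ) • qdet n m q := by
  set D' := ∑ w ∈ words (Idx n m) (n * m),
    (topCoeff q w : ℂ) • matMon (OM.u n m q) w (rowWord n m) with hD'
  have h0 : coactR n m q (topForm n m q) = topForm n m q ⊗ₜ[ℂ] D' := by
    nth_rw 1 [topForm_eq]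
    exact coactR_topForm_aux hq length_rowWord
  have h1 {v : List (Idx n m)} (hv : v.length = n * m) :
      ∑ w ∈ words (Idx n m) (n * m), (topCoeff q w : ℂ) • matMon (OM.u n m q) w v =
        (topCoeff q v : ℂ) • D' := by
    apply topForm_tmul_injective hq
    rw [← coactR_topForm_aux hq hv, mon_eq_topCoeff_smul hq hv, map_smul, h0,
      TensorProduct.smul_tmul', TensorProduct.smul_tmul]
  -- Both sides equal the double sum of `t(v) t(w) u_{vw}`, summed first over one index or over the
  -- other.
  have h2 : (∑ w ∈ words (Idx n m) (n * m), (topCoeff q w : ℂ) * (topCoeff q w : ℂ)) • D' =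
      (∑ w ∈ words (Idx n m) (n * m), (topCoeff q w : ℂ) * (topCoeff q w : ℂ)) • qdet n m q := by
    simp only [Finset.sum_smul, mul_smul]
    rw [Finset.sum_congr rfl fun w hw => by rw [← h1 (mem_words.1 hw)]]
    conv_rhs => rw [Finset.sum_congr rfl fun w hw => by rw [← sum_matMon_left hq (mem_words.1 hw)]]
    simp only [Finset.smul_sum]
    rw [Finset.sum_comm]
    exact Finset.sum_congr rfl fun _ _ => Finset.sum_congr rfl fun _ _ => smul_comm _ _ _
  rw [h1 hv, smul_right_injective _ (sum_topCoeff_sq_ne_zero (n := n) (m := m) hq) h2]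

theorem coactR_topForm (hq : q ≠ 0) :
    coactR n m q (topForm n m q) = topForm n m q ⊗ₜ[ℂ] qdet n m q := by
  nth_rw 1 [topForm_eq]
  rw [coactR_topForm_aux hq length_rowWord, sum_matMon_right hq length_rowWord,
    topCoeff_rowWord hq]
  simp

theorem isLeftDet_iff (hq : q ≠ 0) (D : OM n m q) : IsLeftDet D ↔ D = qdet n m q := by
  rw [IsLeftDet, coactL_topForm hq]
  exact ⟨fun h => (tmul_topForm_injective hq h).symm, fun h => by rw [h]⟩

theorem isRightDet_iff (hq : q ≠ 0) (D : OM n m q) : IsRightDet D ↔ D = qdet n m q := by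
  rw [IsRightDet, coactR_topForm hq]
  exact ⟨fun h => (topForm_tmul_injective hq h).symm, fun h => by rw [h]⟩

end TopCoeff

/-! ### Dual bases and the cofactor matrix -/

section Cofactor

variable {n m : ℕ} {q : ℝ}

variable (q) in
/-- The Gram coefficients of the left dual basis. -/
def gramL (c : Idx n m) : ℂ :=
  ∑ A ∈ words (Idx n m) (n * m - 1), (topCoeff q (c :: A) : ℂ) * topCoeff q (c :: A)

variable (q) in
/-- The Gram coefficients of the right dual basis. -/
def gramR (c : Idx n m) : ℂ :=
  ∑ A ∈ words (Idx n m) (n * m - 1), (topCoeff q (A ++ [c]) : ℂ) * topCoeff q (A ++ [c])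

variable (q) in
/-- The mixed Gram coefficients. -/
def gramM (c : Idx n m) : ℂ :=
  ∑ A ∈ words (Idx n m) (n * m - 1), (topCoeff q (A ++ [c]) : ℂ) * topCoeff q (c :: A)

theorem Idx.card_pos (c : Idx n m) : n * m - 1 + 1 = n * m :=
  Nat.sub_add_cancel (Nat.mul_pos (Fin.pos c.1) (Fin.pos c.2))

theorem length_of_mem_words (c : Idx n m) {A : List (Idx n m)}
    (hA : A ∈ words (Idx n m) (n * m - 1)) : A.length + 1 = n * m := by
  rw [mem_words.1 hA, Idx.card_pos c]

theorem exists_complement (c : Idx n m) : ∃ A ∈ words (Idx n m) (n * m - 1), (c :: A).Nodup := by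
  have hp := List.perm_cons_erase (mem_rowWord c)
  refine ⟨(rowWord n m).erase c, mem_words.2 ?_, hp.nodup_iff.1 nodup_rowWord⟩
  rw [List.length_erase_of_mem (mem_rowWord c), length_rowWord]

theorem gramL_ne_zero (hq : q ≠ 0) (c : Idx n m) : gramL q c ≠ 0 := by
  obtain ⟨A, hA, hd⟩ := exists_complement c
  have : 0 < ∑ A ∈ words (Idx n m) (n * m - 1), topCoeff q (c :: A) * topCoeff q (c :: A) :=
    Finset.sum_pos' (fun w _ => mul_self_nonneg _)
      ⟨A, hA, mul_self_pos.2 (topCoeff_ne_zero hq hd (length_of_mem_words c hA))⟩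
  rw [gramL]
  exact_mod_cast this.ne'

theorem gramR_ne_zero (hq : q ≠ 0) (c : Idx n m) : gramR q c ≠ 0 := by
  obtain ⟨A, hA, hd⟩ := exists_complement c
  have hp : (A ++ [c]).Perm (c :: A) := List.perm_append_singleton c A
  have : 0 < ∑ A ∈ words (Idx n m) (n * m - 1), topCoeff q (A ++ [c]) * topCoeff q (A ++ [c]) :=
    Finset.sum_pos' (fun w _ => mul_self_nonneg _)
      ⟨A, hA, mul_self_pos.2 (topCoeff_ne_zero hq (hp.nodup_iff.2 hd)
        (hp.length_eq.trans (length_of_mem_words c hA)))⟩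
  rw [gramR]
  exact_mod_cast this.ne'

variable (q) in
/-- The basis that is dual to the generators under left multiplication by generators. -/
def dualL (c : Idx n m) : QExt n m q :=
  (gramL q c)⁻¹ • ∑ A ∈ words (Idx n m) (n * m - 1), (topCoeff q (c :: A) : ℂ) • mon q A

variable (q) in
/-- The basis that is dual to the generators under right multiplication by generators. -/
def dualR (c : Idx n m) : QExt n m q :=
  (gramR q c)⁻¹ • ∑ A ∈ words (Idx n m) (n * m - 1), (topCoeff q (A ++ [c]) : ℂ) • mon q A

theorem x_mul_mon (hq : q ≠ 0) (a : Idx n m) {A : List (Idx n m)}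
    (hA : A ∈ words (Idx n m) (n * m - 1)) :
    QExt.x a * mon q A = (topCoeff q (a :: A) : ℂ) • topForm n m q := by
  rw [← mon_cons]
  exact mon_eq_topCoeff_smul hq (length_of_mem_words a hA)

theorem mon_mul_x (hq : q ≠ 0) (a : Idx n m) {A : List (Idx n m)}
    (hA : A ∈ words (Idx n m) (n * m - 1)) :
    mon q A * QExt.x a = (topCoeff q (A ++ [a]) : ℂ) • topForm n m q := by
  rw [← mon_eq_topCoeff_smul hq (by simpa using length_of_mem_words a hA), mon_append, mon_cons,
    mon_nil, mul_one]

/-- Completing the same word `A` by different letters gives different torus weights, so at most one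
of the two coefficients is nonzero and every summand vanishes. -/
theorem sum_topCoeff_eq_zero (hq : q ≠ 0) {a c : Idx n m} (hac : a ≠ c)
    (F G : List (Idx n m) → List (Idx n m)) (hF : ∀ A, (F A).Perm (a :: A))
    (hG : ∀ A, (G A).Perm (c :: A)) :
    ∑ A ∈ words (Idx n m) (n * m - 1), (topCoeff q (F A) : ℂ) * topCoeff q (G A) = 0 := by
  refine Finset.sum_eq_zero fun A hA => ?_
  by_contra h
  simp only [mul_eq_zero, not_or, Complex.ofReal_eq_zero] at h
  exact hac (eq_of_topCoeff_ne_zero hq (hF A) (hG A) (length_of_mem_words a hA) h.1 h.2)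

theorem x_mul_dualL (hq : q ≠ 0) (a c : Idx n m) :
    QExt.x a * dualL q c = if a = c then topForm n m q else 0 := by
  have h : QExt.x a * dualL q c = ((gramL q c)⁻¹ * ∑ A ∈ words (Idx n m) (n * m - 1),
      (topCoeff q (c :: A) : ℂ) * topCoeff q (a :: A)) • topForm n m q := by
    rw [dualL, mul_smul_comm, Finset.mul_sum, mul_smul, Finset.sum_smul]
    congr 1
    refine Finset.sum_congr rfl fun A hA => ?_
    rw [mul_smul_comm, x_mul_mon hq a hA, smul_smul]
  rw [h]
  split_ifs with hac
  · rw [hac, ← gramL, inv_mul_cancel₀ (gramL_ne_zero hq c), one_smul]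
  · rw [sum_topCoeff_eq_zero hq (Ne.symm hac) (c :: ·) (a :: ·) (fun _ => List.Perm.refl _)
      (fun _ => List.Perm.refl _), mul_zero, zero_smul]

theorem dualR_mul_x (hq : q ≠ 0) (a c : Idx n m) :
    dualR q c * QExt.x a = if a = c then topForm n m q else 0 := by
  have h : dualR q c * QExt.x a = ((gramR q c)⁻¹ * ∑ A ∈ words (Idx n m) (n * m - 1),
      (topCoeff q (A ++ [c]) : ℂ) * topCoeff q (A ++ [a])) • topForm n m q := by
    rw [dualR, smul_mul_assoc, Finset.sum_mul, mul_smul, Finset.sum_smul]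
    congr 1
    refine Finset.sum_congr rfl fun A hA => ?_
    rw [smul_mul_assoc, mon_mul_x hq a hA, smul_smul]
  rw [h]
  split_ifs with hac
  · rw [hac, ← gramR, inv_mul_cancel₀ (gramR_ne_zero hq c), one_smul]
  · rw [sum_topCoeff_eq_zero hq (Ne.symm hac) (· ++ [c]) (· ++ [a])
      (fun A => List.perm_append_singleton c A) (fun A => List.perm_append_singleton a A),
      mul_zero, zero_smul]

theorem x_mul_dualR (hq : q ≠ 0) (a c : Idx n m) :
    QExt.x a * dualR q c = if a = c then ((gramR q c)⁻¹ * gramM q c) • topForm n m q else 0 := by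
  have h : QExt.x a * dualR q c = ((gramR q c)⁻¹ * ∑ A ∈ words (Idx n m) (n * m - 1),
      (topCoeff q (A ++ [c]) : ℂ) * topCoeff q (a :: A)) • topForm n m q := by
    rw [dualR, mul_smul_comm, Finset.mul_sum, mul_smul, Finset.sum_smul]
    congr 1
    refine Finset.sum_congr rfl fun A hA => ?_
    rw [mul_smul_comm, x_mul_mon hq a hA, smul_smul]
  rw [h]
  split_ifs with hac
  · rw [hac, ← gramM]
  · rw [sum_topCoeff_eq_zero hq (Ne.symm hac) (· ++ [c]) (a :: ·)
      (fun A => List.perm_append_singleton c A) (fun _ => List.Perm.refl _), mul_zero, zero_smul]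

theorem mon_mem_extPow_of_mem_words {r : ℕ} {A : List (Idx n m)} (hA : A ∈ words (Idx n m) r) :
    mon q A ∈ extPow n m q r := by
  have := mon_mem_extPow (q := q) A
  rwa [mem_words.1 hA] at this

theorem dualL_mem (c : Idx n m) : dualL q c ∈ extPow n m q (n * m - 1) :=
  Submodule.smul_mem _ _ (Submodule.sum_mem _ fun _ hA =>
    Submodule.smul_mem _ _ (mon_mem_extPow_of_mem_words hA))

theorem dualR_mem (c : Idx n m) : dualR q c ∈ extPow n m q (n * m - 1) :=
  Submodule.smul_mem _ _ (Submodule.sum_mem _ fun _ hA =>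
    Submodule.smul_mem _ _ (mon_mem_extPow_of_mem_words hA))

/-- The generators separate the elements of degree `nm - 1`, on both sides. -/
theorem exists_x_mul_ne_zero (hq : q ≠ 0) (hn : 0 < n * m) {z : QExt n m q}
    (hz : z ∈ extPow n m q (n * m - 1)) (hz0 : z ≠ 0) :
    ∃ a, QExt.x a * z ≠ 0 ∧ z * QExt.x a ≠ 0 := by
  obtain ⟨S, hS, h1, h2⟩ := exists_mul_mon_ne_zero hq hz hz0
  have hc : Sᶜ.card = 1 := by
    rw [Finset.card_compl, hS]
    simp
    omega
  obtain ⟨a, ha⟩ := Finset.card_eq_one.1 hc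
  rw [ha, Finset.toList_singleton, mon_cons, mon_nil, mul_one] at h1 h2
  exact ⟨a, h2, h1⟩

/-- The difference of the two sides is annihilated by left multiplication by every generator, and
the generators separate elements of degree `nm - 1`. -/
theorem eq_sum_dualL (hq : q ≠ 0) (hn : 0 < n * m) {z : QExt n m q}
    (hz : z ∈ extPow n m q (n * m - 1)) (c : Idx n m → ℂ)
    (hc : ∀ a, QExt.x a * z = c a • topForm n m q) : z = ∑ k, c k • dualL q k := by
  rw [← sub_eq_zero]
  by_contra h
  obtain ⟨a, ha, -⟩ := exists_x_mul_ne_zero hq hn (sub_mem hz (Submodule.sum_mem _ fun k _ =>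
    Submodule.smul_mem _ (c k) (dualL_mem k))) h
  apply ha
  rw [mul_sub, hc, Finset.mul_sum, Finset.sum_eq_single a]
  · rw [mul_smul_comm, x_mul_dualL hq, if_pos rfl, sub_self]
  · intro b _ hb
    rw [mul_smul_comm, x_mul_dualL hq, if_neg hb.symm, smul_zero]
  · simp

theorem eq_sum_dualR (hq : q ≠ 0) (hn : 0 < n * m) {z : QExt n m q}
    (hz : z ∈ extPow n m q (n * m - 1)) (c : Idx n m → ℂ)
    (hc : ∀ a, z * QExt.x a = c a • topForm n m q) : z = ∑ k, c k • dualR q k := by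
  rw [← sub_eq_zero]
  by_contra h
  obtain ⟨a, -, ha⟩ := exists_x_mul_ne_zero hq hn (sub_mem hz (Submodule.sum_mem _ fun k _ =>
    Submodule.smul_mem _ (c k) (dualR_mem k))) h
  apply ha
  rw [sub_mul, hc, Finset.sum_mul, Finset.sum_eq_single a]
  · rw [smul_mul_assoc, dualR_mul_x hq, if_pos rfl, sub_self]
  · intro b _ hb
    rw [smul_mul_assoc, dualR_mul_x hq, if_neg hb.symm, smul_zero]
  · simp

theorem mul_mem_extPow {r s : ℕ} {y z : QExt n m q} (hy : y ∈ extPow n m q r)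
    (hz : z ∈ extPow n m q s) : y * z ∈ extPow n m q (r + s) := by
  rw [extPow, pow_add]
  exact Submodule.mul_mem_mul hy hz

theorem x_mem (a : Idx n m) : (QExt.x a : QExt n m q) ∈ extPow n m q 1 := by
  have := mon_mem_extPow (q := q) [a]
  rwa [mon_cons, mon_nil, mul_one] at this

theorem exists_eq_smul_topForm (hq : q ≠ 0) {r : ℕ} (hr : r = n * m) {y : QExt n m q}
    (hy : y ∈ extPow n m q r) : ∃ c : ℂ, y = c • topForm n m q := by
  rw [hr, extPow_top hq, Submodule.mem_span_singleton] at hy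
  exact hy.imp fun _ h => h.symm

/-- The dual basis for left multiplication. -/
theorem exists_basisL (hq : q ≠ 0) (hn : 0 < n * m) :
    ∃ b : Module.Basis (Idx n m) ℂ (extPow n m q (n * m - 1)),
      ∀ c, (b c : QExt n m q) = dualL q c := by
  have hli : LinearIndependent ℂ fun c : Idx n m =>
      (⟨dualL q c, dualL_mem c⟩ : extPow n m q (n * m - 1)) := by
    rw [Fintype.linearIndependent_iff]
    intro g hg a
    have h := congr_arg (fun z => QExt.x a * Subtype.val z) hg
    simp only [Submodule.coe_sum, Submodule.coe_smul, Finset.mul_sum, mul_smul_comm,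
      x_mul_dualL hq, smul_ite, smul_zero, Finset.sum_ite_eq, Finset.mem_univ, if_true,
      Submodule.coe_zero, mul_zero] at h
    exact (smul_eq_zero.1 h).resolve_right (topForm_ne_zero hq)
  refine ⟨Module.Basis.mk hli ?_, fun c => by rw [Module.Basis.mk_apply]⟩
  rintro ⟨z, hz⟩ -
  choose c hc using fun a => exists_eq_smul_topForm hq (by omega) (mul_mem_extPow (x_mem a) hz)
  rw [show (⟨z, hz⟩ : extPow n m q (n * m - 1)) = ∑ k, c k • ⟨dualL q k, dualL_mem k⟩ from
    Subtype.ext (by simpa using eq_sum_dualL hq hn hz c hc)]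
  exact Submodule.sum_mem _ fun k _ => Submodule.smul_mem _ _ (Submodule.subset_span ⟨k, rfl⟩)

/-- The dual basis for right multiplication. -/
theorem exists_basisR (hq : q ≠ 0) (hn : 0 < n * m) :
    ∃ b : Module.Basis (Idx n m) ℂ (extPow n m q (n * m - 1)),
      ∀ c, (b c : QExt n m q) = dualR q c := by
  have hli : LinearIndependent ℂ fun c : Idx n m =>
      (⟨dualR q c, dualR_mem c⟩ : extPow n m q (n * m - 1)) := by
    rw [Fintype.linearIndependent_iff]
    intro g hg a
    have h := congr_arg (fun z => Subtype.val z * QExt.x a) hg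
    simp only [Submodule.coe_sum, Submodule.coe_smul, Finset.sum_mul, smul_mul_assoc,
      dualR_mul_x hq, smul_ite, smul_zero, Finset.sum_ite_eq, Finset.mem_univ, if_true,
      Submodule.coe_zero, zero_mul] at h
    exact (smul_eq_zero.1 h).resolve_right (topForm_ne_zero hq)
  refine ⟨Module.Basis.mk hli ?_, fun c => by rw [Module.Basis.mk_apply]⟩
  rintro ⟨z, hz⟩ -
  choose c hc using fun a => exists_eq_smul_topForm hq (by omega) (mul_mem_extPow hz (x_mem a))
  rw [show (⟨z, hz⟩ : extPow n m q (n * m - 1)) = ∑ k, c k • ⟨dualR q k, dualR_mem k⟩ from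
    Subtype.ext (by simpa using eq_sum_dualR hq hn hz c hc)]
  exact Submodule.sum_mem _ fun k _ => Submodule.smul_mem _ _ (Submodule.subset_span ⟨k, rfl⟩)

theorem mon_eq_sum_dualL (hq : q ≠ 0) (hn : 0 < n * m) {A : List (Idx n m)}
    (hA : A ∈ words (Idx n m) (n * m - 1)) :
    mon q A = ∑ k, (topCoeff q (k :: A) : ℂ) • dualL q k :=
  eq_sum_dualL hq hn (mon_mem_extPow_of_mem_words hA) _ fun a => x_mul_mon hq a hA

theorem mon_eq_sum_dualR (hq : q ≠ 0) (hn : 0 < n * m) {A : List (Idx n m)}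
    (hA : A ∈ words (Idx n m) (n * m - 1)) :
    mon q A = ∑ k, (topCoeff q (A ++ [k]) : ℂ) • dualR q k :=
  eq_sum_dualR hq hn (mon_mem_extPow_of_mem_words hA) _ fun a => mon_mul_x hq a hA

/-- The Nakayama automorphism is diagonal. -/
theorem topCoeff_cons (hq : q ≠ 0) (hn : 0 < n * m) (a : Idx n m) {A : List (Idx n m)}
    (hA : A ∈ words (Idx n m) (n * m - 1)) :
    (topCoeff q (a :: A) : ℂ) = (gramR q a)⁻¹ * gramM q a * topCoeff q (A ++ [a]) := by
  apply topForm_smul_injective (n := n) (m := m) hq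
  -- Expanding `mon q A` in the right dual basis and multiplying by `x_a` on the left isolates one
  -- term, whose coefficient is `topCoeff q (A ++ [a])`.
  rw [← x_mul_mon hq a hA, mon_eq_sum_dualR hq hn hA, Finset.mul_sum, Finset.sum_eq_single a]
  · rw [mul_smul_comm, x_mul_dualR hq, if_pos rfl, smul_smul, mul_comm]
  · intro b _ hb
    rw [mul_smul_comm, x_mul_dualR hq, if_neg hb.symm, smul_zero]
  · simp

theorem gramL_eq (hq : q ≠ 0) (hn : 0 < n * m) (a : Idx n m) :
    gramL q a = ((gramR q a)⁻¹ * gramM q a) ^ 2 * gramR q a := by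
  rw [gramL]
  conv_rhs => rw [gramR, Finset.mul_sum]
  refine Finset.sum_congr rfl fun A hA => ?_
  rw [topCoeff_cons hq hn a hA]
  conv_rhs => rw [← gramR]
  ring

theorem gramM_ne_zero (hq : q ≠ 0) (hn : 0 < n * m) (a : Idx n m) : gramM q a ≠ 0 := by
  intro h
  have := gramL_eq hq hn a
  rw [h] at this
  exact gramL_ne_zero hq a (by simpa using this)

variable (q) in
/-- The cofactor matrix with respect to the left coaction. -/
def cofL : Matrix (Idx n m) (Idx n m) (OM n m q) := Matrix.of fun k c =>
  (gramL q c)⁻¹ • ∑ A ∈ words (Idx n m) (n * m - 1), ∑ A' ∈ words (Idx n m) (n * m - 1),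
    ((topCoeff q (c :: A) : ℂ) * topCoeff q (k :: A')) • matMon (OM.u n m q) A A'

variable (q) in
/-- The cofactor matrix with respect to the right coaction. -/
def cofR : Matrix (Idx n m) (Idx n m) (OM n m q) := Matrix.of fun c k =>
  (gramR q c)⁻¹ • ∑ A ∈ words (Idx n m) (n * m - 1), ∑ A' ∈ words (Idx n m) (n * m - 1),
    ((topCoeff q (A' ++ [c]) : ℂ) * topCoeff q (A ++ [k])) • matMon (OM.u n m q) A A'

theorem coactL_dualL (hq : q ≠ 0) (hn : 0 < n * m) (c : Idx n m) :
    coactL n m q (dualL q c) = ∑ k, cofL q k c ⊗ₜ[ℂ] dualL q k := by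
  have h (A) (hA : A ∈ words (Idx n m) (n * m - 1)) : coactL n m q (mon q A) =
      ∑ k, ∑ A' ∈ words (Idx n m) (n * m - 1), (topCoeff q (k :: A') : ℂ) •
        (matMon (OM.u n m q) A A' ⊗ₜ[ℂ] dualL q k) := by
    rw [coactL_mon, mem_words.1 hA, Finset.sum_comm]
    refine Finset.sum_congr rfl fun A' hA' => ?_
    rw [mon_eq_sum_dualL hq hn hA', TensorProduct.tmul_sum]
    simp only [TensorProduct.tmul_smul]
  rw [dualL, map_smul, map_sum]
  simp only [map_smul]
  rw [Finset.sum_congr rfl fun A hA => by rw [h A hA]]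
  simp only [cofL, Matrix.of_apply, ← TensorProduct.smul_tmul', TensorProduct.sum_tmul,
    Finset.smul_sum, mul_smul]
  rw [Finset.sum_comm]

theorem coactR_dualR (hq : q ≠ 0) (hn : 0 < n * m) (c : Idx n m) :
    coactR n m q (dualR q c) = ∑ k, dualR q k ⊗ₜ[ℂ] cofR q c k := by
  have h (A) (hA : A ∈ words (Idx n m) (n * m - 1)) : coactR n m q (mon q A) =
      ∑ k, ∑ A' ∈ words (Idx n m) (n * m - 1), (topCoeff q (A' ++ [k]) : ℂ) •
        (dualR q k ⊗ₜ[ℂ] matMon (OM.u n m q) A' A) := by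
    rw [coactR_mon, mem_words.1 hA, Finset.sum_comm]
    refine Finset.sum_congr rfl fun A' hA' => ?_
    rw [mon_eq_sum_dualR hq hn hA', TensorProduct.sum_tmul]
    simp only [TensorProduct.smul_tmul']
  rw [dualR, map_smul, map_sum]
  simp only [map_smul]
  rw [Finset.sum_congr rfl fun A hA => by rw [h A hA]]
  simp only [cofR, Matrix.of_apply, TensorProduct.tmul_smul, TensorProduct.tmul_sum,
    Finset.smul_sum, mul_smul]
  rw [Finset.sum_comm]
  refine Finset.sum_congr rfl fun k _ => ?_
  rw [Finset.sum_comm]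

/-- This is the left coaction applied to `x_a b_c = δ_{ac} ω`, with coefficients of `ω` compared. -/
theorem u_mul_cofL (hq : q ≠ 0) (hn : 0 < n * m) :
    OM.u n m q * cofL q = Matrix.diagonal fun _ => qdet n m q := by
  ext a c
  apply tmul_topForm_injective hq
  have h := congr_arg (coactL n m q) (x_mul_dualL hq a c)
  rw [map_mul, coactL_x, coactL_dualL hq hn, sum_tmul_mul_sum_tmul, Fintype.sum_prod_type] at h
  simp only [x_mul_dualL hq, TensorProduct.tmul_ite, Finset.sum_ite_eq,
    Finset.mem_univ, if_true] at h
  rw [Matrix.mul_apply, TensorProduct.sum_tmul, h, Matrix.diagonal_apply]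
  split_ifs
  · exact coactL_topForm hq
  · simp

theorem cofR_mul_u (hq : q ≠ 0) (hn : 0 < n * m) :
    cofR q * OM.u n m q = Matrix.diagonal fun _ => qdet n m q := by
  ext c a
  apply topForm_tmul_injective hq
  have h := congr_arg (coactR n m q) (dualR_mul_x hq a c)
  rw [map_mul, coactR_x, coactR_dualR hq hn, sum_tmul_mul_sum_tmul, Fintype.sum_prod_type,
    Finset.sum_comm] at h
  simp only [dualR_mul_x hq, TensorProduct.ite_tmul, Finset.sum_ite_eq,
    Finset.mem_univ, if_true] at h
  rw [Matrix.mul_apply, TensorProduct.tmul_sum, h, Matrix.diagonal_apply]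
  simp only [eq_comm (a := c)]
  split_ifs
  · exact coactR_topForm hq
  · simp

/-- The two cofactor matrices are proportional entry by entry. -/
theorem cofL_eq_smul (hq : q ≠ 0) (hn : 0 < n * m) (k c : Idx n m) :
    cofL q k c = (gramM q k / gramM q c) • cofR q k c := by
  have h1 := gramR_ne_zero hq k
  have h2 := gramR_ne_zero hq c
  have h3 := gramM_ne_zero hq hn c
  simp only [cofL, cofR, Matrix.of_apply, smul_smul, Finset.smul_sum]
  refine Finset.sum_congr rfl fun A hA => Finset.sum_congr rfl fun A' hA' => ?_
  rw [topCoeff_cons hq hn c hA, topCoeff_cons hq hn k hA', gramL_eq hq hn]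
  congr 1
  field_simp

end Cofactor

/-! ### Representations of the quantum matrix space by the `R̂`-matrix -/

section Representation

variable {n m : ℕ} {q : ℝ} {B : Type*} [Ring B] [Algebra ℂ B]

theorem OM.exists_lift (U : Matrix (Idx n m) (Idx n m) B)
    (hU : ∀ a b : Idx n m × Idx n m, ∑ e, Pplus n m q a e • (U e.1 b.1 * U e.2 b.2) =
      ∑ e, Pplus n m q e b • (U a.1 e.1 * U a.2 e.2)) :
    ∃ f : OM n m q →ₐ[ℂ] B, ∀ a b, f (OM.u n m q a b) = U a b := by
  refine ⟨RingQuot.liftAlgHom ℂ ⟨FreeAlgebra.lift ℂ fun p => U p.1 p.2, ?_⟩, fun a b => ?_⟩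
  · rintro _ _ ⟨a, b⟩
    simpa only [map_sum, map_smul, map_mul, FreeAlgebra.lift_ι_apply] using hU a b
  · exact (RingQuot.liftAlgHom_mkAlgHom_apply ℂ _ _ _).trans (by simp)

theorem commute_iff {P : Type*} [Fintype P] [DecidableEq P] (R : Matrix P P ℂ)
    (M : Matrix P P B) : Commute (R.map (algebraMap ℂ B)) M ↔
      ∀ a b, ∑ e, R a e • M e b = ∑ e, R e b • M a e := by
  rw [commute_iff_eq, ← Matrix.ext_iff]
  simp only [Matrix.mul_apply, Matrix.map_apply, Algebra.smul_def]
  refine forall₂_congr fun a b => ?_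
  rw [Finset.sum_congr rfl fun e _ => (Algebra.commutes (R e b) (M a e)).symm]

/-- `P₊` is a polynomial in `R̂`, so commuting with `R̂` is enough. -/
theorem Pplus_comm_of_Rhat (hq : q ≠ 0) (M : Matrix (Idx n m × Idx n m) (Idx n m × Idx n m) B)
    (h : ∀ a b, ∑ e, Rhat n m q a e • M e b = ∑ e, Rhat n m q e b • M a e) (a b) :
    ∑ e, Pplus n m q a e • M e b = ∑ e, Pplus n m q e b • M a e := by
  rw [← commute_iff] at h
  obtain ⟨c, d, hcd⟩ := exists_Pplus_eq (n := n) (m := m) hq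
  refine (commute_iff _ _).1 ?_ a b
  have e : (Pplus n m q).map (algebraMap ℂ B) =
      (c • (Rhat n m q).map (algebraMap ℂ B) + d • 1) *
        ((Rhat n m q).map (algebraMap ℂ B) + 1) := by
    have := congr_arg (Algebra.ofId ℂ B).mapMatrix hcd
    simp only [map_mul, map_add, map_smul, map_one] at this
    exact this
  rw [e]
  exact ((h.smul_left c).add_left ((Commute.one_left M).smul_left d)).mul_left
    (h.add_left (Commute.one_left M))

/-- The block of the `R̂`-matrix that represents the entry `(i, j)`. -/
def rBlock (q : ℝ) (i j : Fin n) : Matrix (Fin n) (Fin n) ℂ :=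
  Matrix.of fun b d => RhatStd n q (b, i) (j, d)

theorem rBlock_eq (i j b d : Fin n) :
    rBlock q i j b d = rAct q (fun c d' => if c = j ∧ d' = d then (1 : ℂ) else 0) b i := by
  rw [rBlock, Matrix.of_apply, rAct, Finset.sum_eq_single (j, d)]
  · simp
  · rintro ⟨c, d'⟩ - h
    rw [if_neg, smul_zero]
    rintro ⟨rfl, rfl⟩
    exact h rfl
  · simp

theorem rBlock_mul (i j : Fin n) (M : Matrix (Fin n) (Fin n) ℂ) (x y : Fin n) :
    (rBlock q i j * M) x y = rAct q (fun p z => if p = j then M z y else 0) x i := by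
  rw [Matrix.mul_apply, rAct, Fintype.sum_prod_type, Finset.sum_comm]
  simp [rBlock]

/-- This is the FRT form of the braid relation: an entry of the products on either side is an entry
of a triple product of `R̂`-matrices. -/
theorem rBlock_rel (hq : q ≠ 0) (a b : Fin n × Fin n) :
    ∑ e, RhatStd n q a e • (rBlock q e.1 b.1 * rBlock q e.2 b.2) =
      ∑ e, RhatStd n q e b • (rBlock q a.1 e.1 * rBlock q a.2 e.2) := by
  obtain ⟨a1, a2⟩ := a
  obtain ⟨b1, b2⟩ := b
  have hR (M : Fin n → Fin n → Matrix (Fin n) (Fin n) ℂ) :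
      ∑ e, RhatStd n q e (b1, b2) • M e.1 e.2 = rAct q M b1 b2 :=
    Finset.sum_congr rfl fun e _ => by rw [RhatStd_symm]
  rw [hR fun c d => rBlock q a1 c * rBlock q a2 d]
  change rAct q (fun c d => rBlock q c b1 * rBlock q d b2) a1 a2 = _
  ext x y
  rw [rAct_matrix_apply, rAct_matrix_apply]
  simp only [rBlock_mul, rBlock_eq]
  have hb := rAct_braid hq (fun p s t => if p = b1 ∧ s = b2 ∧ t = y then (1 : ℂ) else 0) x a1 a2
  have h1 (p z d : Fin n) : (if p = b1 then rAct q (fun s t => if s = b2 ∧ t = y then (1 : ℂ) else 0)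
      z d else 0) = rAct q (fun s t => if p = b1 ∧ s = b2 ∧ t = y then (1 : ℂ) else 0) z d := by
    split_ifs with h
    · simp [h]
    · simp [h, rAct]
  simp only [h1]
  rw [← hb, rAct_comm]
  congr 1
  ext p z
  have h2 (c d : Fin n) : (if p = c then rAct q (fun s t => if s = d ∧ t = y then (1 : ℂ) else 0)
      z a2 else 0) = rAct q (fun s t => if p = c ∧ s = d ∧ t = y then (1 : ℂ) else 0) z a2 := by
    split_ifs with h
    · simp [h]
    · simp [h, rAct]
  simp only [h2]
  rw [rAct_comm]
  congr 1
  ext s t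
  by_cases ht : t = y
  · simp only [ht, and_true, rAct, smul_ite, smul_zero]
    have e1 (e : Fin n × Fin n) : (p = e.1 ∧ s = e.2) ↔ (p, s) = e := by rw [Prod.ext_iff]
    have e2 (e : Fin n × Fin n) : (e.1 = b1 ∧ e.2 = b2) ↔ e = (b1, b2) := by rw [Prod.ext_iff]
    simp only [e1, e2, Finset.sum_ite_eq, Finset.sum_ite_eq', Finset.mem_univ, if_true]
    rw [RhatStd_symm]
  · simp [ht, rAct]

theorem rep_rel {U : Matrix (Fin n) (Fin n) B} {W : Matrix (Fin m) (Fin m) B}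
    (hU : ∀ a b : Fin n × Fin n, ∑ e, RhatStd n q a e • (U e.1 b.1 * U e.2 b.2) =
      ∑ e, RhatStd n q e b • (U a.1 e.1 * U a.2 e.2))
    (hW : ∀ a b : Fin m × Fin m, ∑ e, RhatStd m q a e • (W e.1 b.1 * W e.2 b.2) =
      ∑ e, RhatStd m q e b • (W a.1 e.1 * W a.2 e.2))
    (hUW : ∀ i j k l, U i j * W k l = W k l * U i j) (a b : Idx n m × Idx n m) :
    ∑ e, Rhat n m q a e • (U e.1.1 b.1.1 * W e.1.2 b.1.2 * (U e.2.1 b.2.1 * W e.2.2 b.2.2)) =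
      ∑ e, Rhat n m q e b •
        (U a.1.1 e.1.1 * W a.1.2 e.1.2 * (U a.2.1 e.2.1 * W a.2.2 e.2.2)) := by
  have h (i j k l i' j' k' l') : U i j * W k l * (U i' j' * W k' l') =
      (U i j * U i' j') * (W k l * W k' l') := by
    rw [mul_assoc, ← mul_assoc (W k l), ← hUW, mul_assoc, mul_assoc]
  simp only [h]
  have h1 : (∑ e, RhatStd n q (a.1.1, a.2.1) e • (U e.1 b.1.1 * U e.2 b.2.1)) *
      (∑ e, RhatStd m q (a.1.2, a.2.2) e • (W e.1 b.1.2 * W e.2 b.2.2)) =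
      (∑ e, RhatStd n q e (b.1.1, b.2.1) • (U a.1.1 e.1 * U a.2.1 e.2)) *
      (∑ e, RhatStd m q e (b.1.2, b.2.2) • (W a.1.2 e.1 * W a.2.2 e.2)) := by
    rw [hU (a.1.1, a.2.1) (b.1.1, b.2.1), hW (a.1.2, a.2.2) (b.1.2, b.2.2)]
  simp only [Finset.sum_mul_sum, ← Fintype.sum_prod_type', smul_mul_smul_comm] at h1
  conv_lhs at h1 => rw [← (Equiv.prodProdProdComm _ _ _ _).sum_comp]
  conv_rhs at h1 => rw [← (Equiv.prodProdProdComm _ _ _ _).sum_comp]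
  exact h1

theorem one_rel (a b : Fin n × Fin n) :
    ∑ e, RhatStd n q a e • ((1 : Matrix (Fin n) (Fin n) B) e.1 b.1 *
      (1 : Matrix (Fin n) (Fin n) B) e.2 b.2) =
      ∑ e, RhatStd n q e b • ((1 : Matrix (Fin n) (Fin n) B) a.1 e.1 *
        (1 : Matrix (Fin n) (Fin n) B) a.2 e.2) := by
  have h (x y : Fin n × Fin n) : (1 : Matrix (Fin n) (Fin n) B) x.1 y.1 *
      (1 : Matrix (Fin n) (Fin n) B) x.2 y.2 = if x = y then 1 else 0 := by
    simp only [Matrix.one_apply, Prod.ext_iff]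
    split_ifs <;> simp_all
  simp only [h, smul_ite, smul_zero]
  simp

-- The representation on `ℂⁿ` uses blocks of `R̂_V` in the first factor and the identity in the
-- second. The relations hold because `R̂` is the tensor product of `R̂_V` and `R̂_W`.
variable (n m) in
theorem exists_repV (hq : q ≠ 0) : ∃ f : OM n m q →ₐ[ℂ] Matrix (Fin n) (Fin n) ℂ,
    ∀ a b, f (OM.u n m q a b) = rBlock q a.1 b.1 * (1 : Matrix (Fin m) (Fin m) _) a.2 b.2 :=
  OM.exists_lift (Matrix.of fun a b : Idx n m => rBlock q a.1 b.1 *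
    (1 : Matrix (Fin m) (Fin m) (Matrix (Fin n) (Fin n) ℂ)) a.2 b.2)
    (Pplus_comm_of_Rhat hq _ (rep_rel (U := Matrix.of (rBlock q)) (rBlock_rel hq) one_rel
      (by intro i j k l; rw [Matrix.one_apply]; split_ifs <;> simp)))

variable (n m) in
theorem exists_repW (hq : q ≠ 0) : ∃ f : OM n m q →ₐ[ℂ] Matrix (Fin m) (Fin m) ℂ,
    ∀ a b, f (OM.u n m q a b) = (1 : Matrix (Fin n) (Fin n) _) a.1 b.1 * rBlock q a.2 b.2 :=
  OM.exists_lift (Matrix.of fun a b : Idx n m =>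
    (1 : Matrix (Fin n) (Fin n) (Matrix (Fin m) (Fin m) ℂ)) a.1 b.1 * rBlock q a.2 b.2)
    (Pplus_comm_of_Rhat hq _ (rep_rel (W := Matrix.of (rBlock q)) one_rel (rBlock_rel hq)
      (by intro i j k l; rw [Matrix.one_apply]; split_ifs <;> simp)))

theorem rBlock_diag (i j x : Fin n) :
    rBlock q i j x x = if i = j then (if i = x then (q : ℂ) else 1) else 0 := by
  simp only [rBlock, RhatStd, Matrix.of_apply]
  grind

theorem rBlock_lower (i j : Fin n) {b d : Fin n} (h : d < b) : rBlock q i j b d = 0 := by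
  simp only [rBlock, RhatStd, Matrix.of_apply]
  grind

theorem rBlock_torus (g : Fin n → ℂ) (i j b d : Fin n) :
    g i * (g b * rBlock q i j b d) = g j * (rBlock q i j b d * g d) := by
  simp only [rBlock, RhatStd, Matrix.of_apply]
  split_ifs with h1 h2 h3 h4 <;> grind

/-- The inverse of `rBlock`. -/
def rBlockInv (q : ℝ) (i j : Fin n) : Matrix (Fin n) (Fin n) ℂ :=
  Matrix.of fun b d => RhatStd n q (i, b) (d, j) -
    ((q : ℂ) - (q : ℂ)⁻¹) * if (i, b) = (d, j) then 1 else 0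

/-- By the Hecke relation the inverse of `R̂` is `R̂ - (q - q⁻¹)`, whose blocks are the `rBlockInv`.
-/
theorem sum_rBlock_mul_rBlockInv (hq : q ≠ 0) (i j : Fin n) :
    ∑ k, rBlock q i k * rBlockInv q k j = if i = j then 1 else 0 := by
  ext b l
  have h := congr_fun (congr_fun (RhatStd_mul_self (n := n) hq) (b, i)) (l, j)
  rw [Matrix.mul_apply, Matrix.add_apply, Matrix.smul_apply] at h
  simp only [Matrix.sum_apply, Matrix.mul_apply, rBlock, rBlockInv, Matrix.of_apply, mul_sub,
    Finset.sum_sub_distrib, ← Fintype.sum_prod_type', Prod.mk.eta]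
  rw [h, Matrix.one_apply]
  by_cases hij : i = j <;> simp [hij, Matrix.one_apply, mul_comm]

theorem rBlockInv_ne_zero (hq : q ≠ 0) (hq1 : q ^ 2 ≠ 1) {i j : Fin n} (h : j < i) :
    rBlockInv q i j ≠ 0 := by
  intro h0
  -- The entry `(j, i)` of this block is `-(q - q⁻¹)`, which is nonzero since `q² ≠ 1`.
  have := congr_fun (congr_fun h0 j) i
  have hne : (q : ℂ) - (q : ℂ)⁻¹ ≠ 0 := by
    have hq' : (q : ℂ) ≠ 0 := by exact_mod_cast hq
    intro h
    apply hq1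
    have : (q : ℂ) ^ 2 = 1 := by
      field_simp at h
      linear_combination h
    exact_mod_cast this
  simp [rBlockInv, RhatStd, h.ne', h.not_gt] at this
  exact hne (by linear_combination -this)

/-! ### The two cofactor matrices agree -/

theorem upper_mul_diag {M N : Matrix (Fin n) (Fin n) ℂ} (hM : ∀ b d, d < b → M b d = 0)
    (hN : ∀ b d, d < b → N b d = 0) :
    (∀ b d, d < b → (M * N) b d = 0) ∧ ∀ x, (M * N) x x = M x x * N x x := by
  constructor
  · intro b d h
    rw [Matrix.mul_apply]
    refine Finset.sum_eq_zero fun e _ => ?_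
    rcases lt_or_ge e b with he | he
    · rw [hM b e he, zero_mul]
    · rw [hN e d (h.trans_le he), mul_zero]
  · intro x
    rw [Matrix.mul_apply, Finset.sum_eq_single x]
    · intro e _ he
      rcases he.lt_or_gt with he | he
      · rw [hM x e he, zero_mul]
      · rw [hN e x he, mul_zero]
    · simp

theorem matMon_diag {ι : Type*} [DecidableEq ι] (U : Matrix ι ι (Matrix (Fin n) (Fin n) ℂ))
    (δ : ι → Fin n → ℂ) (hU : ∀ a b i j, j < i → U a b i j = 0)
    (hδ : ∀ a b x, U a b x x = if a = b then δ a x else 0) (v w : List ι)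
    (h : v.length = w.length) :
    (∀ i j, j < i → matMon U v w i j = 0) ∧
      ∀ x, matMon U v w x x = if v = w then (v.map fun a => δ a x).prod else 0 := by
  induction v generalizing w with
  | nil =>
    obtain rfl := List.length_eq_zero_iff.1 h.symm
    exact ⟨fun i j hij => by simp [matMon_nil, hij.ne'], by simp [matMon_nil]⟩
  | cons a v ih =>
    match w, h with
    | b :: w, h =>
      have ih := ih w (by simpa using h)
      have := upper_mul_diag (hU a b) ih.1
      rw [matMon_cons]
      refine ⟨this.1, fun x => ?_⟩
      rw [this.2, hδ, ih.2]
      by_cases hab : a = b <;> by_cases hvw : v = w <;> simp [hab, hvw]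

theorem matMon_torus {ι : Type*} (U : Matrix ι ι (Matrix (Fin n) (Fin n) ℂ)) (s : ι → ℂ)
    (Γ : Matrix (Fin n) (Fin n) ℂ) (hU : ∀ a b, s a • (Γ * U a b) = s b • (U a b * Γ))
    (v w : List ι) (h : v.length = w.length) :
    (v.map s).prod • (Γ * matMon U v w) = (w.map s).prod • (matMon U v w * Γ) := by
  induction v generalizing w with
  | nil =>
    obtain rfl := List.length_eq_zero_iff.1 h.symm
    simp [matMon_nil]
  | cons a v ih =>
    match w, h with
    | b :: w, h =>
      have ih := ih w (by simpa using h)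
      rw [matMon_cons, List.map_cons, List.prod_cons, List.map_cons, List.prod_cons, ← mul_assoc,
        mul_comm (s a), mul_smul, ← smul_mul_assoc, hU, smul_mul_assoc, smul_comm, mul_assoc,
        ← mul_smul_comm, ih, mul_smul_comm, mul_smul, mul_assoc]

/-- Every word contributing to the determinant has the torus weight of `rowWord`, so the image
commutes with a diagonal matrix with distinct entries and is diagonal. By triangularity, its
diagonal comes from the word `rowWord` alone. -/
theorem rep_qdet (hq : q ≠ 0) {p : ℕ} (f : OM n m q →ₐ[ℂ] Matrix (Fin p) (Fin p) ℂ)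
    (s : Fin n → ℂ) (r : Fin m → ℂ) (hs : ∀ i, s i ≠ 0) (hr : ∀ i, r i ≠ 0)
    (g : Fin p → ℂ) (hg : Function.Injective g)
    (h1 : ∀ a b, (s a.1 * r a.2) • (Matrix.diagonal g * f (OM.u n m q a b)) =
      (s b.1 * r b.2) • (f (OM.u n m q a b) * Matrix.diagonal g))
    (h2 : ∀ a b i j, j < i → f (OM.u n m q a b) i j = 0) (δ : Idx n m → Fin p → ℂ)
    (h3 : ∀ a b x, f (OM.u n m q a b) x x = if a = b then δ a x else 0) (D : ℂ)
    (h4 : ∀ x, ∏ a, δ a x = D) : f (qdet n m q) = D • 1 := by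
  have e : f (qdet n m q) = ∑ w ∈ words (Idx n m) (n * m), (topCoeff q w : ℂ) •
      matMon ((OM.u n m q).map f) (rowWord n m) w := by
    simp only [qdet, map_sum, map_smul, map_matMon]
  have hl (w) (hw : w ∈ words (Idx n m) (n * m)) : (rowWord n m).length = w.length :=
    length_rowWord.trans (mem_words.1 hw).symm
  have hcomm : Matrix.diagonal g * f (qdet n m q) = f (qdet n m q) * Matrix.diagonal g := by
    rw [e, Finset.mul_sum, Finset.sum_mul]
    refine Finset.sum_congr rfl fun w hw => ?_
    rw [mul_smul_comm, smul_mul_assoc]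
    by_cases ht : topCoeff q w = 0
    · simp [ht]
    congr 1
    have := matMon_torus ((OM.u n m q).map f) (fun a => s a.1 * r a.2) _ h1 _ w (hl w hw)
    rw [prod_eq_of_topCoeff_ne_zero hq s r (mem_words.1 hw) ht] at this
    refine smul_right_injective _ (List.prod_ne_zero ?_) this
    simp [hs, hr]
  ext x y
  by_cases hxy : x = y
  · subst hxy
    rw [e, Matrix.sum_apply, Finset.sum_eq_single (rowWord n m)]
    · rw [Matrix.smul_apply, (matMon_diag ((OM.u n m q).map f) δ h2 h3 _ _ rfl).2, if_pos rfl,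
        topCoeff_rowWord hq,
        ← List.prod_toFinset _ nodup_rowWord, show (rowWord n m).toFinset = Finset.univ by
          ext a; simp [mem_rowWord], h4]
      simp
    · intro w hw hne
      rw [Matrix.smul_apply, (matMon_diag ((OM.u n m q).map f) δ h2 h3 _ _ (hl w hw)).2,
        if_neg hne.symm, smul_zero]
    · exact fun h => absurd (mem_words.2 length_rowWord) h
  · have := congr_fun (congr_fun hcomm x) y
    rw [Matrix.diagonal_mul, Matrix.mul_diagonal, mul_comm, ← sub_eq_zero, ← mul_sub] at this
    rw [(mul_eq_zero.1 this).resolve_right (sub_ne_zero.2 (hg.ne hxy))]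
    simp [hxy]

/-- In the representation `D` is an invertible scalar, so a left and a right cofactor matrix must
coincide, both being `D • Y`. Where `Y k c ≠ 0`, the factor `gramM q k / gramM q c` between them is
then `1`. -/
theorem gramM_eq_of_rep (hq : q ≠ 0) (hn : 0 < n * m) {p : ℕ}
    (f : OM n m q →ₐ[ℂ] Matrix (Fin p) (Fin p) ℂ) {D : ℂ} (hD : D ≠ 0)
    (hf : f (qdet n m q) = D • 1) (Y : Matrix (Idx n m) (Idx n m) (Matrix (Fin p) (Fin p) ℂ))
    (hY : (OM.u n m q).map f * Y = 1) {k c : Idx n m} (hkc : Y k c ≠ 0) :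
    gramM q k = gramM q c := by
  have hd : (Matrix.diagonal fun _ : Idx n m => qdet n m q).map f = D • 1 := by
    ext1 a b
    rw [Matrix.map_apply, Matrix.diagonal_apply, Matrix.smul_apply, Matrix.one_apply]
    split_ifs
    · exact hf
    · simp
  have hL : (OM.u n m q).map f * (cofL q).map f = D • 1 := by
    rw [← hd, ← u_mul_cofL hq hn, Matrix.map_mul]
  have hR : (cofR q).map f * (OM.u n m q).map f = D • 1 := by
    rw [← hd, ← cofR_mul_u hq hn, Matrix.map_mul]
  have h1 : (cofR q).map f = D • Y := by
    rw [← mul_one ((cofR q).map f), ← hY, ← mul_assoc, hR, smul_mul_assoc, one_mul]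
  have h2 : (cofL q).map f = (cofR q).map f := by
    have : (D • (1 : Matrix (Idx n m) (Idx n m) (Matrix (Fin p) (Fin p) ℂ))) * (cofL q).map f =
        (cofR q).map f * (D • 1) := by
      conv_rhs => rw [← hL]
      rw [← mul_assoc, hR]
    rw [smul_mul_assoc, one_mul, mul_smul_comm, mul_one] at this
    exact smul_right_injective _ hD this
  have h3 := congr_fun (congr_fun h2 k) c
  have h4 := congr_fun (congr_fun h1 k) c
  simp only [Matrix.map_apply, cofL_eq_smul hq hn k c, map_smul] at h3 h4
  rw [h4, ← sub_eq_zero, ← one_smul ℂ ((D • Y) k c), smul_smul, ← sub_smul, mul_one] at h3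
  have h5 := (smul_eq_zero.1 h3).resolve_right (smul_ne_zero hD hkc)
  rw [sub_eq_zero, div_eq_one_iff_eq (gramM_ne_zero hq hn c)] at h5
  exact h5

theorem gramM_fst (hq : q ≠ 0) (hq1 : q ^ 2 ≠ 1) (hn : 0 < n * m) {i j : Fin n} (h : j < i)
    (k : Fin m) : gramM q (i, k) = gramM q (j, k) := by
  obtain ⟨f, hf⟩ := exists_repV n m hq
  have hg : Function.Injective fun i : Fin n => ((i : ℕ) + 1 : ℂ) := by
    intro i j hij
    simpa [Fin.ext_iff] using hij
  have hg0 (i : Fin n) : ((i : ℕ) + 1 : ℂ) ≠ 0 := Nat.cast_add_one_ne_zero _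
  -- At the diagonal position `x`, exactly the `m` indices of row `x` contribute a factor `q`. The
  -- torus entries `i + 1` below are chosen to be distinct and nonzero.
  refine gramM_eq_of_rep hq hn f (D := (q : ℂ) ^ m) (pow_ne_zero _ (by exact_mod_cast hq)) ?_
    (Matrix.of fun a b => rBlockInv q a.1 b.1 * (1 : Matrix (Fin m) (Fin m) _) a.2 b.2) ?_ ?_
  · refine rep_qdet hq f (fun i => (i : ℕ) + 1) (fun _ => 1) hg0 (by simp)
      (fun i => (i : ℕ) + 1) hg ?_ ?_ (fun a x => if a.1 = x then q else 1) ?_ _ ?_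
    · intro a b
      ext x y
      rw [hf, Matrix.one_apply]
      split_ifs with h
      · simpa using rBlock_torus (fun i : Fin n => ((i : ℕ) + 1 : ℂ)) a.1 b.1 x y
      · simp
    · intro a b i j hij
      rw [hf, Matrix.one_apply]
      split_ifs
      · rw [mul_one, rBlock_lower _ _ hij]
      · simp
    · intro a b x
      rw [hf, Matrix.one_apply]
      by_cases h1 : a.1 = b.1 <;> by_cases h2 : a.2 = b.2 <;>
      simp [h1, h2, rBlock_diag, Prod.ext_iff]
    · intro x
      rw [Fintype.prod_prod_type, Finset.prod_comm]
      simp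
  · ext1 a b
    rw [Matrix.mul_apply, Fintype.sum_prod_type, Finset.sum_comm]
    simp only [Matrix.map_apply, hf, Matrix.of_apply]
    simp only [Matrix.one_apply, mul_ite, mul_one, mul_zero, ite_mul, zero_mul,
      Finset.sum_ite_irrel, Finset.sum_const_zero, Finset.sum_ite_eq', Finset.mem_univ, if_true]
    rw [sum_rBlock_mul_rBlockInv hq]
    by_cases h1 : a.1 = b.1 <;> by_cases h2 : a.2 = b.2 <;>
      simp [h1, h2, Prod.ext_iff]
  · simpa using rBlockInv_ne_zero hq hq1 h

theorem gramM_snd (hq : q ≠ 0) (hq1 : q ^ 2 ≠ 1) (hn : 0 < n * m) {i j : Fin m} (h : j < i)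
    (k : Fin n) : gramM q (k, i) = gramM q (k, j) := by
  obtain ⟨f, hf⟩ := exists_repW n m hq
  have hg : Function.Injective fun i : Fin m => ((i : ℕ) + 1 : ℂ) := by
    intro i j hij
    simpa [Fin.ext_iff] using hij
  have hg0 (i : Fin m) : ((i : ℕ) + 1 : ℂ) ≠ 0 := Nat.cast_add_one_ne_zero _
  refine gramM_eq_of_rep hq hn f (D := (q : ℂ) ^ n) (pow_ne_zero _ (by exact_mod_cast hq)) ?_
    (Matrix.of fun a b => (1 : Matrix (Fin n) (Fin n) _) a.1 b.1 * rBlockInv q a.2 b.2) ?_ ?_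
  · refine rep_qdet hq f (fun _ => 1) (fun i => (i : ℕ) + 1) (by simp) hg0
      (fun i => (i : ℕ) + 1) hg ?_ ?_ (fun a x => if a.2 = x then q else 1) ?_ _ ?_
    · intro a b
      ext x y
      rw [hf, Matrix.one_apply]
      split_ifs with h
      · simpa using rBlock_torus (fun i : Fin m => ((i : ℕ) + 1 : ℂ)) a.2 b.2 x y
      · simp
    · intro a b i j hij
      rw [hf, Matrix.one_apply]
      split_ifs
      · rw [one_mul, rBlock_lower _ _ hij]
      · simp
    · intro a b x
      rw [hf, Matrix.one_apply]
      by_cases h1 : a.1 = b.1 <;> by_cases h2 : a.2 = b.2 <;>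
      simp [h1, h2, rBlock_diag, Prod.ext_iff]
    · intro x
      rw [Fintype.prod_prod_type]
      simp
  · ext1 a b
    rw [Matrix.mul_apply, Fintype.sum_prod_type]
    simp only [Matrix.map_apply, hf, Matrix.of_apply]
    simp only [Matrix.one_apply, mul_ite, mul_zero, ite_mul, zero_mul, one_mul,
      Finset.sum_ite_irrel, Finset.sum_const_zero, Finset.sum_ite_eq', Finset.mem_univ, if_true]
    rw [sum_rBlock_mul_rBlockInv hq]
    by_cases h1 : a.1 = b.1 <;> by_cases h2 : a.2 = b.2 <;>
      simp [h1, h2, Prod.ext_iff]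
  · simpa using rBlockInv_ne_zero hq hq1 h

theorem gramM_eq (hq : q ≠ 0) (hq1 : q ^ 2 ≠ 1) (hn : 0 < n * m) (a b : Idx n m) :
    gramM q a = gramM q b := by
  obtain ⟨i, k⟩ := a
  obtain ⟨j, l⟩ := b
  have h1 : gramM q (i, k) = gramM q (j, k) := by
    rcases lt_trichotomy i j with h | rfl | h
    · exact (gramM_fst hq hq1 hn h k).symm
    · rfl
    · exact gramM_fst hq hq1 hn h k
  rw [h1]
  rcases lt_trichotomy k l with h | rfl | h
  · exact (gramM_snd hq hq1 hn h j).symm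
  · rfl
  · exact gramM_snd hq hq1 hn h j

/-- The left and the right cofactor matrices agree. -/
theorem cofL_eq_cofR (hq : q ≠ 0) (hq1 : q ^ 2 ≠ 1) (hn : 0 < n * m) :
    (cofL q : Matrix (Idx n m) (Idx n m) (OM n m q)) = cofR q := by
  ext k c
  rw [cofL_eq_smul hq hn, gramM_eq hq hq1 hn k c, div_self (gramM_ne_zero hq hn c), one_smul]

theorem isPairingMatrix_cofR (hq : q ≠ 0) (hq1 : q ^ 2 ≠ 1) (hn : 0 < n * m) :
    IsPairingMatrix (cofR q : Matrix (Idx n m) (Idx n m) (OM n m q)) := by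
  obtain ⟨b, hb⟩ := exists_basisL (n := n) (m := m) hq hn
  obtain ⟨b', hb'⟩ := exists_basisR (n := n) (m := m) hq hn
  refine ⟨⟨b, fun r s => ?_, fun s => ?_⟩, b', fun r s => ?_, fun s => ?_⟩
  · rw [hb]
    exact x_mul_dualL hq r s
  · simp only [hb, ← cofL_eq_cofR hq hq1 hn]
    exact coactL_dualL hq hn s
  · rw [hb']
    exact dualR_mul_x hq r s
  · simp only [hb']
    exact coactR_dualR hq hn s

end Representation

/-! ### Adjoining an inverse -/

section AdjoinInv

variable {A B : Type*} [Ring A] [Algebra ℂ A] [Ring B] [Algebra ℂ B]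

/-- The canonical map to `AdjoinInv d`. -/
def AdjoinInv.ofHom (d : A) : A →ₐ[ℂ] AdjoinInv d :=
  have hs (c : ℂ) : AdjoinInv.of d (algebraMap ℂ A c) = algebraMap ℂ (AdjoinInv d) c :=
    (RingQuot.mkAlgHom_rel ℂ (AdjoinInvRel.scalar c)).trans (AlgHom.commutes _ c)
  { toFun := AdjoinInv.of d
    map_one' := by simpa using hs 1
    map_mul' := fun a b => (RingQuot.mkAlgHom_rel ℂ (AdjoinInvRel.mul a b)).trans (map_mul _ _ _)
    map_zero' := by simpa using hs 0
    map_add' := fun a b => (RingQuot.mkAlgHom_rel ℂ (AdjoinInvRel.add a b)).trans (map_add _ _ _)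
    commutes' := hs }

theorem AdjoinInv.ofHom_apply (d a : A) : AdjoinInv.ofHom d a = AdjoinInv.of d a := rfl

theorem AdjoinInv.of_mul_inv (d : A) : AdjoinInv.of d d * AdjoinInv.inv d = 1 :=
  (map_mul _ _ _).symm.trans
    ((RingQuot.mkAlgHom_rel ℂ (AdjoinInvRel.mul_inv (d := d))).trans (map_one _))

theorem AdjoinInv.inv_mul_of (d : A) : AdjoinInv.inv d * AdjoinInv.of d d = 1 :=
  (map_mul _ _ _).symm.trans
    ((RingQuot.mkAlgHom_rel ℂ (AdjoinInvRel.inv_mul (d := d))).trans (map_one _))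

/-- The extension to `AdjoinInv d` of a map that makes `d` invertible. -/
def AdjoinInv.lift (d : A) (f : A →ₐ[ℂ] B) (e : B) (h₁ : f d * e = 1) (h₂ : e * f d = 1) :
    AdjoinInv d →ₐ[ℂ] B :=
  (AdjoinInv.existsUnique_lift d f e h₁ h₂).choose

section Lift

variable (d : A) (f : A →ₐ[ℂ] B) (e : B) (h₁ : f d * e = 1) (h₂ : e * f d = 1)

theorem AdjoinInv.lift_of (a : A) :
    AdjoinInv.lift d f e h₁ h₂ (AdjoinInv.of d a) = f a :=
  (AdjoinInv.existsUnique_lift d f e h₁ h₂).choose_spec.1.1 a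

theorem AdjoinInv.lift_inv :
    AdjoinInv.lift d f e h₁ h₂ (AdjoinInv.inv d) = e :=
  (AdjoinInv.existsUnique_lift d f e h₁ h₂).choose_spec.1.2

end Lift

theorem AdjoinInv.algHom_ext {d : A} {f g : AdjoinInv d →ₐ[ℂ] B}
    (h : ∀ a, f (AdjoinInv.of d a) = g (AdjoinInv.of d a)) : f = g := by
  have hf₁ : f (AdjoinInv.of d d) * f (AdjoinInv.inv d) = 1 := by
    rw [← map_mul, AdjoinInv.of_mul_inv, map_one]
  have hf₂ : f (AdjoinInv.inv d) * f (AdjoinInv.of d d) = 1 := by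
    rw [← map_mul, AdjoinInv.inv_mul_of, map_one]
  have hg : g (AdjoinInv.inv d) * f (AdjoinInv.of d d) = 1 := by
    rw [h, ← map_mul, AdjoinInv.inv_mul_of, map_one]
  exact (AdjoinInv.existsUnique_lift d (f.comp (AdjoinInv.ofHom d)) _ hf₁ hf₂).unique
    ⟨fun _ => rfl, rfl⟩ ⟨fun a => (h a).symm, left_inv_eq_right_inv hg hf₁⟩

end AdjoinInv

/-! ### Maps from the quantum matrix space -/

section MatrixSpace

variable {n m : ℕ} {q : ℝ} {B C : Type*} [Ring B] [Algebra ℂ B] [Ring C] [Algebra ℂ C]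

variable (q) in
/-- The relations of the quantum matrix space for a matrix with entries in an algebra. -/
def PlusRel (U : Matrix (Idx n m) (Idx n m) B) : Prop :=
  ∀ a b : Idx n m × Idx n m, ∑ e, Pplus n m q a e • (U e.1 b.1 * U e.2 b.2) =
    ∑ e, Pplus n m q e b • (U a.1 e.1 * U a.2 e.2)

/-- The map from the quantum matrix space given by a matrix that satisfies the relations. -/
def OM.lift (U : Matrix (Idx n m) (Idx n m) B) (hU : PlusRel q U) : OM n m q →ₐ[ℂ] B :=
  (OM.exists_lift U hU).choose

theorem OM.lift_u (U : Matrix (Idx n m) (Idx n m) B) (hU : PlusRel q U) (a b : Idx n m) :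
    OM.lift U hU (OM.u n m q a b) = U a b :=
  (OM.exists_lift U hU).choose_spec a b

theorem OM.algHom_ext {f g : OM n m q →ₐ[ℂ] B}
    (h : ∀ a b, f (OM.u n m q a b) = g (OM.u n m q a b)) : f = g :=
  RingQuot.ringQuot_ext' ℂ _ _ (FreeAlgebra.hom_ext (funext fun p => h p.1 p.2))

/-- The generators lift to a map into `S`, and its composite with the inclusion is the identity. -/
theorem OM.subalgebra_eq_top {S : Subalgebra ℂ (OM n m q)} (h : ∀ a b, OM.u n m q a b ∈ S) :
    S = ⊤ := by
  let U : Matrix (Idx n m) (Idx n m) S := Matrix.of fun a b => ⟨OM.u n m q a b, h a b⟩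
  have hU : PlusRel q U := fun a b => Subtype.ext (by simpa [U] using OM.rel a b)
  have hf : S.val.comp (OM.lift U hU) = AlgHom.id ℂ _ := OM.algHom_ext fun a b => by
    rw [AlgHom.comp_apply, OM.lift_u]
    rfl
  exact (eq_top_iff).2 fun x _ => by
    rw [← AlgHom.id_apply (R := ℂ) x, ← hf]
    exact (OM.lift U hU x).2

theorem AdjoinInv.subalgebra_eq_top {D : OM n m q} {S : Subalgebra ℂ (AdjoinInv D)}
    (h : ∀ a b, AdjoinInv.of D (OM.u n m q a b) ∈ S) (hi : AdjoinInv.inv D ∈ S) : S = ⊤ := by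
  have h' : S.comap (AdjoinInv.ofHom D) = ⊤ := OM.subalgebra_eq_top h
  have h'' (x : OM n m q) : AdjoinInv.ofHom D x ∈ S :=
    (Subalgebra.mem_comap _ _ _).1 (h' ▸ Algebra.mem_top)
  let f : OM n m q →ₐ[ℂ] S := (AdjoinInv.ofHom D).codRestrict S h''
  let g : AdjoinInv D →ₐ[ℂ] S := AdjoinInv.lift D f ⟨AdjoinInv.inv D, hi⟩
    (Subtype.ext (AdjoinInv.of_mul_inv D)) (Subtype.ext (AdjoinInv.inv_mul_of D))
  have hg : S.val.comp g = AlgHom.id ℂ _ := AdjoinInv.algHom_ext fun a => by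
    rw [AlgHom.comp_apply, AdjoinInv.lift_of]
    rfl
  exact (eq_top_iff).2 fun x _ => by
    rw [← AlgHom.id_apply (R := ℂ) x, ← hg]
    exact (g x).2

theorem AdjoinInv.algHom_ext_u {D : OM n m q} {f g : AdjoinInv D →ₐ[ℂ] B}
    (h : ∀ a b, f (AdjoinInv.of D (OM.u n m q a b)) = g (AdjoinInv.of D (OM.u n m q a b))) :
    f = g :=
  AdjoinInv.algHom_ext fun a => DFunLike.congr_fun
    (OM.algHom_ext (f := f.comp (AdjoinInv.ofHom D)) (g := g.comp (AdjoinInv.ofHom D)) h) a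

theorem PlusRel.map {U : Matrix (Idx n m) (Idx n m) B} (hU : PlusRel q U) (f : B →ₐ[ℂ] C) :
    PlusRel q (U.map f) := fun a b => by
  simpa only [map_sum, map_smul, map_mul, Matrix.map_apply] using congr_arg f (hU a b)

theorem PlusRel.one : PlusRel q (1 : Matrix (Idx n m) (Idx n m) B) := fun a b => by
  have h (x y : Idx n m × Idx n m) : (1 : Matrix (Idx n m) (Idx n m) B) x.1 y.1 *
      (1 : Matrix (Idx n m) (Idx n m) B) x.2 y.2 = if x = y then 1 else 0 := by
    simp only [Matrix.one_apply, Prod.ext_iff (x := x)]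
    split_ifs <;> simp_all
  simp only [h, smul_ite, smul_zero]
  simp

theorem PlusRel.tmul {U : Matrix (Idx n m) (Idx n m) B} {V : Matrix (Idx n m) (Idx n m) C}
    (hU : PlusRel q U) (hV : PlusRel q V) :
    PlusRel q (Matrix.of fun a b => ∑ k, U a k ⊗ₜ[ℂ] V k b) := fun a b => by
  simp only [Matrix.of_apply, sum_tmul_mul_sum_tmul, Finset.smul_sum]
  rw [Finset.sum_comm]
  have h1 (c : Idx n m × Idx n m) :
      ∑ e, Pplus n m q a e • ((U e.1 c.1 * U e.2 c.2) ⊗ₜ[ℂ] (V c.1 b.1 * V c.2 b.2)) =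
      ∑ e, (U a.1 e.1 * U a.2 e.2) ⊗ₜ[ℂ] (Pplus n m q e c • (V c.1 b.1 * V c.2 b.2)) := by
    simp only [TensorProduct.smul_tmul', ← TensorProduct.sum_tmul, ← TensorProduct.smul_tmul]
    rw [hU]
  simp only [h1]
  rw [Finset.sum_comm]
  simp only [← TensorProduct.tmul_sum, hV _ b]
  simp only [TensorProduct.tmul_sum, TensorProduct.tmul_smul]
  rw [Finset.sum_comm]

/-- The inverse of a matrix satisfies the relations over the opposite algebra. -/
theorem PlusRel.op_inv {U W : Matrix (Idx n m) (Idx n m) B} (hU : PlusRel q U) (h₁ : U * W = 1)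
    (h₂ : W * U = 1) : PlusRel q (W.map MulOpposite.op) := fun a b => by
  let M : Matrix (Idx n m × Idx n m) (Idx n m × Idx n m) B :=
    Matrix.of fun a b => U a.1 b.1 * U a.2 b.2
  -- The inverse of `u ⊗ u` has its factors in reversed order, which is the product in the opposite
  -- algebra. Since `P₊` commutes with `u ⊗ u`, it commutes with `Z`.
  let Z : Matrix (Idx n m × Idx n m) (Idx n m × Idx n m) B :=
    Matrix.of fun a b => W a.2 b.2 * W a.1 b.1
  have e₁ (a b) : ∑ k, U a k * W k b = if a = b then 1 else 0 := by
    rw [← Matrix.mul_apply, h₁, Matrix.one_apply]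
  have e₂ (a b) : ∑ k, W a k * U k b = if a = b then 1 else 0 := by
    rw [← Matrix.mul_apply, h₂, Matrix.one_apply]
  have hMZ : M * Z = 1 := by
    ext a b
    rw [Matrix.mul_apply, Fintype.sum_prod_type]
    simp only [M, Z, Matrix.of_apply]
    have (x y : Idx n m) : U a.1 x * U a.2 y * (W y b.2 * W x b.1) =
        U a.1 x * (U a.2 y * W y b.2) * W x b.1 := by simp only [mul_assoc]
    simp only [this, ← Finset.sum_mul, ← Finset.mul_sum, e₁]
    by_cases h : a.2 = b.2
    · simp [h, e₁, Matrix.one_apply, Prod.ext_iff]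
    · simp [h, Prod.ext_iff]
  have hZM : Z * M = 1 := by
    ext a b
    rw [Matrix.mul_apply, Fintype.sum_prod_type, Finset.sum_comm]
    simp only [M, Z, Matrix.of_apply]
    have (x y : Idx n m) : W a.2 y * W a.1 x * (U x b.1 * U y b.2) =
        W a.2 y * (W a.1 x * U x b.1) * U y b.2 := by simp only [mul_assoc]
    simp only [this, ← Finset.sum_mul, ← Finset.mul_sum, e₂]
    by_cases h : a.1 = b.1
    · simp [h, e₂, Matrix.one_apply, Prod.ext_iff]
    · simp [h, Prod.ext_iff]
  have hM : Commute ((Pplus n m q).map (algebraMap ℂ B)) (⟨M, Z, hMZ, hZM⟩ : (Matrix _ _ B)ˣ) :=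
    (commute_iff _ _).2 hU
  have hZ := (commute_iff _ Z).1 hM.units_inv_right a b
  simpa only [MulOpposite.op_smul, MulOpposite.op_mul, Matrix.map_apply, Z,
    Matrix.of_apply, Finset.op_sum] using congr_arg MulOpposite.op hZ

end MatrixSpace

/-! ### Convolution of a homomorphism and an antihomomorphism -/

section Convolution

variable {A B : Type*} [Ring A] [Algebra ℂ A] [Ring B] [Algebra ℂ B]

/-- The linear map underlying an antihomomorphism. -/
def antiLinear (S : A →ₐ[ℂ] Bᵐᵒᵖ) : A →ₗ[ℂ] B :=
  (MulOpposite.opLinearEquiv ℂ).symm.toLinearMap ∘ₗ S.toLinearMap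

theorem antiLinear_apply (S : A →ₐ[ℂ] Bᵐᵒᵖ) (x : A) : antiLinear S x = (S x).unop := rfl

/-- As `S` reverses products, the contribution of `T` sits between those of the two legs of `V`.
Being a scalar, it can be pulled out. Thus the convolution identity passes to products. -/
theorem mul_map_anti_left (S : A →ₐ[ℂ] Bᵐᵒᵖ) (f : A →ₐ[ℂ] B) {T : A ⊗[ℂ] A} {c : ℂ}
    (hT : LinearMap.mul' ℂ B (TensorProduct.map (antiLinear S) f.toLinearMap T) =
      algebraMap ℂ B c) (V : A ⊗[ℂ] A) :
    LinearMap.mul' ℂ B (TensorProduct.map (antiLinear S) f.toLinearMap (T * V)) =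
      c • LinearMap.mul' ℂ B (TensorProduct.map (antiLinear S) f.toLinearMap V) := by
  induction V with
  | zero => simp
  | add V V' h h' => rw [mul_add, map_add, map_add, h, h', map_add, map_add, smul_add]
  | tmul y z =>
    have key : LinearMap.mul' ℂ B (TensorProduct.map (antiLinear S) f.toLinearMap
        (T * (y ⊗ₜ z))) = antiLinear S y * LinearMap.mul' ℂ B
          (TensorProduct.map (antiLinear S) f.toLinearMap T) * f z := by
      clear hT
      induction T with
      | zero => simp
      | add T T' h h' => rw [add_mul, map_add, map_add, h, h', map_add, map_add, mul_add, add_mul]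
      | tmul x w => simp [antiLinear_apply, mul_assoc]
    rw [key, hT, ← Algebra.commutes, mul_assoc, ← Algebra.smul_def]
    simp

theorem mul_map_anti_right (S : A →ₐ[ℂ] Bᵐᵒᵖ) (f : A →ₐ[ℂ] B) {V : A ⊗[ℂ] A} {c : ℂ}
    (hV : LinearMap.mul' ℂ B (TensorProduct.map f.toLinearMap (antiLinear S) V) =
      algebraMap ℂ B c) (T : A ⊗[ℂ] A) :
    LinearMap.mul' ℂ B (TensorProduct.map f.toLinearMap (antiLinear S) (T * V)) =
      c • LinearMap.mul' ℂ B (TensorProduct.map f.toLinearMap (antiLinear S) T) := by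
  induction T with
  | zero => simp
  | add V V' h h' => rw [add_mul, map_add, map_add, h, h', map_add, map_add, smul_add]
  | tmul y z =>
    have key : LinearMap.mul' ℂ B (TensorProduct.map f.toLinearMap (antiLinear S)
        ((y ⊗ₜ z) * V)) = f y * LinearMap.mul' ℂ B
          (TensorProduct.map f.toLinearMap (antiLinear S) V) * antiLinear S z := by
      clear hV
      induction V with
      | zero => simp
      | add T T' h h' => rw [mul_add, map_add, map_add, h, h', map_add, map_add, mul_add, add_mul]
      | tmul x w => simp [antiLinear_apply, mul_assoc]
    rw [key, hV, ← Algebra.commutes, mul_assoc, ← Algebra.smul_def]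
    simp

/-- The elements on which an antihomomorphism is a left convolution inverse of a homomorphism. -/
def leftConvSubalgebra (Δ : A →ₐ[ℂ] A ⊗[ℂ] A) (ε : A →ₐ[ℂ] ℂ) (S : A →ₐ[ℂ] Bᵐᵒᵖ)
    (f : A →ₐ[ℂ] B) : Subalgebra ℂ A where
  carrier := {x | LinearMap.mul' ℂ B (TensorProduct.map (antiLinear S) f.toLinearMap (Δ x)) =
    algebraMap ℂ B (ε x)}
  mul_mem' {x y} hx hy := by
    rw [Set.mem_ofPred_eq] at hx hy ⊢
    rw [map_mul, mul_map_anti_left S f hx, hy, map_mul, map_mul, Algebra.smul_def]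
  add_mem' {x y} hx hy := by
    rw [Set.mem_ofPred_eq] at hx hy ⊢
    simp only [map_add, hx, hy]
  algebraMap_mem' c := by
    rw [Set.mem_ofPred_eq, AlgHom.commutes, AlgHom.commutes, Algebra.algebraMap_eq_smul_one,
      map_smul, map_smul, Algebra.TensorProduct.one_def]
    simp [antiLinear_apply, Algebra.algebraMap_eq_smul_one]

/-- The elements on which an antihomomorphism is a right convolution inverse of a homomorphism. -/
def rightConvSubalgebra (Δ : A →ₐ[ℂ] A ⊗[ℂ] A) (ε : A →ₐ[ℂ] ℂ) (S : A →ₐ[ℂ] Bᵐᵒᵖ)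
    (f : A →ₐ[ℂ] B) : Subalgebra ℂ A where
  carrier := {x | LinearMap.mul' ℂ B (TensorProduct.map f.toLinearMap (antiLinear S) (Δ x)) =
    algebraMap ℂ B (ε x)}
  mul_mem' {x y} hx hy := by
    rw [Set.mem_ofPred_eq] at hx hy ⊢
    rw [map_mul, mul_map_anti_right S f hy, hx, map_mul, mul_comm, map_mul, Algebra.smul_def]
  add_mem' {x y} hx hy := by
    rw [Set.mem_ofPred_eq] at hx hy ⊢
    simp only [map_add, hx, hy]
  algebraMap_mem' c := by
    rw [Set.mem_ofPred_eq, AlgHom.commutes, AlgHom.commutes, Algebra.algebraMap_eq_smul_one,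
      map_smul, map_smul, Algebra.TensorProduct.one_def]
    simp [antiLinear_apply, Algebra.algebraMap_eq_smul_one]

end Convolution

/-! ### The bialgebra structure of the quantum matrix space -/

section Bialgebra

variable {n m : ℕ} {q : ℝ}

variable (n m q) in
theorem OM.plusRel_u : PlusRel q (OM.u n m q) := OM.rel

variable (n m q) in
/-- The comultiplication of the quantum matrix space. -/
def OM.comul : OM n m q →ₐ[ℂ] OM n m q ⊗[ℂ] OM n m q :=
  OM.lift _ ((OM.plusRel_u n m q).tmul (OM.plusRel_u n m q))

variable (n m q) in
/-- The counit of the quantum matrix space. -/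
def OM.counit : OM n m q →ₐ[ℂ] ℂ :=
  OM.lift 1 PlusRel.one

theorem OM.comul_u (a b : Idx n m) : OM.comul n m q (OM.u n m q a b) =
    ∑ k, OM.u n m q a k ⊗ₜ[ℂ] OM.u n m q k b :=
  OM.lift_u _ _ a b

theorem OM.counit_u (a b : Idx n m) :
    OM.counit n m q (OM.u n m q a b) = (1 : Matrix (Idx n m) (Idx n m) ℂ) a b :=
  OM.lift_u _ _ a b

theorem OM.coactL_coassoc (x : QExt n m q) :
    Algebra.TensorProduct.assoc ℂ ℂ ℂ _ _ _
      (Algebra.TensorProduct.map (OM.comul n m q) (AlgHom.id ℂ _) (coactL n m q x)) =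
    Algebra.TensorProduct.map (AlgHom.id ℂ _) (coactL n m q) (coactL n m q x) := by
  have h : ((Algebra.TensorProduct.assoc ℂ ℂ ℂ _ _ _).toAlgHom.comp
      ((Algebra.TensorProduct.map (OM.comul n m q) (AlgHom.id ℂ _)).comp (coactL n m q))) =
      (Algebra.TensorProduct.map (AlgHom.id ℂ _) (coactL n m q)).comp (coactL n m q) := by
    refine QExt.algHom_ext fun a => ?_
    simp [coactL_x, OM.comul_u, TensorProduct.sum_tmul, TensorProduct.tmul_sum]
    exact Finset.sum_comm
  exact DFunLike.congr_fun h x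

theorem OM.coactL_counit (x : QExt n m q) : Algebra.TensorProduct.lid ℂ _
    (Algebra.TensorProduct.map (OM.counit n m q) (AlgHom.id ℂ _) (coactL n m q x)) = x := by
  have h : (Algebra.TensorProduct.lid ℂ _).toAlgHom.comp
      ((Algebra.TensorProduct.map (OM.counit n m q) (AlgHom.id ℂ _)).comp (coactL n m q)) =
      AlgHom.id ℂ _ := by
    refine QExt.algHom_ext fun a => ?_
    simp [coactL_x, OM.counit_u, Matrix.one_apply, ite_smul]
  exact DFunLike.congr_fun h x

/-- Coassociativity of the left coaction, applied to `ω`, compares the two sides as coefficients of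
`ω`. -/
theorem OM.comul_qdet (hq : q ≠ 0) :
    OM.comul n m q (qdet n m q) = qdet n m q ⊗ₜ[ℂ] qdet n m q := by
  apply tmul_topForm_injective hq
  apply (Algebra.TensorProduct.assoc ℂ ℂ ℂ _ _ _).injective
  simpa [coactL_topForm hq] using OM.coactL_coassoc (topForm n m q)

theorem OM.counit_qdet (hq : q ≠ 0) : OM.counit n m q (qdet n m q) = 1 := by
  apply topForm_smul_injective (n := n) (m := m) hq
  simpa [coactL_topForm hq] using OM.coactL_counit (topForm n m q)

end Bialgebra

/-! ### The Hopf algebra structure of the quantum general linear group -/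

section Hopf

variable {n m : ℕ} {q : ℝ}

theorem exists_inverse_u {ut : Matrix (Idx n m) (Idx n m) (OM n m q)} {D : OM n m q}
    (h₁ : ut * OM.u n m q = Matrix.diagonal fun _ => D)
    (h₂ : OM.u n m q * ut = Matrix.diagonal fun _ => D)
    {W : Matrix (Idx n m) (Idx n m) (OGL D)}
    (hW : W = Matrix.of fun a b => AdjoinInv.of D (ut a b) * AdjoinInv.inv D) :
    (OM.u n m q).map (AdjoinInv.of D) * W = 1 ∧ W * (OM.u n m q).map (AdjoinInv.of D) = 1 := by
  -- Both sides are `ut * u * ut`. So `D`, and hence its inverse, commutes with the cofactors, which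
  -- makes `ut D⁻¹` a two-sided inverse of `u`.
  have hc : (Matrix.diagonal fun _ => D) * ut = ut * Matrix.diagonal fun _ => D := by
    nth_rw 1 [← h₁]
    rw [mul_assoc, h₂]
  have hc' (a b) : AdjoinInv.inv D * AdjoinInv.of D (ut a b) =
      AdjoinInv.of D (ut a b) * AdjoinInv.inv D := by
    have := congr_fun (congr_fun hc a) b
    rw [Matrix.diagonal_mul, Matrix.mul_diagonal] at this
    have := congr_arg (AdjoinInv.ofHom D) this
    simp only [map_mul, AdjoinInv.ofHom_apply] at this
    calc _ = AdjoinInv.inv D * (AdjoinInv.of D (ut a b) * AdjoinInv.of D D) * AdjoinInv.inv D := by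
          rw [mul_assoc, mul_assoc, AdjoinInv.of_mul_inv, mul_one]
      _ = _ := by rw [← this, ← mul_assoc, AdjoinInv.inv_mul_of, one_mul]
  have e₁ := congr_arg (AdjoinInv.ofHom D).mapMatrix h₁
  have e₂ := congr_arg (AdjoinInv.ofHom D).mapMatrix h₂
  rw [map_mul] at e₁ e₂
  constructor
  · ext a b
    have := congr_fun (congr_fun e₂ a) b
    simp only [Matrix.mul_apply, AlgHom.mapMatrix_apply, Matrix.map_apply,
      AdjoinInv.ofHom_apply] at this
    simp only [hW, Matrix.mul_apply, Matrix.map_apply, Matrix.of_apply, ← mul_assoc,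
      ← Finset.sum_mul, this, Matrix.diagonal_apply, Matrix.one_apply]
    split_ifs
    · exact AdjoinInv.of_mul_inv D
    · rw [← AdjoinInv.ofHom_apply, map_zero, zero_mul]
  · ext a b
    have := congr_fun (congr_fun e₁ a) b
    simp only [Matrix.mul_apply, AlgHom.mapMatrix_apply, Matrix.map_apply,
      AdjoinInv.ofHom_apply] at this
    simp only [hW, Matrix.mul_apply, Matrix.map_apply, Matrix.of_apply, ← hc', mul_assoc,
      ← Finset.mul_sum, this, Matrix.diagonal_apply, Matrix.one_apply]
    split_ifs
    · exact AdjoinInv.inv_mul_of D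
    · rw [← AdjoinInv.ofHom_apply, map_zero, mul_zero]

section Structure

variable {D : OM n m q} (hΔ : OM.comul n m q D = D ⊗ₜ[ℂ] D) (hε : OM.counit n m q D = 1)

/-- The comultiplication of the quantum general linear group. -/
def OGL.comul : OGL D →ₐ[ℂ] OGL D ⊗[ℂ] OGL D :=
  AdjoinInv.lift D
    ((Algebra.TensorProduct.map (AdjoinInv.ofHom D) (AdjoinInv.ofHom D)).comp (OM.comul n m q))
    (AdjoinInv.inv D ⊗ₜ AdjoinInv.inv D)
    (by simp [hΔ, AdjoinInv.ofHom_apply, AdjoinInv.of_mul_inv, Algebra.TensorProduct.one_def])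
    (by simp [hΔ, AdjoinInv.ofHom_apply, AdjoinInv.inv_mul_of, Algebra.TensorProduct.one_def])

/-- The counit of the quantum general linear group. -/
def OGL.counit : OGL D →ₐ[ℂ] ℂ :=
  AdjoinInv.lift D (OM.counit n m q) 1 (by rw [hε, one_mul]) (by rw [hε, one_mul])

theorem OGL.comul_u (a b : Idx n m) : OGL.comul hΔ (AdjoinInv.of D (OM.u n m q a b)) =
    ∑ k, AdjoinInv.of D (OM.u n m q a k) ⊗ₜ[ℂ] AdjoinInv.of D (OM.u n m q k b) := by
  rw [OGL.comul, AdjoinInv.lift_of, AlgHom.comp_apply, OM.comul_u, map_sum]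
  rfl

theorem OGL.comul_inv :
    OGL.comul hΔ (AdjoinInv.inv D) = AdjoinInv.inv D ⊗ₜ AdjoinInv.inv D :=
  AdjoinInv.lift_inv _ _ _ _ _

theorem OGL.counit_u (a b : Idx n m) : OGL.counit hε (AdjoinInv.of D (OM.u n m q a b)) =
    (1 : Matrix (Idx n m) (Idx n m) ℂ) a b := by
  rw [OGL.counit, AdjoinInv.lift_of, OM.counit_u]

theorem OGL.counit_inv : OGL.counit hε (AdjoinInv.inv D) = 1 :=
  AdjoinInv.lift_inv _ _ _ _ _

/-- The bialgebra structure of the quantum general linear group. -/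
abbrev OGL.bialgebra : Bialgebra ℂ (OGL D) :=
  Bialgebra.ofAlgHom (OGL.comul hΔ) (OGL.counit hε)
    (AdjoinInv.algHom_ext_u fun a b => by
      simp [OGL.comul_u, TensorProduct.sum_tmul, TensorProduct.tmul_sum]
      exact Finset.sum_comm)
    (AdjoinInv.algHom_ext_u fun a b => by
      simp [OGL.comul_u, OGL.counit_u, Matrix.one_apply, TensorProduct.ite_tmul])
    (AdjoinInv.algHom_ext_u fun a b => by
      simp [OGL.comul_u, OGL.counit_u, Matrix.one_apply, TensorProduct.tmul_ite])

end Structure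

variable {D : OM n m q}

theorem exists_antipode (hΔ : OM.comul n m q D = D ⊗ₜ[ℂ] D)
    (hε : OM.counit n m q D = 1)
    {W : Matrix (Idx n m) (Idx n m) (OGL D)}
    (h₁ : (OM.u n m q).map (AdjoinInv.of D) * W = 1)
    (h₂ : W * (OM.u n m q).map (AdjoinInv.of D) = 1) :
    ∃ S : OGL D →ₐ[ℂ] (OGL D)ᵐᵒᵖ,
      (∀ a b, S (AdjoinInv.of D (OM.u n m q a b)) = MulOpposite.op (W a b)) ∧
      S (AdjoinInv.inv D) = MulOpposite.op (AdjoinInv.of D D) := by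
  let S₀ : OM n m q →ₐ[ℂ] (OGL D)ᵐᵒᵖ := OM.lift (W.map MulOpposite.op)
    (((OM.plusRel_u n m q).map (AdjoinInv.ofHom D)).op_inv h₁ h₂)
  have hS₀ (a b) : S₀ (OM.u n m q a b) = MulOpposite.op (W a b) := OM.lift_u _ _ a b
  have htop : leftConvSubalgebra (OM.comul n m q) (OM.counit n m q) S₀ (AdjoinInv.ofHom D) = ⊤ :=
    OM.subalgebra_eq_top fun a b => by
      change LinearMap.mul' ℂ _ (TensorProduct.map (antiLinear S₀)
        (AdjoinInv.ofHom D).toLinearMap (OM.comul n m q (OM.u n m q a b))) =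
        algebraMap ℂ _ (OM.counit n m q (OM.u n m q a b))
      have := congr_fun (congr_fun h₂ a) b
      simp only [Matrix.mul_apply, Matrix.map_apply] at this
      simp [OM.comul_u, OM.counit_u, antiLinear_apply, hS₀, AdjoinInv.ofHom_apply, this,
        Matrix.one_apply]
  have hD : D ∈ leftConvSubalgebra (OM.comul n m q) (OM.counit n m q) S₀ (AdjoinInv.ofHom D) :=
    htop ▸ Algebra.mem_top
  -- The convolution identity at the grouplike `D` with `ε(D) = 1` forces `S₀ D = D⁻¹`, so `S₀`
  -- extends to the localization.
  have hD' : (S₀ D).unop * AdjoinInv.of D D = 1 := by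
    have : LinearMap.mul' ℂ _ (TensorProduct.map (antiLinear S₀)
        (AdjoinInv.ofHom D).toLinearMap (OM.comul n m q D)) =
        algebraMap ℂ _ (OM.counit n m q D) := hD
    simpa [hΔ, hε, antiLinear_apply, AdjoinInv.ofHom_apply] using this
  have hD'' : S₀ D = MulOpposite.op (AdjoinInv.inv D) :=
    MulOpposite.unop_injective (left_inv_eq_right_inv hD' (AdjoinInv.of_mul_inv D))
  refine ⟨AdjoinInv.lift D S₀ (MulOpposite.op (AdjoinInv.of D D)) ?_ ?_, fun a b => ?_, ?_⟩
  · rw [hD'', ← MulOpposite.op_mul, AdjoinInv.of_mul_inv, MulOpposite.op_one]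
  · rw [hD'', ← MulOpposite.op_mul, AdjoinInv.inv_mul_of, MulOpposite.op_one]
  · rw [AdjoinInv.lift_of, hS₀]
  · rw [AdjoinInv.lift_inv]

theorem exists_hopfAlgebra (hΔ : OM.comul n m q D = D ⊗ₜ[ℂ] D)
    (hε : OM.counit n m q D = 1)
    {ut : Matrix (Idx n m) (Idx n m) (OM n m q)}
    (h₁ : ut * OM.u n m q = Matrix.diagonal fun _ => D)
    (h₂ : OM.u n m q * ut = Matrix.diagonal fun _ => D) :
    ∃ H : HopfAlgebra ℂ (OGL D), H.toAlgebra = AdjoinInv.instAlgebra D ∧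
      HopfFormulas H ((OM.u n m q).map (AdjoinInv.of D)) (ut.map (AdjoinInv.of D))
        (AdjoinInv.of D D) (AdjoinInv.inv D) := by
  obtain ⟨hUW, hWU⟩ := exists_inverse_u h₁ h₂ rfl
  obtain ⟨S, hS, hSi⟩ := exists_antipode hΔ hε hUW hWU
  have hl : leftConvSubalgebra (OGL.comul hΔ) (OGL.counit hε) S (AlgHom.id ℂ _) = ⊤ := by
    refine AdjoinInv.subalgebra_eq_top (fun a b => ?_) ?_
    · change LinearMap.mul' ℂ _ (TensorProduct.map (antiLinear S) _ (OGL.comul hΔ _)) =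
        algebraMap ℂ _ (OGL.counit hε _)
      have := congr_fun (congr_fun hWU a) b
      simp only [Matrix.mul_apply, Matrix.map_apply, Matrix.of_apply] at this
      simp [OGL.comul_u, OGL.counit_u, antiLinear_apply, hS, this, Matrix.one_apply]
    · change LinearMap.mul' ℂ _ (TensorProduct.map (antiLinear S) _ (OGL.comul hΔ _)) =
        algebraMap ℂ _ (OGL.counit hε _)
      simp [OGL.comul_inv, OGL.counit_inv, antiLinear_apply, hSi, AdjoinInv.of_mul_inv]
  have hr : rightConvSubalgebra (OGL.comul hΔ) (OGL.counit hε) S (AlgHom.id ℂ _) = ⊤ := by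
    refine AdjoinInv.subalgebra_eq_top (fun a b => ?_) ?_
    · change LinearMap.mul' ℂ _ (TensorProduct.map _ (antiLinear S) (OGL.comul hΔ _)) =
        algebraMap ℂ _ (OGL.counit hε _)
      have := congr_fun (congr_fun hUW a) b
      simp only [Matrix.mul_apply, Matrix.map_apply, Matrix.of_apply] at this
      simp [OGL.comul_u, OGL.counit_u, antiLinear_apply, hS, this, Matrix.one_apply]
    · change LinearMap.mul' ℂ _ (TensorProduct.map _ (antiLinear S) (OGL.comul hΔ _)) =
        algebraMap ℂ _ (OGL.counit hε _)
      simp [OGL.comul_inv, OGL.counit_inv, antiLinear_apply, hSi, AdjoinInv.inv_mul_of]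
  let H : HopfAlgebra ℂ (OGL D) :=
    { OGL.bialgebra hΔ hε with
      antipode := antiLinear S
      mul_antipode_rTensor_comul := LinearMap.ext fun x => by
        have : x ∈ leftConvSubalgebra (OGL.comul hΔ) (OGL.counit hε) S (AlgHom.id ℂ _) :=
          hl ▸ Algebra.mem_top
        exact this
      mul_antipode_lTensor_comul := LinearMap.ext fun x => by
        have : x ∈ rightConvSubalgebra (OGL.comul hΔ) (OGL.counit hε) S (AlgHom.id ℂ _) :=
          hr ▸ Algebra.mem_top
        exact this }
  refine ⟨H, rfl, OGL.comul_u hΔ, OGL.counit_u hε, fun a b => ?_, ?_⟩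
  · exact congr_arg MulOpposite.unop (hS a b)
  · exact congr_arg MulOpposite.unop hSi

/-- Hopf algebra structures on an algebra are determined by their values on generators. -/
theorem hopfAlgebra_ext {B ι : Type} [Ring B] [inst : Algebra ℂ B] [Fintype ι] [DecidableEq ι]
    {u ut : Matrix ι ι B} {d e : B}
    (hgen : ∀ (C : Type) [Ring C] [Algebra ℂ C] (f g : B →ₐ[ℂ] C),
      (∀ i j, f (u i j) = g (u i j)) → f = g)
    {H H' : HopfAlgebra ℂ B} (h : H.toAlgebra = inst) (h' : H'.toAlgebra = inst)
    (F : HopfFormulas H u ut d e) (F' : HopfFormulas H' u ut d e) : H = H' := by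
  -- Antimultiplicativity of the antipodes is recorded before the structures are taken apart. It
  -- makes them algebra maps to the opposite algebra, so `hgen` applies to them as well.
  have s₁ := @HopfAlgebra.antipode_one ℂ B _ _ H
  have s₂ := @HopfAlgebra.antipode_mul_antidistrib ℂ B _ _ H
  have s₁' := @HopfAlgebra.antipode_one ℂ B _ _ H'
  have s₂' := @HopfAlgebra.antipode_mul_antidistrib ℂ B _ _ H'
  rcases H with @⟨@⟨@⟨alg, @⟨⟨comul, counit⟩, c₁, c₂, c₃⟩, b₁, b₂, b₃, b₄⟩, antipode⟩, a₁, a₂⟩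
  rcases H' with @⟨@⟨@⟨alg', @⟨⟨comul', counit'⟩, c₁', c₂', c₃'⟩, b₁', b₂', b₃', b₄'⟩, antipode'⟩,
    a₁', a₂'⟩
  obtain rfl : alg = inst := h
  obtain rfl : alg' = alg := h'
  obtain ⟨F₁, F₂, F₃, -⟩ := F
  obtain ⟨F₁', F₂', F₃', -⟩ := F'
  have e₁ : comul = comul' := congr_arg AlgHom.toLinearMap <| hgen _
    (AlgHom.ofLinearMap comul b₃ fun a b => DFunLike.congr_fun (DFunLike.congr_fun b₄ a) b)
    (AlgHom.ofLinearMap comul' b₃' fun a b => DFunLike.congr_fun (DFunLike.congr_fun b₄' a) b)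
    fun i j => (F₁ i j).trans (F₁' i j).symm
  have e₂ : counit = counit' := congr_arg AlgHom.toLinearMap <| hgen _
    (AlgHom.ofLinearMap counit b₁ fun a b => DFunLike.congr_fun (DFunLike.congr_fun b₂ a) b)
    (AlgHom.ofLinearMap counit' b₁' fun a b => DFunLike.congr_fun (DFunLike.congr_fun b₂' a) b)
    fun i j => (F₂ i j).trans (F₂' i j).symm
  have e₃ : antipode = antipode' := by
    have := hgen _
      (AlgHom.ofLinearMap ((MulOpposite.opLinearEquiv ℂ).toLinearMap ∘ₗ antipode)
        (congr_arg MulOpposite.op s₁) fun a b => congr_arg MulOpposite.op (s₂ a b))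
      (AlgHom.ofLinearMap ((MulOpposite.opLinearEquiv ℂ).toLinearMap ∘ₗ antipode')
        (congr_arg MulOpposite.op s₁') fun a b => congr_arg MulOpposite.op (s₂' a b))
      fun i j => congr_arg MulOpposite.op ((F₃ i j).trans (F₃' i j).symm)
    exact LinearMap.ext fun x => MulOpposite.op_injective (DFunLike.congr_fun this x)
  subst e₁ e₂ e₃
  rfl

end Hopf

end QuantumKronecker

end

/-! ### The main theorem. -/

open QuantumKronecker
theorem mainTheorem8 (n m : ℕ) (hn : 0 < n) (hm : 0 < m) (q : ℝ) (hq : 0 < q)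
    (hqt : Transcendental ℚ q) :
    Module.finrank ℂ (extPow n m q (n * m)) = 1 ∧
    (∀ r s : ℕ, r + s = n * m → (wedgePairing n m q r s).Nondegenerate) ∧
    ∃ D : OM n m q,
      (∀ D' : OM n m q, IsLeftDet D' ↔ D' = D) ∧
      (∀ D' : OM n m q, IsRightDet D' ↔ D' = D) ∧
      ∃ ut : Matrix (Idx n m) (Idx n m) (OM n m q),
        IsPairingMatrix ut ∧
        ut * OM.u n m q = Matrix.diagonal (fun _ => D) ∧
        OM.u n m q * ut = Matrix.diagonal (fun _ => D) ∧
        ∃! H : HopfAlgebra ℂ (OGL D),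
          H.toAlgebra = AdjoinInv.instAlgebra D ∧
          HopfFormulas H ((OM.u n m q).map (AdjoinInv.of D)) (ut.map (AdjoinInv.of D))
            (AdjoinInv.of D D) (AdjoinInv.inv D) := by
  have hq0 : q ≠ 0 := hq.ne'
  -- Since `q > 0`, the equation `q² = 1` would give `q = 1`, which is algebraic. Transcendence
  -- enters only here.
  have hq1 : q ^ 2 ≠ 1 := by
    intro h
    have : q = 1 := by nlinarith
    exact hqt (this ▸ isAlgebraic_one)
  have hnm : 0 < n * m := Nat.mul_pos hn hm
  have h₁ := cofR_mul_u (q := q) hq0 hnm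
  have h₂ := u_mul_cofL (q := q) hq0 hnm
  rw [cofL_eq_cofR hq0 hq1 hnm] at h₂
  refine ⟨finrank_extPow_top hq0, fun r s => wedgePairing_nondegenerate hq0, qdet n m q,
    isLeftDet_iff hq0, isRightDet_iff hq0, cofR q, isPairingMatrix_cofR hq0 hq1 hnm, h₁, h₂, ?_⟩
  obtain ⟨H, hH, hF⟩ := exists_hopfAlgebra (OM.comul_qdet hq0) (OM.counit_qdet hq0) h₁ h₂
  exact ⟨H, ⟨hH, hF⟩, fun H' h' => hopfAlgebra_ext
    (fun C _ _ f g => AdjoinInv.algHom_ext_u) h'.1 hH h'.2 hF⟩
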